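/- Let $\Sigma$ be a compact smooth $3$-manifold and $\mathsf M=\mathbb R\times\Sigma$ with Lorentzian metric $g=-\beta^2dt^2+h_t$, where $\beta>0$ is smooth, $h_t$ is a smooth one-parameter family of Riemannian metrics on $\Sigma$, and $\partial_t$ is future pointing. Let $\iota_t:\Sigma\to\mathsf M$, $x\mapsto(t,x)$. For $s\in\mathbb R$, $y\in\Sigma$ and $\eta\in T_y^*\Sigma\setminus\{0\}$ let $\eta_+$ (resp. $\eta_-$) be the unique future (resp. past) pointing null covector at $(s,y)$ with $\iota_s^*\eta_\pm=\eta$. Let $\tilde X^\pm$ be the null geodesic starting at $(s,y)$ with initial covector $\eta_\pm/\|\eta\|_{h_s}$, let $\tilde\Xi^\pm$ be the parallel transport of $\eta_\pm$ along it, and let $t\mapsto(X^\pm(t;s,y,\eta),\Xi^\pm(t;s,y,\eta))$, $t\in\mathbb R$, be the same curve reparameterised by the global time $t$ (the Levi-Civita flow). Put $x^\pm:=\iota_t^{-1}(X^\pm)$ and $\xi^\pm:=\iota_t^*\Xi^\pm$. Fix for each $Z\in\mathsf M$ a normal neighbourhood $U_Z$, depending smoothly on $Z$ (in particular $\{(Z,X):X\in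 U_Z\}$ is open), and let $\sigma(X,Z)=\frac12 g_Z(\exp_Z^{-1}X,\exp_Z^{-1}X)$, $X\in U_Z$, be the Ruse–Synge world function. Let $\varphi^\pm(t,x;s,y,\eta)$ be Levi-Civita phase functions: smooth complex-valued functions on $\mathsf M\times\mathbb R\times(T^*\Sigma\setminus 0)$ such that $$\varphi^\pm(t,x;s,y,\eta)=-\langle\Xi^\pm,\operatorname{grad}_Z\sigma(X,Z)|_{Z=X^\pm}\rangle+i\,\|\eta\|_{h_s}\,\sigma(X,X^\pm)\qquad(1)$$ whenever $X=(t,x)\in U_{X^\pm}$, $X^\pm=X^\pm(t;s,y,\eta)$, and such that elsewhere $\operatorname{Im}\varphi^\pm\ge0$ and $\partial_\eta\varphi^\pm\neq0$. Then: (a) $\varphi^\pm(t,x;s,y,\lambda\eta)=\lambda\,\varphi^\pm(t,x;s,y,\eta)$ for every $\lambda>0$ and all $(t,x;s,y,\eta)$ with $(t,x)\in U_{X^\pm(t;s,y,\eta)}$. (b) $\varphi^+(t,x;s,y,\eta)=-\overline{\varphi^-(t,x;s,y,-\eta)}$ for all $(t,x;s,y,\eta)$ with $(t,x)\in U_{X^+(t;s,y,\eta)}$.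 Moreover, the continuations can be chosen so that (a) and (b) hold everywhere: there are smaller normal neighbourhoods $U'_Z\subseteq U_Z$, again depending smoothly on $Z$, with the same $\exp_Z^{-1}$ on $U'_Z$, and Levi-Civita phase functions $\psi^\pm$ with respect to them (for the same flows) which satisfy (a) and (b) for all $(t,x;s,y,\eta)$, $\eta\ne0$. (c) For all $t,s\in\mathbb R$, $y\in\Sigma$ and $\eta\in T^*_y\Sigma\setminus\{0\}$, $$\varphi^\pm(t,x^\pm;s,y,\eta)=0,\qquad \operatorname{grad}_x\varphi^\pm(t,x;s,y,\eta)\big|_{x=x^\pm}=\xi^\pm,\qquad \det\Big(\frac{\partial^2\varphi^\pm(t,x;s,y,\eta)}{\partial x^\alpha\partial\eta_\beta}\Big)\Big|_{x=x^\pm}\neq0,$$ where $\operatorname{grad}_x\varphi$ is the covector $\partial_x\varphi$ and the determinant is taken in arbitrary local coordinates at $x^\pm$ and at $y$. -/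

import Mathlib

open scoped Manifold ContDiff Topology
open Set

noncomputable section

namespace LeviCivitaPhase

/-- The model space of the three-dimensional Cauchy surface. -/
abbrev E3 : Type := EuclideanSpace ℝ (Fin 3)

/-! ### Local pseudo-Riemannian geometry -/

/-- The Christoffel symbols (of the second kind) at `p` of a metric `G` given on a normed space (a
coordinate domain), as a bilinear expression in `u` and `v`: the vector `Γ(u, v)` such that
`G(Γ(u, v), w) = (∂_u G(v, w) + ∂_v G(u, w) - ∂_w G(u, v)) / 2` for all `w`. -/
def christoffel {F : Type*} [NormedAddCommGroup F] [NormedSpace ℝ F]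
    (G : F → F →L[ℝ] F →L[ℝ] ℝ) (p u v : F) : F :=
  (G p).inverse ((1 / 2 : ℝ) •
    (fderiv ℝ G p u v + fderiv ℝ G p v u - ((fderiv ℝ G p).flip u).flip v))

section Spacetime

variable {S : Type*} [TopologicalSpace S] [ChartedSpace E3 S]

/-- Tangent space of the Cauchy surface. -/
abbrev TS (x : S) : Type := TangentSpace 𝓘(ℝ, E3) x

/-- Cotangent space of the Cauchy surface. -/
abbrev CoTS (x : S) : Type := TS x →L[ℝ] ℝ

/-- Tangent space of the spacetime `ℝ × S` at `X = (t, x)`, that is `ℝ ∂_t ⊕ T_x S`. -/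
abbrev TM (X : ℝ × S) : Type := ℝ × TS X.2

/-- Cotangent space of the spacetime `ℝ × S`. -/
abbrev CoTM (X : ℝ × S) : Type := TM X →L[ℝ] ℝ

/-- Points of the cotangent bundle of the spacetime. -/
abbrev CotangentM (S : Type*) [TopologicalSpace S] [ChartedSpace E3 S] : Type _ :=
  Σ X : ℝ × S, CoTM X

/-- Pull-back of a bilinear form by a linear map. -/
def pullForm {V W : Type*} [AddCommGroup V] [Module ℝ V] [TopologicalSpace V]
    [IsTopologicalAddGroup V] [ContinuousSMul ℝ V]
    [AddCommGroup W] [Module ℝ W] [TopologicalSpace W]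
    [IsTopologicalAddGroup W] [ContinuousSMul ℝ W]
    (B : W →L[ℝ] W →L[ℝ] ℝ) (D : V →L[ℝ] W) : V →L[ℝ] V →L[ℝ] ℝ :=
  (ContinuousLinearMap.precomp ℝ D).comp (B.comp D)

/-- Differential of the inverse of the chart `e` at the coordinate point `z`. -/
def dSymm (e : OpenPartialHomeomorph S E3) (z : E3) : E3 →L[ℝ] TS (e.symm z) :=
  mfderiv 𝓘(ℝ, E3) 𝓘(ℝ, E3) e.symm z

/-- Differential of the chart `e` at `x`. -/
def dChart (e : OpenPartialHomeomorph S E3) (x : S) : TS x →L[ℝ] E3 :=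
  mfderiv 𝓘(ℝ, E3) 𝓘(ℝ, E3) e x

variable (S) in
/-- The data of a metric `-β² dt² + h_t` on `ℝ × S`: a positive smooth lapse function `β` and a
smooth one-parameter family `h_t` of Riemannian metrics on `S`. -/
structure SpacetimeMetric where
  /-- the lapse function -/
  lapse : ℝ × S → ℝ
  lapse_pos : ∀ X, 0 < lapse X
  lapse_smooth : ContMDiff (𝓘(ℝ, ℝ).prod 𝓘(ℝ, E3)) 𝓘(ℝ, ℝ) ∞ lapse
  /-- the Riemannian metrics `h_t` -/
  h : ℝ → ∀ x : S, TS x →L[ℝ] TS x →L[ℝ] ℝ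
  h_symm : ∀ t x u v, h t x u v = h t x v u
  h_pos : ∀ t x u, u ≠ 0 → 0 < h t x u u
  h_smooth : ∀ e ∈ atlas E3 S,
    ContDiffOn ℝ ∞ (fun p : ℝ × E3 => pullForm (h p.1 (e.symm p.2)) (dSymm e p.2))
      (univ ×ˢ e.target)

namespace SpacetimeMetric

variable (g : SpacetimeMetric S)

/-- The Lorentzian metric `-β² dt² + h_t`. -/
def metric (X : ℝ × S) : TM X →L[ℝ] TM X →L[ℝ] ℝ :=
  (-(g.lapse X) ^ 2) •
      (ContinuousLinearMap.fst ℝ ℝ (TS X.2)).smulRight (ContinuousLinearMap.fst ℝ ℝ (TS X.2))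
    + pullForm (g.h X.1 X.2) (ContinuousLinearMap.snd ℝ ℝ (TS X.2))

/-- The musical isomorphism `♯ : T*_X M → T_X M`. -/
def sharp (X : ℝ × S) : CoTM X →L[ℝ] TM X := (g.metric X).inverse

/-- The norm `‖η‖_{h_s}` of a covector `η` of `S` at `y`. -/
def conorm (s : ℝ) (y : S) (η : CoTS y) : ℝ := √(η ((g.h s y).inverse η))

/-- The Lorentzian metric in the local coordinates `(t, e)` of `ℝ × S`. -/
def metricLoc (e : OpenPartialHomeomorph S E3) (p : ℝ × E3) :
    (ℝ × E3) →L[ℝ] (ℝ × E3) →L[ℝ] ℝ :=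
  pullForm (g.metric (p.1, e.symm p.2)) ((ContinuousLinearMap.id ℝ ℝ).prodMap (dSymm e p.2))

end SpacetimeMetric

/-- A curve in spacetime, in the local coordinates `(t, e)`. -/
def curveLoc (e : OpenPartialHomeomorph S E3) (γ : ℝ → ℝ × S) (τ : ℝ) : ℝ × E3 :=
  ((γ τ).1, e (γ τ).2)

/-- A covector, in the local coordinates `(t, e)`. -/
def covecLoc (e : OpenPartialHomeomorph S E3) (k : CotangentM S) : (ℝ × E3) →L[ℝ] ℝ :=
  k.2.comp ((ContinuousLinearMap.id ℝ ℝ).prodMap (dChart e k.1.2).inverse)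

/-- The velocity of a curve in spacetime. -/
def velocity (γ : ℝ → ℝ × S) (τ : ℝ) : TM (γ τ) :=
  (deriv (fun r => (γ r).1) τ,
    (mfderiv 𝓘(ℝ, ℝ) 𝓘(ℝ, E3) (fun r => (γ r).2) τ : ℝ →L[ℝ] TS (γ τ).2) 1)

namespace SpacetimeMetric

variable (g : SpacetimeMetric S)

/-- `γ` is an (affinely parameterised) geodesic on the open set `J` of parameters. -/
structure IsGeodesicOn (γ : ℝ → ℝ × S) (J : Set ℝ) : Prop where
  smooth : ContMDiffOn 𝓘(ℝ, ℝ) (𝓘(ℝ, ℝ).prod 𝓘(ℝ, E3)) ∞ γ J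
  equation : ∀ e ∈ atlas E3 S, ∀ τ ∈ J, (γ τ).2 ∈ e.source →
    deriv (deriv (curveLoc e γ)) τ =
      -christoffel (g.metricLoc e) (curveLoc e γ τ)
        (deriv (curveLoc e γ) τ) (deriv (curveLoc e γ) τ)

/-- The covector field `c.2` along the curve `c.1` is parallel on the open set `J` of parameters:
`(d/dτ) Ξ(v) = Ξ(Γ(γ', v))` in local coordinates, for constant `v`. -/
def IsParallelOn (c : ℝ → CotangentM S) (J : Set ℝ) : Prop :=
  ∀ e ∈ atlas E3 S, ∀ τ ∈ J, (c τ).1.2 ∈ e.source → ∀ v : ℝ × E3,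
    HasDerivAt (fun r => covecLoc e (c r) v)
      (covecLoc e (c τ)
        (christoffel (g.metricLoc e) (curveLoc e (fun r => (c r).1) τ)
          (deriv (curveLoc e (fun r => (c r).1)) τ) v)) τ

/-- `k = η_ε`: the null covector `k` at `(s, y)`, future pointing for `ε = 1` and past pointing for
`ε = -1` (the vector field `∂_t` being future pointing), restricts to `η` on `T_y S`. -/
structure IsNullLift (ε : ℤˣ) (s : ℝ) (y : S) (η : CoTS y) (k : CoTM (s, y)) : Prop where
  restrict : k.comp (ContinuousLinearMap.inr ℝ ℝ (TS y)) = η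
  null : k (g.sharp (s, y) k) = 0
  pointing : 0 < ((ε : ℤ) : ℝ) * (g.sharp (s, y) k).1

/-- `Φ = (X, Ξ)` is the curve of the positive (`ε = 1`) or negative (`ε = -1`) Levi-Civita flow
starting at `(s, y)` with `η`, parameterised by global time `t`. Here `c` is the same curve in the
affine parameter: its base curve is the geodesic with initial covector `η_ε / ‖η‖`, and its
covector part is the parallel transport of `η_ε`. -/
def IsFlowLine (ε : ℤˣ) (s : ℝ) (y : S) (η : CoTS y) (Φ : ℝ → CotangentM S) : Prop :=
  ∃ (J : Set ℝ) (c : ℝ → CotangentM S) (k : CoTM (s, y)),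
    IsOpen J ∧ IsPreconnected J ∧ (0 : ℝ) ∈ J ∧
    g.IsNullLift ε s y η k ∧
    c 0 = ⟨(s, y), k⟩ ∧
    g.metric (c 0).1 (velocity (fun τ => (c τ).1) 0) = (g.conorm s y η)⁻¹ • (c 0).2 ∧
    g.IsGeodesicOn (fun τ => (c τ).1) J ∧
    g.IsParallelOn c J ∧
    ∀ t : ℝ, ∃ τ ∈ J, (c τ).1.1 = t ∧ Φ t = c τ

/-- `Φ s y η t = (X(t; s, y, η), Ξ(t; s, y, η))` is the positive (`ε = 1`) or negative (`ε = -1`)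
Levi-Civita flow, parameterised by global time. -/
def IsLeviCivitaFlow (ε : ℤˣ) (Φ : ℝ → ∀ y : S, CoTS y → ℝ → CotangentM S) : Prop :=
  ∀ (s : ℝ) (y : S) (η : CoTS y), η ≠ 0 → g.IsFlowLine ε s y η (Φ s y η)

/-- A choice, for each `Z` in spacetime, of a normal neighbourhood `{X | (Z, X) ∈ dom}` of `Z`,
depending smoothly on `Z`; `log Z` is the inverse of the exponential map `exp_Z` there. The field
`geodesic` says that `log Z X` is the initial velocity of a geodesic running from `Z` to `X` in
unit parameter time inside the neighbourhood, and that the image of `log Z` is star-shaped, each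
`r • log Z X` being the logarithm of the corresponding point of that geodesic. -/
structure NormalNeighbourhoods where
  /-- the pairs `(Z, X)` with `X` in the normal neighbourhood of `Z` -/
  dom : Set ((ℝ × S) × (ℝ × S))
  isOpen_dom : IsOpen dom
  diag_mem : ∀ Z, (Z, Z) ∈ dom
  /-- the inverse of the exponential map at the first argument -/
  log : ∀ Z : ℝ × S, ℝ × S → TM Z
  geodesic : ∀ Z X, (Z, X) ∈ dom → ∃ (J : Set ℝ) (γ : ℝ → ℝ × S),
    IsOpen J ∧ Icc 0 1 ⊆ J ∧ g.IsGeodesicOn γ J ∧ γ 0 = Z ∧ γ 1 = X ∧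
    (⟨γ 0, velocity γ 0⟩ : Σ Y : ℝ × S, TM Y) = ⟨Z, log Z X⟩ ∧
    ∀ r ∈ Icc (0 : ℝ) 1, (Z, γ r) ∈ dom ∧ log Z (γ r) = r • log Z X
  log_smooth : ∀ e ∈ atlas E3 S, ∀ f ∈ atlas E3 S,
    ContDiffOn ℝ ∞
      (fun q : (ℝ × E3) × (ℝ × E3) =>
        let v := log (q.1.1, e.symm q.1.2) (q.2.1, f.symm q.2.2)
        ((v.1, dChart e (e.symm q.1.2) v.2) : ℝ × E3))
      {q | q.1.2 ∈ e.target ∧ q.2.2 ∈ f.target ∧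
        ((q.1.1, e.symm q.1.2), (q.2.1, f.symm q.2.2)) ∈ dom}

variable {g}

/-- The Ruse–Synge world function `σ(X, Z)`: half of the signed squared length of the geodesic
from `Z` to `X` in the normal neighbourhood of `Z`. -/
def NormalNeighbourhoods.worldFunction (N : g.NormalNeighbourhoods) (X Z : ℝ × S) : ℝ :=
  (1 / 2) * g.metric Z (N.log Z X) (N.log Z X)

/-- The gradient at `Z` of the world function with respect to its second argument. -/
def NormalNeighbourhoods.gradWorldFunction (N : g.NormalNeighbourhoods) (X Z : ℝ × S) : TM Z :=
  g.sharp Z (mfderiv (𝓘(ℝ, ℝ).prod 𝓘(ℝ, E3)) 𝓘(ℝ, ℝ) (fun Z' => N.worldFunction X Z') Z)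

end SpacetimeMetric

variable (S) in
/-- Complex-valued functions `φ t x s y η` on `M × ℝ × T*S`. -/
abbrev PhaseFunction : Type _ := ℝ → S → ℝ → ∀ y : S, CoTS y → ℂ

/-- The derivative `∂φ/∂η` in the direction of the covector `ζ`. -/
def PhaseFunction.dEta (φ : PhaseFunction S) (t : ℝ) (x : S) (s : ℝ) (y : S) (η ζ : CoTS y) : ℂ :=
  deriv (fun r : ℝ => φ t x s y (η + r • ζ)) 0

/-- The differential of `φ` in `x`. -/
def PhaseFunction.dX (φ : PhaseFunction S) (t : ℝ) (x : S) (s : ℝ) (y : S) (η : CoTS y) :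
    TS x →L[ℝ] ℂ :=
  mfderiv 𝓘(ℝ, E3) 𝓘(ℝ, ℂ) (fun x' => φ t x' s y η) x

/-- The matrix `∂²φ/∂x^α ∂η_β` with respect to a basis `b` of `T_x S` (such as the coordinate
vectors of a chart around `x`) and a basis `c` of `T*_y S` (such as the coordinate covectors of a
chart around `y`). -/
def PhaseFunction.mixedHessian (φ : PhaseFunction S) (t : ℝ) (x : S) (s : ℝ) (y : S) (η : CoTS y)
    (b : Module.Basis (Fin 3) ℝ (TS x)) (c : Module.Basis (Fin 3) ℝ (CoTS y)) :
    Matrix (Fin 3) (Fin 3) ℂ :=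
  Matrix.of fun α β =>
    (mfderiv 𝓘(ℝ, E3) 𝓘(ℝ, ℂ) (fun x' => φ.dEta t x' s y η (c β)) x : TS x →L[ℝ] ℂ) (b α)

/-- Smoothness of `φ` on `M × ℝ × (T*S ∖ 0)`, in local coordinates `(t, z, s, w, p)`, where `z` and
`w` are coordinates of `x` and `y` and `p` are the canonical coordinates of `η`. -/
def PhaseFunction.IsSmooth (φ : PhaseFunction S) : Prop :=
  ∀ e ∈ atlas E3 S, ∀ f ∈ atlas E3 S,
    ContDiffOn ℝ ∞
      (fun q : ℝ × E3 × ℝ × E3 × (E3 →L[ℝ] ℝ) =>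
        φ q.1 (e.symm q.2.1) q.2.2.1 (f.symm q.2.2.2.1)
          (q.2.2.2.2.comp (dChart f (f.symm q.2.2.2.1))))
      {q | q.2.1 ∈ e.target ∧ q.2.2.2.1 ∈ f.target ∧ q.2.2.2.2 ≠ 0}

/-- `φ` is a Levi-Civita phase function for the flow `Φ`: it is smooth, it is given by
`-⟨Ξ, grad_Z σ(X, Z)|_{Z = X(t)}⟩ + i ‖η‖ σ(X, X(t))` for `X = (t, x)` in the normal
neighbourhood of `X(t) = X(t; s, y, η)`, and elsewhere `Im φ ≥ 0` and `∂φ/∂η ≠ 0`. -/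
structure IsLeviCivitaPhase {g : SpacetimeMetric S} (N : g.NormalNeighbourhoods)
    (Φ : ℝ → ∀ y : S, CoTS y → ℝ → CotangentM S) (φ : PhaseFunction S) : Prop where
  smooth : φ.IsSmooth
  formula : ∀ (t : ℝ) (x : S) (s : ℝ) (y : S) (η : CoTS y), η ≠ 0 →
    ((Φ s y η t).1, (t, x)) ∈ N.dom →
    φ t x s y η =
      -(((Φ s y η t).2 (N.gradWorldFunction (t, x) (Φ s y η t).1) : ℝ) : ℂ)
        + Complex.I * (g.conorm s y η : ℂ) * (N.worldFunction (t, x) (Φ s y η t).1 : ℂ)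
  im_nonneg : ∀ (t : ℝ) (x : S) (s : ℝ) (y : S) (η : CoTS y), η ≠ 0 →
    ((Φ s y η t).1, (t, x)) ∉ N.dom → 0 ≤ (φ t x s y η).im
  dEta_ne_zero : ∀ (t : ℝ) (x : S) (s : ℝ) (y : S) (η : CoTS y), η ≠ 0 →
    ((Φ s y η t).1, (t, x)) ∉ N.dom → ∃ ζ : CoTS y, φ.dEta t x s y η ζ ≠ 0

end Spacetime

end LeviCivitaPhase

end

noncomputable section

set_option maxSynthPendingDepth 3

namespace LeviCivitaPhase

section Wrappers

variable {P W : Type*} [NormedAddCommGroup P] [NormedSpace ℝ P] [NormedAddCommGroup W]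
  [NormedSpace ℝ W] {x : P} {n : WithTop ℕ∞}

/-! Symmetries. Along a flow line the covector `Ξ` and `‖η‖` times the metric dual of the velocity
are both parallel and agree initially, so `Ξ` is null and its raised time component never vanishes.
Hence the global time is an admissible parameter, and in it the flow line solves the first-order
system `flowField`, whose base direction depends only on the line spanned by `Ξ`. Uniqueness for
this system (`IsTimeFlow.unique`) together with uniqueness of the null lift shows that scaling `η`
scales `Ξ`, while `η ↦ -η` exchanges the two flows and changes the sign of `Ξ`. Inserting this into
(1) gives (a) and (b).

Jets along the flow. In coordinates the logarithm `L` vanishes on the diagonal and has derivative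
`dX - dZ` there (`hasFDerivAt_logLoc`). Since `σ = G(L, L) / 2`, both first derivatives of `σ`
vanish on the diagonal, the mixed second derivative is `-G` and the second derivative in `X` is `G`.
So `φ = 0` and `∂_x φ = ξ` along the flow, and the imaginary part of the Hessian `φ_xx` is `‖η‖ h`,
which is positive definite.

Smoothness of the flow. The definition of the flow contains no dependence on initial data; this is
recovered from the smoothness of `φ`. Two distinct points at the same time are joined, inside a
normal neighbourhood, by a spacelike geodesic, so there `Im φ = ‖η‖ σ` vanishes only at the flow
point. Isolated zeros, a known initial point and compactness of the Cauchy surface give continuity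
(`continuousAt_zero_curve`). The implicit function theorem for `Im ∂_x φ = 0` then makes the
position smooth, and `ξ = ∂_x φ` at that position is smooth too.

Nondegeneracy. Differentiating `∂_x φ (x(η), η) = ξ(η)` gives `φ_xη = ξ_η - φ_xx x_η`. The pairing
`⟨ξ, x_η⟩` is constant in time, because the flow is null and `Ξ` is parallel, and it is zero
initially. One more derivative makes `ξ_η(δ)(x_η δ')` symmetric in `δ, δ'`. If `φ_xη` kills `δ + i
δ'`, pairing with `x_η δ` and `x_η δ'` and using this symmetry leaves `Im φ_xx(x_η δ, x_η δ) + Im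
φ_xx(x_η δ', x_η δ') = 0`. So `x_η` kills both variations, hence so does `ξ_η`, and running the flow
backwards gives `δ = δ' = 0`.

Global continuation. With a cut-off `κ` equal to `0` on the diagonal and `1` off the normal
neighbourhoods, put `ψ⁺(η) = ‖η‖ (φ⁺(η / ‖η‖) + i χ(κ - 1/2))`, where `χ` is smooth, zero on `(-∞,
0]` and positive on `(0, ∞)`. It is homogeneous by construction, agrees with `φ⁺` on smaller
neighbourhoods where `κ < 1/2`, and has positive imaginary part outside them. There Euler's relation
turns `ψ⁺ ≠ 0` into `∂_η ψ⁺ ≠ 0`. Taking `ψ⁻(η) = -conj ψ⁺(-η)` makes (b) hold identically. -/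

lemma contDiffAt_fun_smul {a : P → ℝ} {f : P → W} (ha : ContDiffAt ℝ n a x)
    (hf : ContDiffAt ℝ n f x) : ContDiffAt ℝ n (fun p => a p • f p) x := ha.smul hf

lemma contDiffAt_fun_add {a f : P → W} (ha : ContDiffAt ℝ n a x)
    (hf : ContDiffAt ℝ n f x) : ContDiffAt ℝ n (fun p => a p + f p) x := ha.add hf

lemma contDiffAt_fun_sub {a f : P → W} (ha : ContDiffAt ℝ n a x)
    (hf : ContDiffAt ℝ n f x) : ContDiffAt ℝ n (fun p => a p - f p) x := ha.sub hf

end Wrappers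

lemma contDiffAt_warped {P A E : Type*} [NormedAddCommGroup P] [NormedSpace ℝ P]
    [NormedAddCommGroup A] [NormedSpace ℝ A]
    [NormedAddCommGroup E] [NormedSpace ℝ E] {a : P → ℝ} {H : P → E →L[ℝ] E →L[ℝ] ℝ} {p : P}
    (π : A →L[ℝ] ℝ) (π' : A →L[ℝ] E) (ha : ContDiffAt ℝ ∞ a p) (hH : ContDiffAt ℝ ∞ H p) :
    ContDiffAt ℝ ∞ (fun p => (-(a p) ^ 2) • π.smulRight π
      + (ContinuousLinearMap.precomp ℝ π').comp ((H p).comp π')) p :=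
  contDiffAt_fun_add (contDiffAt_fun_smul (ha.pow 2).neg contDiffAt_const)
    (contDiffAt_const.clm_comp (hH.clm_comp contDiffAt_const))

/-! ### The metric, tangent vectors and covectors in charts. -/

section Charts

variable {S : Type*} [TopologicalSpace S] [ChartedSpace E3 S]

/-- The coordinates `(t, e x)` of a point of spacetime. -/
def ptLoc (e : OpenPartialHomeomorph S E3) (X : ℝ × S) : ℝ × E3 := (X.1, e X.2)

/-- The coordinates of a tangent vector of spacetime. -/
def vecLoc (e : OpenPartialHomeomorph S E3) (X : ℝ × S) : TM X →L[ℝ] ℝ × E3 :=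
  (ContinuousLinearMap.id ℝ ℝ).prodMap (dChart e X.2)

/-- The metric `h_t` in local coordinates. -/
def hLoc (g : SpacetimeMetric S) (e : OpenPartialHomeomorph S E3) (p : ℝ × E3) :
    E3 →L[ℝ] E3 →L[ℝ] ℝ :=
  pullForm (g.h p.1 (e.symm p.2)) (dSymm e p.2)

variable (g : SpacetimeMetric S) {e : OpenPartialHomeomorph S E3}

lemma hLoc_apply (p : ℝ × E3) (u v : E3) :
    hLoc g e p u v = g.h p.1 (e.symm p.2) (dSymm e p.2 u) (dSymm e p.2 v) := rfl

lemma metric_apply (X : ℝ × S) (u v : TM X) :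
    g.metric X u v = -(g.lapse X) ^ 2 * (u.1 * v.1) + g.h X.1 X.2 u.2 v.2 := by
  simp [SpacetimeMetric.metric, pullForm]

lemma metricLoc_apply (p u v : ℝ × E3) :
    g.metricLoc e p u v = -(g.lapse (p.1, e.symm p.2)) ^ 2 * (u.1 * v.1) + hLoc g e p u.2 v.2 := by
  simp [SpacetimeMetric.metricLoc, SpacetimeMetric.metric, pullForm, hLoc]

lemma metricLoc_symm (p u v : ℝ × E3) : g.metricLoc e p u v = g.metricLoc e p v u := by
  rw [metricLoc_apply, metricLoc_apply, hLoc_apply, hLoc_apply, g.h_symm, mul_comm u.1]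

lemma vecLoc_fst (X : ℝ × S) (v : TM X) : (vecLoc e X v).1 = v.1 := rfl

lemma vecLoc_snd (X : ℝ × S) (v : TM X) : (vecLoc e X v).2 = dChart e X.2 v.2 := rfl

/-- Injectivity is enough because `V` and its dual have equal finite dimension. In this form it
serves the indefinite spacetime metric as well as the definite `h_t`. -/
lemma isInvertible_of_pos_diag {V : Type*} [NormedAddCommGroup V] [NormedSpace ℝ V]
    [FiniteDimensional ℝ V] {B : V →L[ℝ] V →L[ℝ] ℝ} (hB : ∀ v, B v = 0 → v = 0) :
    B.IsInvertible := by
  have hinj : Function.Injective (B : V →ₗ[ℝ] V →L[ℝ] ℝ) := by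
    rw [← LinearMap.ker_eq_bot, LinearMap.ker_eq_bot']
    exact hB
  have hdim : Module.finrank ℝ V = Module.finrank ℝ (V →L[ℝ] ℝ) := by
    rw [← LinearMap.toContinuousLinearMap.finrank_eq (R := ℝ) (M := V →ₗ[ℝ] ℝ)]
    exact (Subspace.dual_finrank_eq (K := ℝ) (V := V)).symm
  refine ⟨((B : V →ₗ[ℝ] V →L[ℝ] ℝ).linearEquivOfInjective hinj hdim).toContinuousLinearEquiv, ?_⟩
  ext v w
  rfl

lemma eq_zero_of_h_eq_zero {t : ℝ} {x : S} {u : TS x} (hu : g.h t x u = 0) : u = 0 := by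
  by_contra hne
  have := g.h_pos t x u hne
  rw [hu] at this
  exact lt_irrefl _ this

lemma h_isInvertible (t : ℝ) (x : S) : (g.h t x).IsInvertible :=
  isInvertible_of_pos_diag (V := E3) (B := g.h t x) fun _ hv => eq_zero_of_h_eq_zero g hv

lemma eq_zero_of_metric_eq_zero {X : ℝ × S} {v : TM X} (hv : g.metric X v = 0) : v = 0 := by
  have h1 : g.metric X v (v.1, 0) = 0 := by rw [hv]; rfl
  have h2 : g.metric X v (0, v.2) = 0 := by rw [hv]; rfl
  rw [metric_apply] at h1 h2
  have hl := g.lapse_pos X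
  have h3 : v.1 = 0 := by
    simp only [map_zero, add_zero] at h1
    have : v.1 * v.1 = 0 := by
      rcases mul_eq_zero.1 h1 with h | h
      · exact absurd h (by have := pow_pos hl 2; linarith)
      · exact h
    simpa using this
  have h4 : v.2 = 0 := by
    by_contra hne
    have := g.h_pos X.1 X.2 v.2 hne
    simp only [mul_zero, zero_add] at h2
    linarith
  exact Prod.ext h3 h4

lemma metric_isInvertible (X : ℝ × S) : (g.metric X).IsInvertible :=
  isInvertible_of_pos_diag (V := ℝ × E3) (B := g.metric X)
    fun _ hv => eq_zero_of_metric_eq_zero g hv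

lemma metric_sharp (X : ℝ × S) (k : CoTM X) : g.metric X (g.sharp X k) = k :=
  (metric_isInvertible g X).self_apply_inverse k

lemma sharp_metric (X : ℝ × S) (v : TM X) : g.sharp X (g.metric X v) = v :=
  (metric_isInvertible g X).inverse_apply_self v

variable [IsManifold 𝓘(ℝ, E3) ∞ S]

lemma chart_mdiff (he : e ∈ atlas E3 S) : e.MDifferentiable 𝓘(ℝ, E3) 𝓘(ℝ, E3) :=
  have : IsManifold 𝓘(ℝ, E3) 1 S := .of_le (n := ∞) (by norm_num)
  mdifferentiable_of_mem_atlas he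

lemma dChart_dSymm (he : e ∈ atlas E3 S) {z : E3} (hz : z ∈ e.target) (u : E3) :
    dChart e (e.symm z) (dSymm e z u) = u :=
  DFunLike.congr_fun ((chart_mdiff he).comp_symm_deriv hz) u

lemma dSymm_dChart (he : e ∈ atlas E3 S) {z : E3} (hz : z ∈ e.target) (u : TS (e.symm z)) :
    dSymm e z (dChart e (e.symm z) u) = u := by
  have h := DFunLike.congr_fun ((chart_mdiff he).symm_comp_deriv (e.map_target hz)) u
  rw [e.right_inv hz] at h
  exact h

lemma dSymm_bijective (he : e ∈ atlas E3 S) {z : E3} (hz : z ∈ e.target) :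
    Function.Bijective (dSymm e z) :=
  ⟨Function.LeftInverse.injective (dChart_dSymm he hz),
    Function.RightInverse.surjective (dSymm_dChart he hz)⟩

/-- The differential of a chart, as an isomorphism. -/
def dChartEquiv (he : e ∈ atlas E3 S) {x : S} (hx : x ∈ e.source) : TS x ≃L[ℝ] E3 :=
  (chart_mdiff he).mfderiv hx

lemma dChart_inverse (he : e ∈ atlas E3 S) {x : S} (hx : x ∈ e.source) :
    (dChart e x).inverse = (dChartEquiv he hx).symm := by
  have : dChart e x = (dChartEquiv he hx : TS x →L[ℝ] E3) := rfl
  rw [this, ContinuousLinearMap.inverse_equiv]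

lemma dChart_bijective (he : e ∈ atlas E3 S) {x : S} (hx : x ∈ e.source) :
    Function.Bijective (dChart e x) := (dChartEquiv he hx).bijective

lemma dChart_inverse_apply (he : e ∈ atlas E3 S) {x : S} (hx : x ∈ e.source) (u : TS x) :
    (dChart e x).inverse (dChart e x u) = u := by
  rw [dChart_inverse he hx]
  exact (dChartEquiv he hx).symm_apply_apply u

lemma vecLoc_bijective (he : e ∈ atlas E3 S) {X : ℝ × S} (hX : X.2 ∈ e.source) :
    Function.Bijective (vecLoc e X) := by
  have hb := dChart_bijective he hX
  refine ⟨fun v w h => ?_, fun u => ?_⟩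
  · have h1 : v.1 = w.1 := by rw [← vecLoc_fst (e := e) X v, h, vecLoc_fst]
    have h2 : dChart e X.2 v.2 = dChart e X.2 w.2 := by rw [← vecLoc_snd X v, h, vecLoc_snd]
    exact Prod.ext h1 (hb.1 h2)
  · obtain ⟨w, hw⟩ := hb.2 u.2
    exact ⟨(u.1, w), Prod.ext rfl hw⟩

lemma covecLoc_vecLoc (he : e ∈ atlas E3 S) {X : ℝ × S} (hX : X.2 ∈ e.source) (k : CoTM X)
    (v : TM X) : covecLoc e ⟨X, k⟩ (vecLoc e X v) = k v := by
  change k (v.1, (dChart e X.2).inverse (dChart e X.2 v.2)) = k v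
  rw [dChart_inverse_apply he hX]

lemma covecLoc_injective (he : e ∈ atlas E3 S) {X : ℝ × S} (hX : X.2 ∈ e.source) {k l : CoTM X}
    (h : covecLoc e ⟨X, k⟩ = covecLoc e ⟨X, l⟩) : k = l := by
  refine ContinuousLinearMap.ext fun v => ?_
  rw [← covecLoc_vecLoc he hX k, ← covecLoc_vecLoc he hX l, h]

lemma metricLoc_vecLoc (he : e ∈ atlas E3 S) {X : ℝ × S} (hX : X.2 ∈ e.source) (v w : TM X) :
    g.metricLoc e (ptLoc e X) (vecLoc e X v) (vecLoc e X w) = g.metric X v w := by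
  obtain ⟨t, x⟩ := X
  obtain ⟨z, hz, rfl⟩ : ∃ z ∈ e.target, e.symm z = x :=
    ⟨e x, e.map_source hX, e.left_inv hX⟩
  have hp : ptLoc e (t, e.symm z) = (t, z) := Prod.ext rfl (e.right_inv hz)
  have hd : ∀ v : TM (t, e.symm z), dSymm e z (vecLoc e (t, e.symm z) v).2 = v.2 :=
    fun v => dSymm_dChart he hz v.2
  rw [hp, metricLoc_apply, metric_apply, hLoc_apply]
  simp only [hd, vecLoc_fst]

lemma covecLoc_metric (he : e ∈ atlas E3 S) {X : ℝ × S} (hX : X.2 ∈ e.source) (v : TM X) :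
    covecLoc e ⟨X, g.metric X v⟩ = g.metricLoc e (ptLoc e X) (vecLoc e X v) := by
  apply ContinuousLinearMap.ext
  intro u
  obtain ⟨w, rfl⟩ := (vecLoc_bijective he hX).2 u
  rw [covecLoc_vecLoc he hX, metricLoc_vecLoc g he hX]

lemma hLoc_pos (he : e ∈ atlas E3 S) {p : ℝ × E3} (hp : p.2 ∈ e.target) {u : E3} (hu : u ≠ 0) :
    0 < hLoc g e p u u := by
  rw [hLoc_apply]
  refine g.h_pos _ _ _ fun h => hu ?_
  exact (dSymm_bijective he hp).1 (h.trans (map_zero _).symm)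

lemma metricLoc_isInvertible (he : e ∈ atlas E3 S) {p : ℝ × E3} (hp : p.2 ∈ e.target) :
    (g.metricLoc e p).IsInvertible := by
  refine isInvertible_of_pos_diag fun v hv => ?_
  have hs : (p.1, e.symm p.2).2 ∈ e.source := e.map_target hp
  obtain ⟨w, rfl⟩ := (vecLoc_bijective he (X := (p.1, e.symm p.2)) hs).2 v
  have h0 : g.metric (p.1, e.symm p.2) w = 0 := by
    apply ContinuousLinearMap.ext
    intro u
    rw [← metricLoc_vecLoc g he hs]
    have : ptLoc e (p.1, e.symm p.2) = p := by simp [ptLoc, e.right_inv hp]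
    rw [this, hv]
    rfl
  rw [eq_zero_of_metric_eq_zero g h0, map_zero]

lemma vecLoc_sharp (he : e ∈ atlas E3 S) {X : ℝ × S} (hX : X.2 ∈ e.source) (k : CoTM X) :
    vecLoc e X (g.sharp X k) = (g.metricLoc e (ptLoc e X)).inverse (covecLoc e ⟨X, k⟩) := by
  have h := covecLoc_metric g he hX (g.sharp X k)
  rw [metric_sharp] at h
  rw [h, (metricLoc_isInvertible g he (p := ptLoc e X) (e.map_source hX)).inverse_apply_self]

omit [IsManifold 𝓘(ℝ, E3) ∞ S] in
lemma contDiffOn_hLoc (he : e ∈ atlas E3 S) :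
    ContDiffOn ℝ ∞ (hLoc g e) (univ ×ˢ e.target) := g.h_smooth e he

lemma contMDiffAt_symm_prod (he : e ∈ atlas E3 S) {p : ℝ × E3} (hp : p.2 ∈ e.target) :
    ContMDiffAt 𝓘(ℝ, ℝ × E3) (𝓘(ℝ, ℝ).prod 𝓘(ℝ, E3)) ∞
      (fun p : ℝ × E3 => ((p.1, e.symm p.2) : ℝ × S)) p := by
  refine ContMDiffAt.prodMk contDiffAt_fst.contMDiffAt ?_
  have h1 : ContMDiffAt 𝓘(ℝ, E3) 𝓘(ℝ, E3) ∞ e.symm p.2 :=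
    (contMDiffOn_symm_of_mem_maximalAtlas (IsManifold.subset_maximalAtlas he)).contMDiffAt
      (e.open_target.mem_nhds hp)
  exact h1.comp p (contDiffAt_snd.contMDiffAt)

lemma contDiffAt_metricLoc (he : e ∈ atlas E3 S) {p : ℝ × E3} (hp : p.2 ∈ e.target) :
    ContDiffAt ℝ ∞ (g.metricLoc e) p := by
  have h1 : ContDiffAt ℝ ∞ (fun p : ℝ × E3 => g.lapse (p.1, e.symm p.2)) p :=
    ((g.lapse_smooth.contMDiffAt).comp p (contMDiffAt_symm_prod he hp)).contDiffAt
  have h2 : ContDiffAt ℝ ∞ (hLoc g e) p :=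
    (contDiffOn_hLoc g he).contDiffAt
      ((isOpen_univ.prod e.open_target).mem_nhds ⟨mem_univ _, hp⟩)
  have h3 : g.metricLoc e = fun p => (-(g.lapse (p.1, e.symm p.2)) ^ 2) •
      (ContinuousLinearMap.fst ℝ ℝ E3).smulRight (ContinuousLinearMap.fst ℝ ℝ E3)
      + (ContinuousLinearMap.precomp ℝ (ContinuousLinearMap.snd ℝ ℝ E3)).comp
        ((hLoc g e p).comp (ContinuousLinearMap.snd ℝ ℝ E3)) := by
    funext p
    apply ContinuousLinearMap.ext; intro u
    apply ContinuousLinearMap.ext; intro v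
    rw [metricLoc_apply]
    simp
  rw [h3]
  exact contDiffAt_warped _ _ h1 h2

end Charts

/-! ### Christoffel symbols as smooth bilinear maps. -/

section Christoffel

variable {F : Type*} [NormedAddCommGroup F] [NormedSpace ℝ F]

/-- The Christoffel symbols with lowered index, up to the factor `1 / 2`. -/
def christoffelLow (D : F →L[ℝ] F →L[ℝ] F →L[ℝ] ℝ) : F →L[ℝ] F →L[ℝ] F →L[ℝ] ℝ :=
  D + D.flip - (ContinuousLinearMap.flipₗᵢ ℝ F F ℝ : (F →L[ℝ] F →L[ℝ] ℝ) →L[ℝ] _).comp D.flip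

/-- The Christoffel symbols as a continuous bilinear map. -/
def christoffelL (G : F → F →L[ℝ] F →L[ℝ] ℝ) (p : F) : F →L[ℝ] F →L[ℝ] F :=
  (ContinuousLinearMap.compL ℝ F (F →L[ℝ] ℝ) F ((G p).inverse)).comp
    ((1 / 2 : ℝ) • christoffelLow (fderiv ℝ G p))

lemma christoffelL_apply (G : F → F →L[ℝ] F →L[ℝ] ℝ) (p u v : F) :
    christoffelL G p u v = christoffel G p u v := rfl

lemma metric_christoffel {G : F → F →L[ℝ] F →L[ℝ] ℝ} {p : F} (hG : (G p).IsInvertible)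
    (u v w : F) : G p (christoffel G p u v) w =
      (fderiv ℝ G p u v w + fderiv ℝ G p v u w - fderiv ℝ G p w u v) / 2 := by
  rw [christoffel, hG.self_apply_inverse]
  simp
  ring

lemma contDiff_christoffelLow [FiniteDimensional ℝ F] :
    ContDiff ℝ ∞ (christoffelLow : (F →L[ℝ] F →L[ℝ] F →L[ℝ] ℝ) → _) := by
  have hf : ContDiff ℝ ∞ (fun D : F →L[ℝ] F →L[ℝ] F →L[ℝ] ℝ => D.flip) :=
    (ContinuousLinearMap.flipₗᵢ ℝ F F (F →L[ℝ] ℝ)).contDiff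
  refine contDiff_iff_contDiffAt.2 fun D => ?_
  exact contDiffAt_fun_sub (contDiffAt_fun_add contDiffAt_id hf.contDiffAt)
    (contDiffAt_const.clm_comp hf.contDiffAt)

lemma contDiffAt_christoffelL [FiniteDimensional ℝ F] {G : F → F →L[ℝ] F →L[ℝ] ℝ} {p : F}
    (hs : ContDiffAt ℝ ∞ G p) (hG : (G p).IsInvertible) :
    ContDiffAt ℝ ∞ (christoffelL G) p := by
  have : CompleteSpace F := FiniteDimensional.complete ℝ F
  have h1 : ContDiffAt ℝ ∞ (fun p => (G p).inverse) p := (hG.contDiffAt_map_inverse).comp p hs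
  have h2 : ContDiffAt ℝ ∞ (fun p => christoffelLow (fderiv ℝ G p)) p :=
    (contDiff_christoffelLow.contDiffAt).comp p (hs.fderiv_right (m := ∞) (by simp))
  exact (((ContinuousLinearMap.compL ℝ F (F →L[ℝ] ℝ) F).contDiff.contDiffAt).comp p h1).clm_comp
    (contDiffAt_fun_smul contDiffAt_const h2)

/-- Differentiability of a family of functionals can be tested on vectors. -/
lemma hasDerivAt_of_forall_apply [FiniteDimensional ℝ F] {D : ℝ → F →L[ℝ] ℝ} {D' : F →L[ℝ] ℝ}
    {τ : ℝ} (h : ∀ v, HasDerivAt (fun r => D r v) (D' v) τ) : HasDerivAt D D' τ := by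
  let b := Module.finBasis ℝ F
  let Λ : (F →L[ℝ] ℝ) ≃ₗ[ℝ] (Fin (Module.finrank ℝ F) → ℝ) :=
    (LinearMap.toContinuousLinearMap (𝕜 := ℝ) (E := F) (F' := ℝ)).symm.trans (b.constr ℝ).symm
  let L := Λ.toContinuousLinearEquiv
  have h1 : HasDerivAt (fun r => L (D r)) (L D') τ := by
    refine hasDerivAt_pi.2 fun i => ?_
    exact h (b i)
  have h2 := (L.symm : _ →L[ℝ] F →L[ℝ] ℝ).hasFDerivAt.comp_hasDerivAt τ h1
  have h3 : (⇑(L.symm : _ →L[ℝ] F →L[ℝ] ℝ) ∘ fun r => L (D r)) = D := by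
    funext r; exact L.symm_apply_apply _
  rw [h3] at h2
  have h4 : (L.symm : _ →L[ℝ] F →L[ℝ] ℝ) (L D') = D' := L.symm_apply_apply _
  rwa [h4] at h2

/-- A predicate that is locally constant along a preconnected set is constant there. -/
lemma iff_of_isPreconnected {I : Set ℝ} (hI : IsPreconnected I) {P : ℝ → Prop}
    (h : ∀ τ ∈ I, ∀ᶠ r in 𝓝 τ, (P τ ↔ P r)) {a b : ℝ} (ha : a ∈ I) (hb : b ∈ I) : P a ↔ P b :=
  hI.induction₂ (fun x y => P x ↔ P y) (fun x hx => (h x hx).filter_mono nhdsWithin_le_nhds)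
    (fun _ _ _ _ _ _ h1 h2 => h1.trans h2) (fun _ _ _ _ h => h.symm) ha hb

end Christoffel

/-! ### The flow parameterised by time as a vector field on covectors. -/

section Field

variable {E : Type*} [NormedAddCommGroup E] [NormedSpace ℝ E] [FiniteDimensional ℝ E]

/-- The direction `ξ♯ / (ξ♯)_t` with unit time component. -/
def flowDir (G : ℝ × E → (ℝ × E) →L[ℝ] (ℝ × E) →L[ℝ] ℝ)
    (q : (ℝ × E) × ((ℝ × E) →L[ℝ] ℝ)) : ℝ × E :=
  ((G q.1).inverse q.2).1⁻¹ • (G q.1).inverse q.2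

/-- The vector field of the Levi-Civita flow parameterised by time. -/
def flowField (G : ℝ × E → (ℝ × E) →L[ℝ] (ℝ × E) →L[ℝ] ℝ)
    (q : (ℝ × E) × ((ℝ × E) →L[ℝ] ℝ)) : (ℝ × E) × ((ℝ × E) →L[ℝ] ℝ) :=
  (flowDir G q, q.2.comp (christoffelL G q.1 (flowDir G q)))

/-- Dividing by the time component of the raised covector is the only obstruction to smoothness,
hence the hypothesis `hq`; along null bicharacteristics it always holds. -/
lemma contDiffAt_flowField {G : ℝ × E → (ℝ × E) →L[ℝ] (ℝ × E) →L[ℝ] ℝ}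
    {q : (ℝ × E) × ((ℝ × E) →L[ℝ] ℝ)} (hs : ContDiffAt ℝ ∞ G q.1) (hG : (G q.1).IsInvertible)
    (hq : ((G q.1).inverse q.2).1 ≠ 0) : ContDiffAt ℝ ∞ (flowField G) q := by
  have : CompleteSpace E := FiniteDimensional.complete ℝ E
  have h1 : ContDiffAt ℝ ∞ (fun q : (ℝ × E) × ((ℝ × E) →L[ℝ] ℝ) => (G q.1).inverse) q :=
    ((hG.contDiffAt_map_inverse).comp q.1 hs).comp q contDiffAt_fst
  have h2 : ContDiffAt ℝ ∞
      (fun q : (ℝ × E) × ((ℝ × E) →L[ℝ] ℝ) => (G q.1).inverse q.2) q :=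
    h1.clm_apply contDiffAt_snd
  have h3 : ContDiffAt ℝ ∞ (flowDir G) q :=
    contDiffAt_fun_smul ((h2.fst).inv hq) h2
  have h4 : ContDiffAt ℝ ∞
      (fun q : (ℝ × E) × ((ℝ × E) →L[ℝ] ℝ) => christoffelL G q.1) q :=
    (contDiffAt_christoffelL hs hG).comp q contDiffAt_fst
  exact h3.prodMk (contDiffAt_snd.clm_comp (h4.clm_apply h3))

end Field

/-! ### Local ODE arguments and metric compatibility. -/

section LocalOde

variable {F : Type*} [NormedAddCommGroup F] [NormedSpace ℝ F]

lemma eventually_eq_of_hasDerivAt_zero {f : ℝ → ℝ} {τ : ℝ}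
    (h : ∀ᶠ r in 𝓝 τ, HasDerivAt f 0 r) : ∀ᶠ r in 𝓝 τ, f r = f τ := by
  obtain ⟨ε, hε, hb⟩ := Metric.eventually_nhds_iff_ball.1 h
  filter_upwards [Metric.ball_mem_nhds τ hε] with r hr
  exact Metric.isOpen_ball.is_const_of_deriv_eq_zero (convex_ball τ ε).isPreconnected
    (fun x hx => (hb x hx).differentiableAt.differentiableWithinAt)
    (fun x hx => (hb x hx).deriv) hr (Metric.mem_ball_self hε)

lemma eq_of_hasDerivAt_zero {I : Set ℝ} (hI : IsPreconnected I) {f : ℝ → ℝ}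
    (h : ∀ τ ∈ I, ∀ᶠ r in 𝓝 τ, HasDerivAt f 0 r) {a b : ℝ} (ha : a ∈ I) (hb : b ∈ I) :
    f b = f a := by
  refine (iff_of_isPreconnected hI (P := fun r => f r = f a) (fun τ hτ => ?_) ha hb).1 rfl
  filter_upwards [eventually_eq_of_hasDerivAt_zero (h τ hτ)] with r hr
  rw [hr]

/-- A linear equation has the zero solution, so uniqueness propagates a zero in both directions. The
local equivalence is the shape needed for propagation along a connected parameter set. -/
lemma eventually_zero_iff_of_linear_ode {W : Type*} [NormedAddCommGroup W] [NormedSpace ℝ W]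
    {D : ℝ → W} {B : ℝ → W →L[ℝ] W} {τ : ℝ}
    (hD : ∀ᶠ r in 𝓝 τ, HasDerivAt D (B r (D r)) r) (hB : ContinuousAt B τ) :
    ∀ᶠ r in 𝓝 τ, (D τ = 0 ↔ D r = 0) := by
  let K : NNReal := ⟨‖B τ‖ + 1, by positivity⟩
  have hK : ∀ᶠ r in 𝓝 τ, ‖B r‖ < ‖B τ‖ + 1 :=
    hB.norm.eventually (gt_mem_nhds (by linarith))
  obtain ⟨ε, hε, hb⟩ := Metric.eventually_nhds_iff_ball.1 (hD.and hK)
  simp_rw [Real.ball_eq_Ioo] at hb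
  have hv : ∀ t ∈ Ioo (τ - ε) (τ + ε), LipschitzOnWith K (B t) univ := by
    intro t ht
    exact ((B t).lipschitz.weaken (show ‖B t‖₊ ≤ K from (hb t ht).2.le)).lipschitzOnWith
  have key : ∀ t₀ ∈ Ioo (τ - ε) (τ + ε), D t₀ = 0 → ∀ t ∈ Ioo (τ - ε) (τ + ε), D t = 0 := by
    intro t₀ ht₀ h0 t ht
    refine ODE_solution_unique_of_mem_Ioo (v := fun t => B t) (s := fun _ => univ)
      (K := K) (f := D) (g := fun _ => 0) hv ht₀ (fun t ht => ⟨(hb t ht).1, mem_univ _⟩)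
      (fun t ht => ⟨?_, mem_univ _⟩) h0 ht
    simpa using hasDerivAt_const t (0 : W)
  have hτ : τ ∈ Ioo (τ - ε) (τ + ε) := ⟨by linarith, by linarith⟩
  filter_upwards [Ioo_mem_nhds hτ.1 hτ.2] with r hr
  exact ⟨fun h => key τ hτ h r hr, fun h => key r hr h τ hτ⟩

lemma fderiv_symm {G : F → F →L[ℝ] F →L[ℝ] ℝ} {p : F} (hd : DifferentiableAt ℝ G p)
    (hs : ∀ p u v, G p u v = G p v u) (u v w : F) :
    fderiv ℝ G p u v w = fderiv ℝ G p u w v := by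
  have h : ∀ v w, HasFDerivAt (fun p => G p v w)
      (((fderiv ℝ G p).flip v).flip w) p := fun v w => by
    have := (hd.hasFDerivAt.clm_apply (hasFDerivAt_const v p)).clm_apply (hasFDerivAt_const w p)
    refine this.congr_fderiv ?_
    ext; simp
  have h2 : (fun p => G p v w) = fun p => G p w v := funext fun p => hs p v w
  have h3 := (h v w).unique (h2 ▸ h w v)
  exact DFunLike.congr_fun h3 u

/-- By symmetry of the metric two of the three derivatives in the Koszul formula cancel. This
identity drives both the conservation of the velocity covector and the transport of `⟨ξ, x_η⟩`. -/
lemma metric_christoffel_self {G : F → F →L[ℝ] F →L[ℝ] ℝ} {p : F} (hG : (G p).IsInvertible)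
    (hd : DifferentiableAt ℝ G p) (hs : ∀ p u v, G p u v = G p v u) (v w : F) :
    G p v (christoffel G p v w) = fderiv ℝ G p w v v / 2 := by
  rw [hs, metric_christoffel hG, fderiv_symm hd hs v w v]
  ring

/-- Metric compatibility: lowering the index of the geodesic equation gives the parallel transport
equation for covectors. -/
lemma hasDerivAt_metric_velocity [FiniteDimensional ℝ F] {G : F → F →L[ℝ] F →L[ℝ] ℝ}
    {p p' : ℝ → F} {τ : ℝ} (hG : (G (p τ)).IsInvertible) (hd : DifferentiableAt ℝ G (p τ))
    (hs : ∀ p u v, G p u v = G p v u) (hp : HasDerivAt p (p' τ) τ)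
    (hp' : HasDerivAt p' (-christoffel G (p τ) (p' τ) (p' τ)) τ) :
    HasDerivAt (fun r => G (p r) (p' r))
      ((G (p τ) (p' τ)).comp (christoffelL G (p τ) (p' τ))) τ := by
  refine hasDerivAt_of_forall_apply fun w => ?_
  have h1 : HasDerivAt (fun r => G (p r)) (fderiv ℝ G (p τ) (p' τ)) τ :=
    hd.hasFDerivAt.comp_hasDerivAt τ hp
  have h2 := (h1.clm_apply hp').clm_apply (hasDerivAt_const τ w)
  refine h2.congr_deriv ?_
  simp only [map_neg, add_apply, neg_apply,
    map_zero, add_zero, ContinuousLinearMap.comp_apply, christoffelL_apply]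
  rw [metric_christoffel_self hG hd hs, metric_christoffel hG]
  ring

end LocalOde

/-! ### Parallel covectors and conservation laws along geodesics. -/

section Geodesics

variable {S : Type*} [TopologicalSpace S] [ChartedSpace E3 S] [IsManifold 𝓘(ℝ, E3) ∞ S]
  {g : SpacetimeMetric S} {e : OpenPartialHomeomorph S E3} {γ : ℝ → ℝ × S} {J : Set ℝ} {τ : ℝ}

lemma contDiffAt_curveLoc (hγ : ContMDiffOn 𝓘(ℝ, ℝ) (𝓘(ℝ, ℝ).prod 𝓘(ℝ, E3)) ∞ γ J)
    (hJ : IsOpen J) (he : e ∈ atlas E3 S) (hτ : τ ∈ J) (hs : (γ τ).2 ∈ e.source) :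
    ContDiffAt ℝ ∞ (curveLoc e γ) τ := by
  have h1 : ContMDiffAt 𝓘(ℝ, ℝ) (𝓘(ℝ, ℝ).prod 𝓘(ℝ, E3)) ∞ γ τ := hγ.contMDiffAt (hJ.mem_nhds hτ)
  have h2 : ContMDiffAt 𝓘(ℝ, E3) 𝓘(ℝ, E3) ∞ e (γ τ).2 :=
    (contMDiffOn_of_mem_maximalAtlas (IsManifold.subset_maximalAtlas he)).contMDiffAt
      (e.open_source.mem_nhds hs)
  have h3 : ContMDiffAt 𝓘(ℝ, ℝ) 𝓘(ℝ, E3) ∞ (fun r => e (γ r).2) τ :=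
    h2.comp τ (contMDiffAt_snd.comp τ h1)
  have h4 : ContMDiffAt 𝓘(ℝ, ℝ) 𝓘(ℝ, ℝ) ∞ (fun r => (γ r).1) τ := contMDiffAt_fst.comp τ h1
  have h5 : ContDiffAt ℝ ∞ (fun r => e (γ r).2) τ := contMDiffAt_iff_contDiffAt.1 h3
  have h6 : ContDiffAt ℝ ∞ (fun r => (γ r).1) τ := contMDiffAt_iff_contDiffAt.1 h4
  exact h6.prodMk h5

lemma vecLoc_velocity (hγ : ContMDiffOn 𝓘(ℝ, ℝ) (𝓘(ℝ, ℝ).prod 𝓘(ℝ, E3)) ∞ γ J)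
    (hJ : IsOpen J) (he : e ∈ atlas E3 S) (hτ : τ ∈ J) (hs : (γ τ).2 ∈ e.source) :
    vecLoc e (γ τ) (velocity γ τ) = deriv (curveLoc e γ) τ := by
  have h0 := (contDiffAt_curveLoc hγ hJ he hτ hs).differentiableAt (by simp)
  have h1 : ContMDiffAt 𝓘(ℝ, ℝ) (𝓘(ℝ, ℝ).prod 𝓘(ℝ, E3)) ∞ γ τ := hγ.contMDiffAt (hJ.mem_nhds hτ)
  have h2 : MDifferentiableAt 𝓘(ℝ, ℝ) 𝓘(ℝ, E3) (fun r => (γ r).2) τ :=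
    (contMDiffAt_snd.comp τ h1).mdifferentiableAt (by simp)
  have h3 := (((chart_mdiff he).mdifferentiableAt hs).hasMFDerivAt.comp τ h2.hasMFDerivAt)
  have h4 : HasDerivAt (fun r => e (γ r).2) (vecLoc e (γ τ) (velocity γ τ)).2 τ :=
    HasFDerivAt.hasDerivAt (f' := (show ℝ →L[ℝ] E3 from (dChart e (γ τ).2).comp
      (mfderiv 𝓘(ℝ, ℝ) 𝓘(ℝ, E3) (fun r => (γ r).2) τ : ℝ →L[ℝ] TS (γ τ).2)))
      (hasMFDerivAt_iff_hasFDerivAt.1 h3)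
  have h5 : HasDerivAt (curveLoc e γ) (vecLoc e (γ τ) (velocity γ τ)) τ := by
    refine HasDerivAt.prodMk ?_ h4
    exact (hasFDerivAt_fst.comp_hasDerivAt τ h0.hasDerivAt).differentiableAt.hasDerivAt
  exact h5.deriv.symm

omit [IsManifold 𝓘(ℝ, E3) ∞ S] in
lemma eventually_mem_source (hγ : ContMDiffOn 𝓘(ℝ, ℝ) (𝓘(ℝ, ℝ).prod 𝓘(ℝ, E3)) ∞ γ J)
    (hJ : IsOpen J) (hτ : τ ∈ J) (hs : (γ τ).2 ∈ e.source) :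
    ∀ᶠ r in 𝓝 τ, r ∈ J ∧ (γ r).2 ∈ e.source := by
  have h1 : ContinuousAt γ τ := (hγ.continuousOn).continuousAt (hJ.mem_nhds hτ)
  exact (show ∀ᶠ r in 𝓝 τ, r ∈ J from hJ.mem_nhds hτ).and
    ((continuousAt_snd.comp h1).eventually (e.open_source.mem_nhds hs))

namespace SpacetimeMetric

lemma IsGeodesicOn.hasDerivAt_deriv (hγ : g.IsGeodesicOn γ J) (hJ : IsOpen J)
    (he : e ∈ atlas E3 S) (hτ : τ ∈ J) (hs : (γ τ).2 ∈ e.source) :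
    HasDerivAt (deriv (curveLoc e γ)) (-christoffel (g.metricLoc e) (curveLoc e γ τ)
        (deriv (curveLoc e γ) τ) (deriv (curveLoc e γ) τ)) τ := by
  rw [← hγ.equation e he τ hτ hs]
  refine DifferentiableAt.hasDerivAt ?_
  have h := contDiffAt_curveLoc hγ.smooth hJ he hτ hs
  have h1 : ContDiffAt ℝ 1 (fderiv ℝ (curveLoc e γ)) τ := h.fderiv_right (by norm_cast)
  have h2 := (h1.clm_apply contDiffAt_const (g := fun _ => (1 : ℝ))).differentiableAt (by simp)
  exact h2

/-- The covector of the velocity of a geodesic is parallel. -/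
lemma IsGeodesicOn.parallel (hγ : g.IsGeodesicOn γ J) (hJ : IsOpen J)
    (he : e ∈ atlas E3 S) (hτ : τ ∈ J) (hs : (γ τ).2 ∈ e.source) :
    HasDerivAt (fun r => covecLoc e ⟨γ r, g.metric (γ r) (velocity γ r)⟩)
      ((covecLoc e ⟨γ τ, g.metric (γ τ) (velocity γ τ)⟩).comp
        (christoffelL (g.metricLoc e) (curveLoc e γ τ) (deriv (curveLoc e γ) τ))) τ := by
  have hev : ∀ᶠ r in 𝓝 τ, covecLoc e ⟨γ r, g.metric (γ r) (velocity γ r)⟩ =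
      g.metricLoc e (curveLoc e γ r) (deriv (curveLoc e γ) r) := by
    filter_upwards [eventually_mem_source hγ.smooth hJ hτ hs] with r hr
    rw [covecLoc_metric g he hr.2, vecLoc_velocity hγ.smooth hJ he hr.1 hr.2]
    rfl
  rw [hev.self_of_nhds]
  refine HasDerivAt.congr_of_eventuallyEq ?_ hev
  have hp : (curveLoc e γ τ).2 ∈ e.target := e.map_source hs
  exact hasDerivAt_metric_velocity (metricLoc_isInvertible g he hp)
    ((contDiffAt_metricLoc g he hp).differentiableAt (by simp)) (metricLoc_symm g)
    ((contDiffAt_curveLoc hγ.smooth hJ he hτ hs).differentiableAt (by simp)).hasDerivAt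
    (hγ.hasDerivAt_deriv hJ he hτ hs)

/-- The energy is the velocity covector evaluated on the velocity; the Christoffel terms from the
parallel equation and from the geodesic equation cancel. -/
lemma IsGeodesicOn.energy_eq (hγ : g.IsGeodesicOn γ J) (hJ : IsOpen J) {I : Set ℝ}
    (hI : IsPreconnected I) (hIJ : I ⊆ J) {a b : ℝ} (ha : a ∈ I) (hb : b ∈ I) :
    g.metric (γ b) (velocity γ b) (velocity γ b) =
      g.metric (γ a) (velocity γ a) (velocity γ a) := by
  refine eq_of_hasDerivAt_zero hI
    (f := fun r => g.metric (γ r) (velocity γ r) (velocity γ r)) (fun τ hτ => ?_) ha hb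
  have hs : (γ τ).2 ∈ (chartAt E3 (γ τ).2).source := mem_chart_source _ _
  set e := chartAt E3 (γ τ).2
  have he : e ∈ atlas E3 S := chart_mem_atlas _ _
  have hev : ∀ᶠ r in 𝓝 τ, g.metric (γ r) (velocity γ r) (velocity γ r) =
      covecLoc e ⟨γ r, g.metric (γ r) (velocity γ r)⟩ (deriv (curveLoc e γ) r) := by
    filter_upwards [eventually_mem_source hγ.smooth hJ (hIJ hτ) hs] with r hr
    rw [← vecLoc_velocity hγ.smooth hJ he hr.1 hr.2, covecLoc_vecLoc he hr.2]
  filter_upwards [hev.eventually_nhds, eventually_mem_source hγ.smooth hJ (hIJ hτ) hs] with r h1 h2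
  refine HasDerivAt.congr_of_eventuallyEq ?_ h1
  have h3 := (hγ.parallel hJ he h2.1 h2.2).clm_apply (hγ.hasDerivAt_deriv hJ he h2.1 h2.2)
  refine h3.congr_deriv ?_
  simp only [map_neg, ContinuousLinearMap.comp_apply, christoffelL_apply]
  ring

/-- A parallel covector field that vanishes somewhere on a connected set vanishes there. -/
lemma parallel_zero {k : ∀ τ, CoTM (γ τ)}
    (hγ : ContMDiffOn 𝓘(ℝ, ℝ) (𝓘(ℝ, ℝ).prod 𝓘(ℝ, E3)) ∞ γ J) (hJ : IsOpen J)
    (hk : ∀ e ∈ atlas E3 S, ∀ τ ∈ J, (γ τ).2 ∈ e.source →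
      HasDerivAt (fun r => covecLoc e ⟨γ r, k r⟩) ((covecLoc e ⟨γ τ, k τ⟩).comp
        (christoffelL (g.metricLoc e) (curveLoc e γ τ) (deriv (curveLoc e γ) τ))) τ)
    {I : Set ℝ} (hI : IsPreconnected I) (hIJ : I ⊆ J) {a b : ℝ} (ha : a ∈ I) (hb : b ∈ I)
    (h0 : k a = 0) : k b = 0 := by
  refine (iff_of_isPreconnected hI (P := fun r => k r = 0) (fun τ hτ => ?_) ha hb).1 h0
  have hs : (γ τ).2 ∈ (chartAt E3 (γ τ).2).source := mem_chart_source _ _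
  set e := chartAt E3 (γ τ).2
  have he : e ∈ atlas E3 S := chart_mem_atlas _ _
  have hev := eventually_mem_source hγ hJ (hIJ hτ) hs
  have hcov : ∀ r, (γ r).2 ∈ e.source → (covecLoc e ⟨γ r, k r⟩ = 0 ↔ k r = 0) := by
    intro r hr
    refine ⟨fun h => covecLoc_injective he hr (h.trans rfl), fun h => by rw [h]; rfl⟩
  have hp : (curveLoc e γ τ).2 ∈ e.target := e.map_source hs
  have hc := contDiffAt_curveLoc hγ hJ he (hIJ hτ) hs
  have hA : ContinuousAt (fun r => christoffelL (g.metricLoc e) (curveLoc e γ r)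
      (deriv (curveLoc e γ) r)) τ := by
    have h1 : ContinuousAt (fun r => christoffelL (g.metricLoc e) (curveLoc e γ r)) τ :=
      (contDiffAt_christoffelL (contDiffAt_metricLoc g he hp)
        (metricLoc_isInvertible g he hp)).continuousAt.comp hc.continuousAt
    have h2 : ContDiffAt ℝ 1 (fderiv ℝ (curveLoc e γ)) τ := hc.fderiv_right (by norm_cast)
    have h3 := (h2.clm_apply contDiffAt_const (g := fun _ => (1 : ℝ))).continuousAt
    exact h1.clm_apply h3
  -- In a chart, parallel transport is the linear equation `D' = D ∘ Γ(γ', ·)`, whose coefficient is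
  -- continuous because the curve is smooth.
  have := eventually_zero_iff_of_linear_ode
    (B := fun r => (ContinuousLinearMap.compL ℝ (ℝ × E3) (ℝ × E3) ℝ).flip
      (christoffelL (g.metricLoc e) (curveLoc e γ r) (deriv (curveLoc e γ) r)))
    (hev.mono fun r hr => hk e he r hr.1 hr.2)
    ((ContinuousLinearMap.continuous _).continuousAt.comp hA)
  filter_upwards [this, hev] with r h1 h2
  rw [← hcov τ hs, ← hcov r h2.2, h1]

/-- A geodesic whose velocity vanishes somewhere is constant. -/
lemma IsGeodesicOn.velocity_eq_zero (hγ : g.IsGeodesicOn γ J) (hJ : IsOpen J) {I : Set ℝ}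
    (hI : IsPreconnected I) (hIJ : I ⊆ J) {a b : ℝ} (ha : a ∈ I) (hb : b ∈ I)
    (h0 : velocity γ a = 0) : velocity γ b = 0 := by
  refine eq_zero_of_metric_eq_zero g (parallel_zero (g := g)
    (k := fun r => g.metric (γ r) (velocity γ r)) hγ.smooth hJ
    (fun e he τ hτ hs => hγ.parallel hJ he hτ hs) hI hIJ ha hb ?_)
  change g.metric (γ a) (velocity γ a) = 0
  rw [h0, map_zero]

end SpacetimeMetric

end Geodesics

section Components

variable {A B : Type*} [NormedAddCommGroup A] [NormedSpace ℝ A] [NormedAddCommGroup B]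
  [NormedSpace ℝ B] {f : ℝ → A × B} {f' : A × B} {t : ℝ}

lemma hasDerivAt_fun_fst (h : HasDerivAt f f' t) : HasDerivAt (fun r => (f r).1) f'.1 t :=
  (ContinuousLinearMap.fst ℝ A B).hasFDerivAt.comp_hasDerivAt t h

lemma hasDerivAt_fun_snd (h : HasDerivAt f f' t) : HasDerivAt (fun r => (f r).2) f'.2 t :=
  (ContinuousLinearMap.snd ℝ A B).hasFDerivAt.comp_hasDerivAt t h

end Components

/-! ### Null bicharacteristics parameterised by global time. -/

section TimeFlow

variable {S : Type*} [TopologicalSpace S] [ChartedSpace E3 S]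
  {g : SpacetimeMetric S} {e : OpenPartialHomeomorph S E3}

/-- A covector of spacetime in local coordinates, together with its base point. -/
def cotLoc (e : OpenPartialHomeomorph S E3) (k : CotangentM S) :
    (ℝ × E3) × ((ℝ × E3) →L[ℝ] ℝ) :=
  (ptLoc e k.1, covecLoc e k)

namespace SpacetimeMetric

variable (g) in
/-- Null bicharacteristics parameterised by global time. -/
structure IsTimeFlow (Ψ : ℝ → CotangentM S) : Prop where
  time : ∀ t, (Ψ t).1.1 = t
  cont : Continuous fun t => (Ψ t).1
  pos : ∀ t, (g.sharp (Ψ t).1 (Ψ t).2).1 ≠ 0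
  null : ∀ t, (Ψ t).2 (g.sharp (Ψ t).1 (Ψ t).2) = 0
  ode : ∀ e ∈ atlas E3 S, ∀ t, (Ψ t).1.2 ∈ e.source →
    HasDerivAt (fun r => cotLoc e (Ψ r)) (flowField (g.metricLoc e) (cotLoc e (Ψ t))) t

end SpacetimeMetric

/-- Vectors tangent to the time slices are spacelike, since `h_t` is positive definite. -/
lemma fst_ne_zero_of_causal {X : ℝ × S} {v : TM X} (h : g.metric X v v ≤ 0) (hv : v ≠ 0) :
    v.1 ≠ 0 := by
  intro h1
  rw [metric_apply, h1] at h
  have h2 : v.2 = 0 := by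
    by_contra hne
    have := g.h_pos X.1 X.2 v.2 hne
    linarith
  exact hv (Prod.ext h1 h2)

lemma conorm_sq (s : ℝ) (y : S) (η : CoTS y) :
    ∃ w : TS y, g.h s y w = η ∧ g.conorm s y η = √(g.h s y w w) := by
  have hi := h_isInvertible g s y
  refine ⟨(g.h s y).inverse η, hi.self_apply_inverse η, ?_⟩
  rw [SpacetimeMetric.conorm, hi.self_apply_inverse]

lemma conorm_pos {s : ℝ} {y : S} {η : CoTS y} (hη : η ≠ 0) : 0 < g.conorm s y η := by
  obtain ⟨w, hw, hc⟩ := conorm_sq (g := g) s y η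
  rw [hc]
  refine Real.sqrt_pos.2 (g.h_pos _ _ _ ?_)
  rintro rfl
  exact hη (by rw [← hw, map_zero])

lemma conorm_smul (s : ℝ) (y : S) (η : CoTS y) (l : ℝ) :
    g.conorm s y (l • η) = |l| * g.conorm s y η := by
  rw [SpacetimeMetric.conorm, SpacetimeMetric.conorm, map_smul, smul_apply, map_smul, smul_smul,
    smul_eq_mul, Real.sqrt_mul (mul_self_nonneg l), Real.sqrt_mul_self_eq_abs]

variable [IsManifold 𝓘(ℝ, E3) ∞ S]

lemma cotLoc_injective (he : e ∈ atlas E3 S) {k l : CotangentM S} (hk : k.1.2 ∈ e.source)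
    (hl : l.1.2 ∈ e.source) (h : cotLoc e k = cotLoc e l) : k = l := by
  obtain ⟨⟨t, x⟩, k⟩ := k
  obtain ⟨⟨t', x'⟩, l⟩ := l
  obtain ⟨h1, h2⟩ := Prod.ext_iff.1 h
  obtain ⟨h3, h4⟩ := Prod.ext_iff.1 h1
  obtain rfl : t = t' := h3
  obtain rfl : x = x' := e.injOn hk hl h4
  rw [covecLoc_injective he hk h2]

lemma inverse_cotLoc_fst (he : e ∈ atlas E3 S) {k : CotangentM S} (hk : k.1.2 ∈ e.source) :
    ((g.metricLoc e (cotLoc e k).1).inverse (cotLoc e k).2).1 = (g.sharp k.1 k.2).1 := by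
  have := vecLoc_sharp g he hk k.2
  exact (congrArg (Prod.fst : ℝ × E3 → ℝ) this).symm

namespace SpacetimeMetric

lemma IsTimeFlow.contDiffAt_flowField {Ψ : ℝ → CotangentM S} (h : g.IsTimeFlow Ψ)
    (he : e ∈ atlas E3 S) {t : ℝ} (ht : (Ψ t).1.2 ∈ e.source) :
    ContDiffAt ℝ ∞ (flowField (g.metricLoc e)) (cotLoc e (Ψ t)) := by
  have hp : (cotLoc e (Ψ t)).1.2 ∈ e.target := e.map_source ht
  refine LeviCivitaPhase.contDiffAt_flowField (contDiffAt_metricLoc g he hp)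
    (metricLoc_isInvertible g he hp) ?_
  rw [inverse_cotLoc_fst he ht]
  exact h.pos t

omit [IsManifold 𝓘(ℝ, E3) ∞ S] in
lemma IsTimeFlow.eventually_mem_source {Ψ : ℝ → CotangentM S} (h : g.IsTimeFlow Ψ)
    {t : ℝ} (ht : (Ψ t).1.2 ∈ e.source) : ∀ᶠ r in 𝓝 t, (Ψ r).1.2 ∈ e.source :=
  (h.cont.snd).continuousAt.eventually (e.open_source.mem_nhds ht)

/-- Null bicharacteristics parameterised by time are determined by one of their points. -/
lemma IsTimeFlow.unique [T2Space S] {Ψ₁ Ψ₂ : ℝ → CotangentM S} (h₁ : g.IsTimeFlow Ψ₁)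
    (h₂ : g.IsTimeFlow Ψ₂) {t₀ : ℝ} (h0 : Ψ₁ t₀ = Ψ₂ t₀) (t : ℝ) : Ψ₁ t = Ψ₂ t := by
  refine (iff_of_isPreconnected isPreconnected_univ (P := fun r => Ψ₁ r = Ψ₂ r)
    (fun τ _ => ?_) (mem_univ t₀) (mem_univ t)).1 h0
  have hs : (Ψ₁ τ).1.2 ∈ (chartAt E3 (Ψ₁ τ).1.2).source := mem_chart_source _ _
  set e := chartAt E3 (Ψ₁ τ).1.2
  have he : e ∈ atlas E3 S := chart_mem_atlas _ _
  -- Agreement is open by ODE uniqueness, the field being locally Lipschitz. Disagreement is open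
  -- too, but base points and covectors must be separated one after the other: the covectors can be
  -- compared in a single chart only when the base points coincide.
  by_cases heq : Ψ₁ τ = Ψ₂ τ
  · have hs2 : (Ψ₂ τ).1.2 ∈ e.source := heq ▸ hs
    obtain ⟨K, s, hsn, hK⟩ := ((h₁.contDiffAt_flowField he hs).of_le
      (show (1 : WithTop ℕ∞) ≤ ∞ by norm_cast)).exists_lipschitzOnWith
    have hc1 := (h₁.ode e he τ hs).continuousAt.eventually hsn
    have hsn2 : s ∈ 𝓝 (cotLoc e (Ψ₂ τ)) := heq ▸ hsn
    have hc2 := (h₂.ode e he τ hs2).continuousAt.eventually hsn2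
    have hm1 := h₁.eventually_mem_source hs
    have hm2 := h₂.eventually_mem_source hs2
    have := ODE_solution_unique_of_eventually (v := fun _ => flowField (g.metricLoc e))
      (s := fun _ => s) (K := K) (t₀ := τ) (f := fun r => cotLoc e (Ψ₁ r))
      (g := fun r => cotLoc e (Ψ₂ r)) (Filter.Eventually.of_forall fun _ => hK)
      (by filter_upwards [hc1, hm1] with r h3 h4 using ⟨h₁.ode e he r h4, h3⟩)
      (by filter_upwards [hc2, hm2] with r h3 h4 using ⟨h₂.ode e he r h4, h3⟩) (by rw [heq])
    filter_upwards [this, hm1, hm2] with r h3 h4 h5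
    exact ⟨fun _ => cotLoc_injective he h4 h5 h3, fun _ => heq⟩
  · by_cases hb : (Ψ₁ τ).1 = (Ψ₂ τ).1
    · have hs2 : (Ψ₂ τ).1.2 ∈ e.source := hb ▸ hs
      have hne : cotLoc e (Ψ₁ τ) ≠ cotLoc e (Ψ₂ τ) := fun h => heq (cotLoc_injective he hs hs2 h)
      have := ((h₁.ode e he τ hs).continuousAt.prodMk
        (h₂.ode e he τ hs2).continuousAt).eventually
        (isClosed_diagonal.isOpen_compl.mem_nhds hne)
      filter_upwards [this] with r hr
      exact ⟨fun h => absurd h heq, fun h => absurd (congrArg (cotLoc e) h) hr⟩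
    · have := (h₁.cont.prodMk h₂.cont).continuousAt.eventually
        (isClosed_diagonal.isOpen_compl.mem_nhds (show ((Ψ₁ τ).1, (Ψ₂ τ).1) ∉ diagonal _ from hb))
      filter_upwards [this] with r hr
      exact ⟨fun h => absurd h heq, fun h => absurd (congrArg Sigma.fst h) hr⟩

lemma IsTimeFlow.continuousAt_sharp {Ψ : ℝ → CotangentM S} (h : g.IsTimeFlow Ψ) (τ : ℝ) :
    ContinuousAt (fun t => (g.sharp (Ψ t).1 (Ψ t).2).1) τ := by
  have hs : (Ψ τ).1.2 ∈ (chartAt E3 (Ψ τ).1.2).source := mem_chart_source _ _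
  set e := chartAt E3 (Ψ τ).1.2
  have he : e ∈ atlas E3 S := chart_mem_atlas _ _
  have h1 : ContinuousAt (fun r => (flowField (g.metricLoc e) (cotLoc e (Ψ r)))) τ :=
    ContinuousAt.comp (f := fun r => cotLoc e (Ψ r)) (h.contDiffAt_flowField he hs).continuousAt
      (h.ode e he τ hs).continuousAt
  have hp : (cotLoc e (Ψ τ)).1.2 ∈ e.target := e.map_source hs
  have hc : ContinuousAt (fun r => cotLoc e (Ψ r)) τ := (h.ode e he τ hs).continuousAt
  have h2 : ContinuousAt (fun r => (g.metricLoc e (cotLoc e (Ψ r)).1).inverse) τ :=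
    ContinuousAt.comp (f := fun r => g.metricLoc e (cotLoc e (Ψ r)).1)
      ((metricLoc_isInvertible g he hp).contDiffAt_map_inverse (n := 1)).continuousAt
      (ContinuousAt.comp (f := fun r => (cotLoc e (Ψ r)).1)
        (contDiffAt_metricLoc g he hp).continuousAt hc.fst)
  refine ((h2.clm_apply hc.snd).fst).congr ?_
  filter_upwards [h.eventually_mem_source hs] with r hr
  exact inverse_cotLoc_fst he hr

/-- The raised time component is continuous and never zero, so it keeps its sign; a null
bicharacteristic stays future or past pointing. -/
lemma IsTimeFlow.pointing {Ψ : ℝ → CotangentM S} (h : g.IsTimeFlow Ψ) {a s : ℝ}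
    (hs : 0 < a * (g.sharp (Ψ s).1 (Ψ s).2).1) (t : ℝ) :
    0 < a * (g.sharp (Ψ t).1 (Ψ t).2).1 := by
  have ha : a ≠ 0 := by rintro rfl; simp at hs
  refine (iff_of_isPreconnected isPreconnected_univ
    (P := fun r => 0 < a * (g.sharp (Ψ r).1 (Ψ r).2).1)
    (fun τ _ => ?_) (mem_univ s) (mem_univ t)).1 hs
  have hc := (h.continuousAt_sharp τ).const_mul a
  rcases lt_or_gt_of_ne (mul_ne_zero ha (h.pos τ)) with h1 | h1
  · filter_upwards [hc.eventually (gt_mem_nhds h1)] with r hr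
    exact ⟨fun h => absurd h h1.not_gt, fun h => absurd h hr.not_gt⟩
  · filter_upwards [hc.eventually (lt_mem_nhds h1)] with r hr
    exact ⟨fun _ => hr, fun _ => h1⟩

omit [IsManifold 𝓘(ℝ, E3) ∞ S] in
-- The direction `ξ♯ / (ξ♯)_t` is unchanged by scaling and the covector equation is linear in `ξ`.
-- Negative factors are allowed, which is what reversal of the flow uses.
lemma IsTimeFlow.smul {Ψ : ℝ → CotangentM S} (h : g.IsTimeFlow Ψ) {l : ℝ} (hl : l ≠ 0) :
    g.IsTimeFlow fun t => ⟨(Ψ t).1, l • (Ψ t).2⟩ where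
  time := h.time
  cont := h.cont
  pos t := by
    change (g.sharp (Ψ t).1 (l • (Ψ t).2)).1 ≠ 0
    rw [map_smul]
    exact mul_ne_zero hl (h.pos t)
  null t := by
    change (l • (Ψ t).2) (g.sharp (Ψ t).1 (l • (Ψ t).2)) = 0
    rw [map_smul, map_smul, smul_apply, h.null t, smul_zero, smul_zero]
  ode e he t ht := by
    have h1 := h.ode e he t ht
    have h2 : HasDerivAt (fun r => ptLoc e (Ψ r).1) _ t := hasDerivAt_fun_fst h1
    have h3 : HasDerivAt (fun r => covecLoc e (Ψ r)) _ t := hasDerivAt_fun_snd h1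
    refine (h2.prodMk (h3.const_smul l)).congr_deriv ?_
    have hdir : flowDir (g.metricLoc e) (ptLoc e (Ψ t).1, l • covecLoc e (Ψ t)) =
        flowDir (g.metricLoc e) (ptLoc e (Ψ t).1, covecLoc e (Ψ t)) := by
      simp only [flowDir, map_smul, Prod.smul_fst, smul_eq_mul, mul_inv]
      rw [smul_smul]
      congr 1
      field_simp
    refine Prod.ext hdir.symm ?_
    change l • (covecLoc e (Ψ t)).comp _ = (l • covecLoc e (Ψ t)).comp
      (christoffelL _ _ (flowDir (g.metricLoc e) (ptLoc e (Ψ t).1, l • covecLoc e (Ψ t))))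
    rw [hdir]
    rfl

end SpacetimeMetric

end TimeFlow

/-! ### From the affine parameter to global time. -/

namespace SpacetimeMetric

variable {S : Type*} [TopologicalSpace S] [ChartedSpace E3 S]
  {g : SpacetimeMetric S} {ε : ℤˣ} {s : ℝ} {y : S} {η : CoTS y}

section Time

variable {γ : ℝ → ℝ × S} {J : Set ℝ} [IsManifold 𝓘(ℝ, E3) ∞ S]

omit [IsManifold 𝓘(ℝ, E3) ∞ S] in
lemma contDiffAt_time (hγ : ContMDiffOn 𝓘(ℝ, ℝ) (𝓘(ℝ, ℝ).prod 𝓘(ℝ, E3)) ∞ γ J)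
    (hJ : IsOpen J) {τ : ℝ} (hτ : τ ∈ J) : ContDiffAt ℝ ∞ (fun r => (γ r).1) τ :=
  contMDiffAt_iff_contDiffAt.1 (contMDiffAt_fst.comp τ (hγ.contMDiffAt (hJ.mem_nhds hτ)))

omit [IsManifold 𝓘(ℝ, E3) ∞ S] in
lemma hasDerivAt_time (hγ : ContMDiffOn 𝓘(ℝ, ℝ) (𝓘(ℝ, ℝ).prod 𝓘(ℝ, E3)) ∞ γ J)
    (hJ : IsOpen J) {τ : ℝ} (hτ : τ ∈ J) :
    HasDerivAt (fun r => (γ r).1) (velocity γ τ).1 τ :=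
  ((contDiffAt_time hγ hJ hτ).differentiableAt (by simp)).hasDerivAt

omit [IsManifold 𝓘(ℝ, E3) ∞ S] in
/-- The time function is injective along a curve with nowhere vanishing time velocity. -/
lemma time_injOn (hγ : ContMDiffOn 𝓘(ℝ, ℝ) (𝓘(ℝ, ℝ).prod 𝓘(ℝ, E3)) ∞ γ J)
    (hJ : IsOpen J) {I : Set ℝ} (hI : I.OrdConnected) (hIJ : I ⊆ J)
    (hv : ∀ τ ∈ I, (velocity γ τ).1 ≠ 0) : InjOn (fun r => (γ r).1) I := by
  have key : ∀ a ∈ I, ∀ b ∈ I, a < b → (γ a).1 ≠ (γ b).1 := by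
    -- Rolle's theorem: equal times at two parameters would force a zero of the time velocity in
    -- between.
    intro a ha b hb hab heq
    have hsub : Icc a b ⊆ I := hI.out ha hb
    obtain ⟨c, hc, h0⟩ := exists_hasDerivAt_eq_zero (f := fun r => (γ r).1)
      (f' := fun r => (velocity γ r).1) hab
      (fun r hr => (hasDerivAt_time hγ hJ (hIJ (hsub hr))).continuousAt.continuousWithinAt) heq
      (fun r hr => hasDerivAt_time hγ hJ (hIJ (hsub (Ioo_subset_Icc_self hr))))
    exact hv c (hsub (Ioo_subset_Icc_self hc)) h0
  intro a ha b hb hab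
  rcases lt_trichotomy a b with h | h | h
  · exact absurd hab (key a ha b hb h)
  · exact h
  · exact absurd hab.symm (key b hb a ha h)

end Time

variable [IsManifold 𝓘(ℝ, E3) ∞ S]

/-- A Levi-Civita flow line is a null bicharacteristic parameterised by time. -/
theorem IsFlowLine.isTimeFlow {Φ : ℝ → CotangentM S} (hη : η ≠ 0)
    (h : g.IsFlowLine ε s y η Φ) :
    g.IsTimeFlow Φ ∧ ∃ k, g.IsNullLift ε s y η k ∧ Φ s = ⟨(s, y), k⟩ := by
  obtain ⟨J, c, k, hJ, hJc, h0, hk, hc0, hv0, hgeo, hpar, hcov⟩ := h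
  let γ : ℝ → ℝ × S := fun τ => (c τ).1
  set a := g.conorm s y η with ha_def
  have ha : 0 < a := conorm_pos hη
  -- The difference of the two sides is parallel, and it vanishes at parameter `0` because the
  -- initial velocity is dual to `k / ‖η‖`.
  have hX : ∀ τ ∈ J, (c τ).2 = a • g.metric (γ τ) (velocity γ τ) := by
    intro τ hτ
    have := parallel_zero (g := g) (γ := γ)
      (k := fun τ => (c τ).2 - a • g.metric (γ τ) (velocity γ τ)) hgeo.smooth hJ
      (fun e he τ hτ hs => ?_) hJc subset_rfl h0 hτ ?_
    · exact sub_eq_zero.1 this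
    · have h1 : HasDerivAt (fun r => covecLoc e (c r)) _ τ :=
        hasDerivAt_of_forall_apply (D' := (covecLoc e (c τ)).comp
          (christoffelL (g.metricLoc e) (curveLoc e γ τ) (deriv (curveLoc e γ) τ)))
          (hpar e he τ hτ hs)
      have h2 := (hgeo.parallel hJ he hτ hs).const_smul a
      refine (h1.sub h2).congr_deriv ?_
      rfl
    · change (c 0).2 - a • g.metric (c 0).1 (velocity γ 0) = 0
      have hv0' : g.metric (c 0).1 (velocity γ 0) = a⁻¹ • (c 0).2 := hv0
      rw [hv0', smul_inv_smul₀ ha.ne', sub_self]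
  have hsharp : ∀ τ ∈ J, g.sharp (c τ).1 (c τ).2 = a • velocity γ τ := by
    intro τ hτ
    rw [hX τ hτ, map_smul]
    change a • g.sharp (γ τ) (g.metric (γ τ) (velocity γ τ)) = _
    rw [sharp_metric]
  have hnull0 : (c 0).2 (g.sharp (c 0).1 (c 0).2) = 0 := by rw [hc0]; exact hk.null
  have hne0 : velocity γ 0 ≠ 0 := by
    intro h
    have h1 := hsharp 0 h0
    have h2 : (g.sharp (c 0).1 (c 0).2).1 = 0 := by
      rw [h1, h, smul_zero]; rfl
    have h3 := hk.pointing
    rw [hc0] at h2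
    have h2 : (g.sharp (s, y) k).1 = 0 := h2
    rw [h2, mul_zero] at h3
    exact lt_irrefl _ h3
  have hnull : ∀ τ ∈ J, g.metric (γ τ) (velocity γ τ) (velocity γ τ) = 0 := by
    intro τ hτ
    rw [hgeo.energy_eq hJ hJc subset_rfl h0 hτ]
    rw [hsharp 0 h0, map_smul, hX 0 h0] at hnull0
    simpa [ha.ne'] using hnull0
  -- The velocity is null by conservation of energy and nonzero because it is nonzero at `0`.
  have hV : ∀ τ ∈ J, (velocity γ τ).1 ≠ 0 := fun τ hτ =>
    fst_ne_zero_of_causal (hnull τ hτ).le fun h =>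
      hne0 (hgeo.velocity_eq_zero hJ hJc subset_rfl hτ h0 h)
  have hinj := time_injOn hgeo.smooth hJ hJc.ordConnected subset_rfl hV
  choose θ hθJ hθT hθΦ using hcov
  -- A nonzero strict derivative makes the time function locally open, and injectivity identifies `θ
  -- t'` with the preimage found near `θ t`.
  have hcont : ∀ t, ContinuousAt θ t := by
    intro t U hU
    have hd : HasStrictDerivAt (fun r => (γ r).1) (velocity γ (θ t)).1 (θ t) := by
      have h1 := (contDiffAt_time hgeo.smooth hJ (hθJ t)).hasStrictDerivAt (n := ∞) (by simp)
      exact (hasDerivAt_time hgeo.smooth hJ (hθJ t)).deriv ▸ h1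
    have h2 := hd.map_nhds_eq (hV _ (hθJ t))
    have h3 : (fun r => (γ r).1) '' (U ∩ J) ∈ 𝓝 t := by
      have : (γ (θ t)).1 = t := hθT t
      rw [← this, ← h2]
      exact Filter.image_mem_map (Filter.inter_mem hU (hJ.mem_nhds (hθJ t)))
    change ∀ᶠ t' in 𝓝 t, θ t' ∈ U
    filter_upwards [h3] with t' ht'
    obtain ⟨u, hu, hut⟩ := ht'
    have : θ t' = u := hinj (hθJ t') hu.2 ((hθT t').trans hut.symm)
    rw [this]
    exact hu.1
  have hderiv : ∀ t, HasDerivAt θ (velocity γ (θ t)).1⁻¹ t := fun t =>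
    (hasDerivAt_time hgeo.smooth hJ (hθJ t)).of_local_left_inverse (hcont t) (hV _ (hθJ t))
      (Filter.Eventually.of_forall hθT)
  have hΦ : Φ = fun t => c (θ t) := funext hθΦ
  subst hΦ
  refine ⟨⟨hθT, ?_, fun t => ?_, fun t => ?_, fun e he t ht => ?_⟩, k, hk, ?_⟩
  · refine continuous_iff_continuousAt.2 fun t => ?_
    exact ContinuousAt.comp (f := θ) (g := γ)
      (hgeo.smooth.continuousOn.continuousAt (hJ.mem_nhds (hθJ t))) (hcont t)
  · rw [hsharp _ (hθJ t)]
    exact mul_ne_zero ha.ne' (hV _ (hθJ t))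
  · rw [hsharp _ (hθJ t), map_smul, hX _ (hθJ t), smul_apply]
    change a • a • g.metric (γ (θ t)) (velocity γ (θ t)) (velocity γ (θ t)) = 0
    rw [hnull _ (hθJ t), smul_zero, smul_zero]
  · have hs : (γ (θ t)).2 ∈ e.source := ht
    have h1 : HasDerivAt (curveLoc e γ) (deriv (curveLoc e γ) (θ t)) (θ t) :=
      ((contDiffAt_curveLoc hgeo.smooth hJ he (hθJ t) hs).differentiableAt (by simp)).hasDerivAt
    have h2 : HasDerivAt (fun r => covecLoc e (c r)) _ (θ t) :=
      hasDerivAt_of_forall_apply (D' := (covecLoc e (c (θ t))).comp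
        (christoffelL (g.metricLoc e) (curveLoc e γ (θ t)) (deriv (curveLoc e γ) (θ t))))
        (hpar e he (θ t) (hθJ t) hs)
    have h3 := (h1.scomp t (hderiv t)).prodMk (h2.scomp t (hderiv t))
    refine h3.congr_deriv ?_
    have hw : (g.metricLoc e (ptLoc e (γ (θ t)))).inverse (covecLoc e (c (θ t))) =
        a • deriv (curveLoc e γ) (θ t) := by
      have := vecLoc_sharp g he hs (c (θ t)).2
      rw [← vecLoc_velocity hgeo.smooth hJ he (hθJ t) hs, ← map_smul, ← hsharp _ (hθJ t)]
      exact this.symm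
    have hfst : (deriv (curveLoc e γ) (θ t)).1 = (velocity γ (θ t)).1 := by
      rw [← vecLoc_velocity hgeo.smooth hJ he (hθJ t) hs]; rfl
    -- The factor `a = ‖η‖` between covector and velocity cancels under normalisation to unit time
    -- component.
    have hdir : flowDir (g.metricLoc e) (cotLoc e (c (θ t))) =
        (velocity γ (θ t)).1⁻¹ • deriv (curveLoc e γ) (θ t) := by
      change ((g.metricLoc e (ptLoc e (γ (θ t)))).inverse (covecLoc e (c (θ t)))).1⁻¹ •
        (g.metricLoc e (ptLoc e (γ (θ t)))).inverse (covecLoc e (c (θ t))) = _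
      rw [hw, Prod.smul_fst, hfst, smul_smul, smul_eq_mul, mul_inv]
      congr 1
      field_simp
    refine Prod.ext hdir.symm ?_
    change _ • (covecLoc e (c (θ t))).comp _ = (covecLoc e (c (θ t))).comp
      (christoffelL (g.metricLoc e) (curveLoc e γ (θ t)) (flowDir (g.metricLoc e) _))
    rw [hdir, map_smul, ContinuousLinearMap.comp_smul]
  · change c (θ s) = _
    have h1 : (c 0).1.1 = s := by rw [hc0]
    have : θ s = 0 := hinj (hθJ s) h0 ((hθT s).trans h1.symm)
    rw [this, hc0]

end SpacetimeMetric

/-! ### Null lifts; scaling, reversal and restarting of the flow. -/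

namespace SpacetimeMetric

variable {S : Type*} [TopologicalSpace S] [ChartedSpace E3 S]
  {g : SpacetimeMetric S} {ε : ℤˣ} {s : ℝ} {y : S} {η : CoTS y}

lemma restrict_eq_h (k : CoTM (s, y)) :
    k.comp (ContinuousLinearMap.inr ℝ ℝ (TS y)) = g.h s y (g.sharp (s, y) k).2 := by
  refine ContinuousLinearMap.ext fun u => ?_
  change k (0, u) = _
  conv_lhs => rw [← metric_sharp g (s, y) k]
  rw [metric_apply]
  simp

/-- The null lift of a covector is unique. -/
lemma IsNullLift.unique {k l : CoTM (s, y)} (hk : g.IsNullLift ε s y η k)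
    (hl : g.IsNullLift ε s y η l) : k = l := by
  have hk2 := restrict_eq_h (g := g) k
  have hl2 := restrict_eq_h (g := g) l
  rw [hk.restrict] at hk2
  rw [hl.restrict] at hl2
  -- The metric has no cross terms, so the restriction determines the spatial part of the raised
  -- covector. Nullity then fixes the square of its time component, and the pointing condition fixes
  -- the sign.
  have h2 : (g.sharp (s, y) k).2 = (g.sharp (s, y) l).2 := by
    have := hk2.symm.trans hl2
    rw [← sub_eq_zero] at this ⊢
    exact eq_zero_of_h_eq_zero g (by rw [map_sub]; exact this)
  have h3 : ∀ m : CoTM (s, y), m (g.sharp (s, y) m) = 0 →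
      (g.lapse (s, y)) ^ 2 * ((g.sharp (s, y) m).1 * (g.sharp (s, y) m).1) =
        g.h s y (g.sharp (s, y) m).2 (g.sharp (s, y) m).2 := by
    intro m hm
    have h4 : g.metric (s, y) (g.sharp (s, y) m) (g.sharp (s, y) m) = 0 := by
      rw [metric_sharp]; exact hm
    rw [metric_apply] at h4
    linarith
  have h5 : (g.sharp (s, y) k).1 * (g.sharp (s, y) k).1 =
      (g.sharp (s, y) l).1 * (g.sharp (s, y) l).1 := by
    have h6 := h3 k hk.null
    rw [h2, ← h3 l hl.null] at h6
    exact mul_left_cancel₀ (pow_pos (g.lapse_pos _) 2).ne' h6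
  have h1 : (g.sharp (s, y) k).1 = (g.sharp (s, y) l).1 := by
    rcases mul_self_eq_mul_self_iff.1 h5 with h | h
    · exact h
    · have h7 := hk.pointing
      have h8 := hl.pointing
      rw [h] at h7
      linarith
  rw [← metric_sharp g (s, y) k, ← metric_sharp g (s, y) l, Prod.ext h1 h2]

lemma IsNullLift.smul {k : CoTM (s, y)} (hk : g.IsNullLift ε s y η k) {l : ℝ} (hl : 0 < l) :
    g.IsNullLift ε s y (l • η) (l • k) where
  restrict := by rw [ContinuousLinearMap.smul_comp, hk.restrict]
  null := by rw [map_smul, map_smul, smul_apply, hk.null, smul_zero, smul_zero]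
  pointing := by
    rw [map_smul, Prod.smul_fst, smul_eq_mul, mul_left_comm]
    exact mul_pos hl hk.pointing

lemma IsNullLift.neg {k : CoTM (s, y)} (hk : g.IsNullLift ε s y η k) :
    g.IsNullLift (-ε) s y (-η) (-k) where
  restrict := by rw [ContinuousLinearMap.neg_comp, hk.restrict]
  null := by rw [map_neg, map_neg, neg_apply, hk.null, neg_zero, neg_zero]
  pointing := by
    have := hk.pointing
    rw [map_neg, Prod.fst_neg]
    push_cast
    linarith

/-- If the restriction were zero, the raised covector would be a null multiple of `∂_t`, hence zero,
against the pointing condition. This permits restarting the flow at a later point. -/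
lemma IsNullLift.ne_zero {k : CoTM (s, y)} (hk : g.IsNullLift ε s y η k) : η ≠ 0 := by
  rintro rfl
  have h2 := restrict_eq_h (g := g) k
  rw [hk.restrict] at h2
  have h2 := eq_zero_of_h_eq_zero g h2.symm
  have h4 : g.metric (s, y) (g.sharp (s, y) k) (g.sharp (s, y) k) = 0 := by
    rw [metric_sharp]; exact hk.null
  have h5 := hk.pointing
  have h6 : (g.sharp (s, y) k).1 = 0 := by
    by_contra hne
    exact fst_ne_zero_of_causal h4.le (fun h => hne (by rw [h]; rfl))
      (by
        rw [metric_apply, h2, map_zero, add_zero, neg_mul, neg_eq_zero] at h4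
        rcases mul_eq_zero.1 h4 with h | h
        · exact absurd h (pow_pos (g.lapse_pos _) 2).ne'
        · simpa using h)
  rw [h6, mul_zero] at h5
  exact lt_irrefl _ h5

variable [IsManifold 𝓘(ℝ, E3) ∞ S]

/-- The defining properties of the Levi-Civita flow as a flow of null bicharacteristics. -/
lemma IsLeviCivitaFlow.isTimeFlow {Φ : ℝ → ∀ y : S, CoTS y → ℝ → CotangentM S}
    (h : g.IsLeviCivitaFlow ε Φ) (s : ℝ) (y : S) {η : CoTS y} (hη : η ≠ 0) :
    g.IsTimeFlow (Φ s y η) ∧ ∃ k, g.IsNullLift ε s y η k ∧ Φ s y η s = ⟨(s, y), k⟩ :=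
  (h s y η hη).isTimeFlow hη

lemma IsLeviCivitaFlow.time {Φ : ℝ → ∀ y : S, CoTS y → ℝ → CotangentM S}
    (h : g.IsLeviCivitaFlow ε Φ) (s : ℝ) (y : S) {η : CoTS y} (hη : η ≠ 0) (t : ℝ) :
    (Φ s y η t).1.1 = t := (h.isTimeFlow s y hη).1.time t

variable [T2Space S]

/-- Homogeneity of the Levi-Civita flow. -/
lemma IsLeviCivitaFlow.smul {Φ : ℝ → ∀ y : S, CoTS y → ℝ → CotangentM S}
    (h : g.IsLeviCivitaFlow ε Φ) (hη : η ≠ 0) {l : ℝ} (hl : 0 < l) (t : ℝ) :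
    Φ s y (l • η) t = ⟨(Φ s y η t).1, l • (Φ s y η t).2⟩ := by
  obtain ⟨h1, k, hk, hs⟩ := h.isTimeFlow s y hη
  obtain ⟨h1', k', hk', hs'⟩ := h.isTimeFlow s y (smul_ne_zero hl.ne' hη)
  refine h1'.unique (h1.smul hl.ne') (t₀ := s) ?_ t
  rw [hs', hs, hk'.unique (hk.smul hl)]

/-- Reversal of the Levi-Civita flow. -/
lemma IsLeviCivitaFlow.neg {Φ Φ' : ℝ → ∀ y : S, CoTS y → ℝ → CotangentM S}
    (h : g.IsLeviCivitaFlow ε Φ) (h' : g.IsLeviCivitaFlow (-ε) Φ') (hη : η ≠ 0) (t : ℝ) :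
    Φ' s y (-η) t = ⟨(Φ s y η t).1, -(Φ s y η t).2⟩ := by
  obtain ⟨h1, k, hk, hs⟩ := h.isTimeFlow s y hη
  obtain ⟨h1', k', hk', hs'⟩ := h'.isTimeFlow s y (neg_ne_zero.2 hη)
  have h2 := h1.smul (l := -1) (by norm_num)
  have := h1'.unique h2 (t₀ := s) (by rw [hs', hs, hk'.unique hk.neg, neg_one_smul]) t
  rw [this, neg_one_smul]

/-- The restriction of the covector of the flow is nonzero, and the flow restarts from it. -/
lemma IsLeviCivitaFlow.restart {Φ : ℝ → ∀ y : S, CoTS y → ℝ → CotangentM S}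
    (h : g.IsLeviCivitaFlow ε Φ) (hη : η ≠ 0) {t : ℝ} {x : S} {k : CoTM (t, x)}
    (ht : Φ s y η t = ⟨(t, x), k⟩) :
    g.IsNullLift ε t x (k.comp (ContinuousLinearMap.inr ℝ ℝ (TS x))) k ∧
    ∀ r, Φ t x (k.comp (ContinuousLinearMap.inr ℝ ℝ (TS x))) r = Φ s y η r := by
  obtain ⟨h1, k₀, hk₀, hs⟩ := h.isTimeFlow s y hη
  have hlift : g.IsNullLift ε t x (k.comp (ContinuousLinearMap.inr ℝ ℝ (TS x))) k := by
    refine ⟨rfl, ?_, ?_⟩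
    · have := h1.null t
      rwa [ht] at this
    · have hp := h1.pointing (a := ((ε : ℤ) : ℝ)) (s := s) (by rw [hs]; exact hk₀.pointing) t
      rwa [ht] at hp
  refine ⟨hlift, fun r => ?_⟩
  obtain ⟨h1', k', hk', hs'⟩ := h.isTimeFlow t x hlift.ne_zero
  exact h1'.unique h1 (t₀ := t) (by rw [hs', ht, hk'.unique hlift]) r

end SpacetimeMetric

/-! ### Homogeneity and conjugation symmetry inside normal neighbourhoods. -/

section Symmetries

variable {S : Type*} [TopologicalSpace S] [ChartedSpace E3 S] [IsManifold 𝓘(ℝ, E3) ∞ S]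
  [T2Space S] {g : SpacetimeMetric S} {N : g.NormalNeighbourhoods} {ε : ℤˣ}

lemma IsLeviCivitaPhase.smul {Φ : ℝ → ∀ y : S, CoTS y → ℝ → CotangentM S} {φ : PhaseFunction S}
    (hΦ : g.IsLeviCivitaFlow ε Φ) (hφ : IsLeviCivitaPhase N Φ φ) {t : ℝ} {x : S} {s : ℝ} {y : S}
    {η : CoTS y} (hη : η ≠ 0) (hd : ((Φ s y η t).1, (t, x)) ∈ N.dom) {l : ℝ} (hl : 0 < l) :
    φ t x s y (l • η) = (l : ℂ) * φ t x s y η := by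
  have hΦl := hΦ.smul (s := s) hη hl t
  rw [hφ.formula t x s y η hη hd, hφ.formula t x s y (l • η) (smul_ne_zero hl.ne' hη)
    (by rw [hΦl]; exact hd), hΦl, conorm_smul, abs_of_pos hl]
  simp only [smul_apply, smul_eq_mul]
  push_cast
  ring

lemma IsLeviCivitaPhase.neg {Φ Φ' : ℝ → ∀ y : S, CoTS y → ℝ → CotangentM S}
    {φ φ' : PhaseFunction S} (hΦ : g.IsLeviCivitaFlow ε Φ) (hΦ' : g.IsLeviCivitaFlow (-ε) Φ')
    (hφ : IsLeviCivitaPhase N Φ φ) (hφ' : IsLeviCivitaPhase N Φ' φ')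
    {t : ℝ} {x : S} {s : ℝ} {y : S} {η : CoTS y} (hη : η ≠ 0)
    (hd : ((Φ s y η t).1, (t, x)) ∈ N.dom) :
    φ t x s y η = -(starRingEnd ℂ) (φ' t x s y (-η)) := by
  have hΦl := hΦ.neg hΦ' (s := s) hη t
  have hc : g.conorm s y (-η) = g.conorm s y η := by
    have := conorm_smul (g := g) s y η (-1)
    simpa using this
  rw [hφ.formula t x s y η hη hd, hφ'.formula t x s y (-η) (neg_ne_zero.2 hη)
    (by rw [hΦl]; exact hd), hΦl, hc]
  simp only [neg_apply, Complex.ofReal_neg, neg_neg, map_add, map_mul, Complex.conj_I,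
    Complex.conj_ofReal]
  ring

end Symmetries

/-! ### The two-jet of the world function on the diagonal. -/

section Calculus

variable {F : Type*} [NormedAddCommGroup F] [NormedSpace ℝ F]

/-- A map whose derivative fixes its values and which has an isolated zero has derivative `1`. -/
lemma fderiv_eq_id_of_fixes [CompleteSpace F] {f : F → F} {A : F →L[ℝ] F} {p : F}
    (hf : HasStrictFDerivAt f A p) (h0 : f p = 0) (hiso : ∀ᶠ q in 𝓝 p, f q = 0 → q = p)
    (hfix : ∀ᶠ q in 𝓝 p, A (f q) = f q) : A = ContinuousLinearMap.id ℝ F := by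
  have hAA : A.comp A = A := by
    have h1 : HasFDerivAt (fun q => A (f q)) (A.comp A) p :=
      A.hasFDerivAt.comp p hf.hasFDerivAt
    exact (h1.congr_of_eventuallyEq (hfix.mono fun q hq => hq.symm)).unique hf.hasFDerivAt
  have hAA' : ∀ v, A (A v) = A v := fun v => DFunLike.congr_fun hAA v
  -- Adding the complementary projection of `q - p` gives derivative `A + (1 - A) = 1`, so `G` is
  -- locally onto. For `A w = 0` a small `r • w` equals `G q`; applying `A` gives `f q = 0`, so `q =
  -- p` and `w = 0`.
  let G : F → F := fun q => f q + ((q - p) - A (q - p))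
  have hG : HasStrictFDerivAt G ((ContinuousLinearEquiv.refl ℝ F : F ≃L[ℝ] F) : F →L[ℝ] F) p := by
    have h1 : HasStrictFDerivAt (fun q : F => q - p) (ContinuousLinearMap.id ℝ F) p :=
      (hasStrictFDerivAt_id p).sub_const p
    have h2 := (hf.add (h1.sub (A.hasStrictFDerivAt.comp p h1)))
    refine h2.congr_fderiv ?_
    ext v
    simp
  have hker : ∀ w, A w = 0 → w = 0 := by
    intro w hw
    have hmap := hG.map_nhds_eq_of_equiv
    have hGp : G p = 0 := by simp [G, h0]
    rw [hGp] at hmap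
    have himg : G '' {q | (f q = 0 → q = p) ∧ A (f q) = f q} ∈ 𝓝 (0 : F) := by
      rw [← hmap]
      exact Filter.image_mem_map (hiso.and hfix)
    have hlim : Filter.Tendsto (fun r : ℝ => r • w) (𝓝[≠] 0) (𝓝 0) := by
      have : Filter.Tendsto (fun r : ℝ => r • w) (𝓝 0) (𝓝 ((0 : ℝ) • w)) :=
        (continuous_id.smul continuous_const).tendsto 0
      rw [zero_smul] at this
      exact this.mono_left nhdsWithin_le_nhds
    obtain ⟨r, ⟨q, hq, hqr⟩, hr⟩ := ((hlim.eventually himg).and self_mem_nhdsWithin).exists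
    have h1 : A (G q) = f q := by
      simp only [G, map_add, map_sub, hAA', sub_self, add_zero]
      exact hq.2
    have h2 : f q = 0 := by rw [← h1, hqr, map_smul, hw, smul_zero]
    rw [hq.1 h2, hGp] at hqr
    exact (smul_eq_zero.1 hqr.symm).resolve_left hr
  refine ContinuousLinearMap.ext fun v => ?_
  have := hker (v - A v) (by rw [map_sub, hAA', sub_self])
  exact (sub_eq_zero.1 this).symm

/-- The world function built from a metric and a logarithm in coordinates. -/
def worldOf (G : F → F →L[ℝ] F →L[ℝ] ℝ) (L : F × F → F) (q : F × F) : ℝ :=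
  (1 / 2) * G q.1 (L q) (L q)

variable {G : F → F →L[ℝ] F →L[ℝ] ℝ} {L : F × F → F} {p : F}

lemma contDiffAt_worldOf {q : F × F} (hG : ContDiffAt ℝ ∞ G q.1) (hL : ContDiffAt ℝ ∞ L q) :
    ContDiffAt ℝ ∞ (worldOf G L) q :=
  contDiffAt_const.mul (((hG.comp q contDiffAt_fst).clm_apply hL).clm_apply hL)

lemma eventually_contDiffAt_inr (hL : ContDiffAt ℝ ∞ L (p, p)) :
    ∀ᶠ q in 𝓝 p, ContDiffAt ℝ 1 L (p, q) :=
  (Continuous.prodMk_right p).continuousAt.eventually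
    ((hL.of_le (by norm_cast)).eventually (by simp) : ∀ᶠ x in 𝓝 (p, p), ContDiffAt ℝ 1 L x)

/-- The derivative in `Z` has the form `B q (L (p, q))`, linear in `L`. As `L` vanishes at `q = p`,
the derivative of `B` is irrelevant and only `B p` survives; `∂_Z L = -1` makes it `-G p`. -/
lemma hasFDerivAt_fderiv_left_worldOf (hG : DifferentiableAt ℝ G p)
    (hs : ∀ p u v, G p u v = G p v u) (hL : ContDiffAt ℝ ∞ L (p, p)) (h0 : L (p, p) = 0)
    (hL' : HasFDerivAt L (ContinuousLinearMap.snd ℝ F F - ContinuousLinearMap.fst ℝ F F) (p, p)) :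
    HasFDerivAt (fun q => fderiv ℝ (fun p' => worldOf G L (p', q)) p) (-G p) p := by
  let P : F → F →L[ℝ] F := fun q => (fderiv ℝ L (p, q)).comp (ContinuousLinearMap.inl ℝ F F)
  let B : F → F →L[ℝ] F →L[ℝ] ℝ := fun q =>
    (1 / 2 : ℝ) • ((fderiv ℝ G p).flip (L (p, q))).flip +
      ((ContinuousLinearMap.compL ℝ F F ℝ).flip (P q)).comp (G p)
  have hev : ∀ᶠ q in 𝓝 p, fderiv ℝ (fun p' => worldOf G L (p', q)) p = B q (L (p, q)) := by
    filter_upwards [eventually_contDiffAt_inr hL] with q hq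
    have h1 : HasFDerivAt (fun p' => L (p', q)) (P q) p :=
      HasFDerivAt.comp (g := L) p (hq.differentiableAt (by simp)).hasFDerivAt
        (hasFDerivAt_prodMk_left p q)
    have h2 := ((hG.hasFDerivAt.clm_apply h1).clm_apply h1).const_mul (1 / 2)
    refine h2.fderiv.trans ?_
    ext w
    simp [B]
    rw [hs p (P q w)]
    ring
  refine HasFDerivAt.congr_of_eventuallyEq ?_ hev
  have hLd : HasFDerivAt (fun q => L (p, q)) (ContinuousLinearMap.id ℝ F) p := by
    refine (HasFDerivAt.comp (g := L) p hL' (hasFDerivAt_prodMk_right p p)).congr_fderiv ?_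
    ext; simp
  have hP : DifferentiableAt ℝ P p := by
    have h1 : ContDiffAt ℝ 1 (fderiv ℝ L) (p, p) := hL.fderiv_right (by norm_cast)
    have h2 : DifferentiableAt ℝ (fun q => fderiv ℝ L (p, q)) p :=
      DifferentiableAt.comp (g := fderiv ℝ L) p (h1.differentiableAt (by simp))
        (hasFDerivAt_prodMk_right p p).differentiableAt
    exact h2.clm_comp (differentiableAt_const _)
  have hB : DifferentiableAt ℝ B p := by
    have h1 : DifferentiableAt ℝ (fun q => ((fderiv ℝ G p).flip (L (p, q))).flip) p :=
      (ContinuousLinearMap.flipₗᵢ ℝ F F ℝ).differentiable.differentiableAt.comp p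
        ((fderiv ℝ G p).flip.differentiableAt.comp p hLd.differentiableAt)
    have h2 : DifferentiableAt ℝ
        (fun q => ((ContinuousLinearMap.compL ℝ F F ℝ).flip (P q)).comp (G p)) p :=
      ((ContinuousLinearMap.compL ℝ F F ℝ).flip.differentiableAt.comp p hP).clm_comp
        (differentiableAt_const _)
    exact (h1.const_smul (1 / 2 : ℝ)).add h2
  have hPp : P p = -ContinuousLinearMap.id ℝ F := by
    simp only [P, hL'.fderiv]
    ext; simp
  refine (hB.hasFDerivAt.clm_apply hLd).congr_fderiv ?_
  ext u w
  simp [B, h0, hPp]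

lemma fderiv_left_worldOf_self (hG : DifferentiableAt ℝ G p)
    (hL : ContDiffAt ℝ ∞ L (p, p)) (h0 : L (p, p) = 0) :
    fderiv ℝ (fun p' => worldOf G L (p', p)) p = 0 := by
  have h1 : HasFDerivAt (fun p' => L (p', p)) _ p :=
    HasFDerivAt.comp (g := L) p (hL.differentiableAt (by simp)).hasFDerivAt
      (hasFDerivAt_prodMk_left p p)
  have h2 := ((hG.hasFDerivAt.clm_apply h1).clm_apply h1).const_mul (1 / 2)
  refine h2.fderiv.trans ?_
  ext w
  simp [h0]

/-- Same mechanism as for the derivative in `Z`, now with `∂_X L = 1`. -/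
lemma hasFDerivAt_fderiv_right_worldOf
    (hs : ∀ p u v, G p u v = G p v u) (hL : ContDiffAt ℝ ∞ L (p, p)) (h0 : L (p, p) = 0)
    (hL' : HasFDerivAt L (ContinuousLinearMap.snd ℝ F F - ContinuousLinearMap.fst ℝ F F) (p, p)) :
    HasFDerivAt (fun q => fderiv ℝ (fun q' => worldOf G L (p, q')) q) (G p) p ∧
      fderiv ℝ (fun q' => worldOf G L (p, q')) p = 0 := by
  let Q : F → F →L[ℝ] F := fun q => (fderiv ℝ L (p, q)).comp (ContinuousLinearMap.inr ℝ F F)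
  let B : F → F →L[ℝ] F →L[ℝ] ℝ := fun q =>
    ((ContinuousLinearMap.compL ℝ F F ℝ).flip (Q q)).comp (G p)
  have hev : ∀ᶠ q in 𝓝 p, fderiv ℝ (fun q' => worldOf G L (p, q')) q = B q (L (p, q)) := by
    filter_upwards [eventually_contDiffAt_inr hL] with q hq
    have h1 : HasFDerivAt (fun q' => L (p, q')) (Q q) q :=
      HasFDerivAt.comp (g := L) q (hq.differentiableAt (by simp)).hasFDerivAt
        (hasFDerivAt_prodMk_right p q)
    have h2 := (((hasFDerivAt_const (G p) q).clm_apply h1).clm_apply h1).const_mul (1 / 2)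
    refine h2.fderiv.trans ?_
    ext w
    simp [B]
    rw [hs p (Q q w)]
    ring
  have hLd : HasFDerivAt (fun q => L (p, q)) (ContinuousLinearMap.id ℝ F) p := by
    refine (HasFDerivAt.comp (g := L) p hL' (hasFDerivAt_prodMk_right p p)).congr_fderiv ?_
    ext; simp
  have hQ : DifferentiableAt ℝ Q p := by
    have h1 : ContDiffAt ℝ 1 (fderiv ℝ L) (p, p) := hL.fderiv_right (by norm_cast)
    have h2 : DifferentiableAt ℝ (fun q => fderiv ℝ L (p, q)) p :=
      DifferentiableAt.comp (g := fderiv ℝ L) p (h1.differentiableAt (by simp))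
        (hasFDerivAt_prodMk_right p p).differentiableAt
    exact h2.clm_comp (differentiableAt_const _)
  have hB : DifferentiableAt ℝ B p :=
    ((ContinuousLinearMap.compL ℝ F F ℝ).flip.differentiableAt.comp p hQ).clm_comp
      (differentiableAt_const _)
  have hQp : Q p = ContinuousLinearMap.id ℝ F := by
    simp only [Q, hL'.fderiv]
    ext; simp
  refine ⟨HasFDerivAt.congr_of_eventuallyEq ?_ hev, ?_⟩
  · refine (hB.hasFDerivAt.clm_apply hLd).congr_fderiv ?_
    ext u w
    simp [B, h0, hQp]
  · rw [hev.self_of_nhds, h0, map_zero]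

end Calculus

/-! ### Geodesics between points at the same time are spacelike. -/

namespace SpacetimeMetric.NormalNeighbourhoods

variable {S : Type*} [TopologicalSpace S] [ChartedSpace E3 S]
  {g : SpacetimeMetric S} (N : g.NormalNeighbourhoods) {Z X : ℝ × S}

lemma exists_geodesic (h : (Z, X) ∈ N.dom) : ∃ (J : Set ℝ) (γ : ℝ → ℝ × S),
    IsOpen J ∧ IsPreconnected J ∧ Icc 0 1 ⊆ J ∧ g.IsGeodesicOn γ J ∧ γ 0 = Z ∧ γ 1 = X ∧
    (⟨γ 0, velocity γ 0⟩ : Σ Y : ℝ × S, TM Y) = ⟨Z, N.log Z X⟩ ∧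
    ∀ r ∈ Icc (0 : ℝ) 1, (Z, γ r) ∈ N.dom ∧ N.log Z (γ r) = r • N.log Z X := by
  obtain ⟨J, γ, hJ, hIJ, hγ, h0, h1, hv, hr⟩ := N.geodesic Z X h
  have hmem : (0 : ℝ) ∈ Icc (0 : ℝ) 1 := ⟨le_rfl, zero_le_one⟩
  -- The parameter set of the given geodesic need not be connected, whereas every propagation
  -- argument needs an interval; the component of `0` still contains `[0, 1]`.
  refine ⟨connectedComponentIn J 0, γ, hJ.connectedComponentIn, isPreconnected_connectedComponentIn,
    isPreconnected_Icc.subset_connectedComponentIn hmem hIJ, ?_, h0, h1, hv, hr⟩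
  have hsub := connectedComponentIn_subset J (0 : ℝ)
  exact ⟨hγ.smooth.mono hsub, fun e he τ hτ => hγ.equation e he τ (hsub hτ)⟩

lemma log_self (Z : ℝ × S) : N.log Z Z = 0 := by
  obtain ⟨J, γ, -, -, -, -, h0, -, -, hr⟩ := N.exists_geodesic (N.diag_mem Z)
  have := (hr 0 ⟨le_rfl, zero_le_one⟩).2
  rwa [h0, zero_smul] at this

variable [IsManifold 𝓘(ℝ, E3) ∞ S]

lemma eq_of_velocity_eq_zero [T2Space S] {γ : ℝ → ℝ × S} {J : Set ℝ}
    (hγ : ContMDiffOn 𝓘(ℝ, ℝ) (𝓘(ℝ, ℝ).prod 𝓘(ℝ, E3)) ∞ γ J) (hJ : IsOpen J)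
    (hJc : IsPreconnected J) (hv : ∀ τ ∈ J, velocity γ τ = 0) {a b : ℝ} (ha : a ∈ J)
    (hb : b ∈ J) : γ b = γ a := by
  refine (iff_of_isPreconnected hJc (P := fun r => γ r = γ a) (fun τ hτ => ?_) ha hb).1 rfl
  have hs : (γ τ).2 ∈ (chartAt E3 (γ τ).2).source := mem_chart_source _ _
  set e := chartAt E3 (γ τ).2
  have he : e ∈ atlas E3 S := chart_mem_atlas _ _
  obtain ⟨ε, hε, hball⟩ := Metric.eventually_nhds_iff_ball.1 (eventually_mem_source hγ hJ hτ hs)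
  have hconst : ∀ r ∈ Metric.ball τ ε, curveLoc e γ r = curveLoc e γ τ := by
    intro r hr
    refine Metric.isOpen_ball.is_const_of_deriv_eq_zero (convex_ball τ ε).isPreconnected
      (fun x hx => ((contDiffAt_curveLoc hγ hJ he (hball x hx).1 (hball x hx).2).differentiableAt
        (by simp)).differentiableWithinAt) (fun x hx => ?_) hr (Metric.mem_ball_self hε)
    rw [← vecLoc_velocity hγ hJ he (hball x hx).1 (hball x hx).2, hv x (hball x hx).1, map_zero]
    rfl
  have hγeq : ∀ r ∈ Metric.ball τ ε, γ r = γ τ := by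
    intro r hr
    have h1 := hconst r hr
    exact Prod.ext (congrArg (Prod.fst : ℝ × E3 → ℝ) h1)
      (e.injOn (hball r hr).2 hs (congrArg (Prod.snd : ℝ × E3 → E3) h1))
  filter_upwards [Metric.ball_mem_nhds τ hε] with r hr
  rw [hγeq r hr]

variable [T2Space S]

/-- A geodesic with zero initial velocity is constant. Thus the logarithm has an isolated zero at
the centre. -/
lemma eq_of_log_eq_zero (h : (Z, X) ∈ N.dom) (h0 : N.log Z X = 0) : X = Z := by
  obtain ⟨J, γ, hJ, hJc, hIJ, hγ, rfl, rfl, hv, -⟩ := N.exists_geodesic h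
  have hv : velocity γ 0 = N.log (γ 0) (γ 1) := eq_of_heq (Sigma.mk.inj hv).2
  rw [h0] at hv
  have m0 : (0 : ℝ) ∈ J := hIJ ⟨le_rfl, zero_le_one⟩
  have m1 : (1 : ℝ) ∈ J := hIJ ⟨zero_le_one, le_rfl⟩
  exact eq_of_velocity_eq_zero hγ.smooth hJ hJc
    (fun τ hτ => hγ.velocity_eq_zero hJ hJc subset_rfl m0 hτ hv) m0 m1

/-- Distinct points at the same time have positive world function. -/
lemma metric_log_pos (h : (Z, X) ∈ N.dom) (ht : Z.1 = X.1) (hne : X ≠ Z) :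
    0 < g.metric Z (N.log Z X) (N.log Z X) := by
  by_contra hle
  have hlog : N.log Z X ≠ 0 := fun h0 => hne (N.eq_of_log_eq_zero h h0)
  obtain ⟨J, γ, hJ, hJc, hIJ, hγ, rfl, rfl, hv, -⟩ := N.exists_geodesic h
  have hv : velocity γ 0 = N.log (γ 0) (γ 1) := eq_of_heq (Sigma.mk.inj hv).2
  rw [← hv] at hle hlog
  have m0 : (0 : ℝ) ∈ J := hIJ ⟨le_rfl, zero_le_one⟩
  have m1 : (1 : ℝ) ∈ J := hIJ ⟨zero_le_one, le_rfl⟩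
  -- If the squared length were not positive, the geodesic would be causal throughout by
  -- conservation of energy, so time would be injective along it, contradicting equal times at its
  -- ends.
  have hV : ∀ τ ∈ J, (velocity γ τ).1 ≠ 0 := by
    intro τ hτ
    refine fst_ne_zero_of_causal (g := g) ?_ fun h0 =>
      hlog (hγ.velocity_eq_zero hJ hJc subset_rfl hτ m0 h0)
    rw [hγ.energy_eq hJ hJc subset_rfl m0 hτ]
    exact not_lt.1 hle
  exact zero_ne_one (time_injOn hγ.smooth hJ hJc.ordConnected subset_rfl hV m0 m1 ht)

lemma worldFunction_pos (h : (Z, X) ∈ N.dom) (ht : Z.1 = X.1) (hne : X ≠ Z) :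
    0 < N.worldFunction X Z :=
  mul_pos (by norm_num) (N.metric_log_pos h ht hne)

end SpacetimeMetric.NormalNeighbourhoods

/-! ### Logarithm and world function in coordinates. -/

section Coordinates

variable {S : Type*} [TopologicalSpace S] [ChartedSpace E3 S]
  {g : SpacetimeMetric S} (N : g.NormalNeighbourhoods) {e : OpenPartialHomeomorph S E3}

/-- The spacetime point with given coordinates. -/
def ptSymm (e : OpenPartialHomeomorph S E3) (p : ℝ × E3) : ℝ × S := (p.1, e.symm p.2)

/-- The logarithm of a normal neighbourhood in local coordinates. -/
def logLoc (e : OpenPartialHomeomorph S E3) (q : (ℝ × E3) × (ℝ × E3)) : ℝ × E3 :=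
  vecLoc e (ptSymm e q.1) (N.log (ptSymm e q.1) (ptSymm e q.2))

/-- The coordinate domain of the logarithm. -/
def domLoc (e : OpenPartialHomeomorph S E3) : Set ((ℝ × E3) × (ℝ × E3)) :=
  {q | q.1.2 ∈ e.target ∧ q.2.2 ∈ e.target ∧ (ptSymm e q.1, ptSymm e q.2) ∈ N.dom}

omit [ChartedSpace E3 S] in
lemma ptSymm_ptLoc {X : ℝ × S} (hX : X.2 ∈ e.source) : ptSymm e (ptLoc e X) = X :=
  Prod.ext rfl (e.left_inv hX)

omit [ChartedSpace E3 S] in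
lemma ptLoc_ptSymm {p : ℝ × E3} (hp : p.2 ∈ e.target) : ptLoc e (ptSymm e p) = p :=
  Prod.ext rfl (e.right_inv hp)

omit [ChartedSpace E3 S] in
lemma continuousAt_ptSymm {p : ℝ × E3} (hp : p.2 ∈ e.target) : ContinuousAt (ptSymm e) p :=
  continuousAt_fst.prodMk ((e.continuousAt_symm hp).comp continuousAt_snd)

lemma domLoc_mem_nhds {q : (ℝ × E3) × (ℝ × E3)} (hq : q ∈ domLoc N e) : domLoc N e ∈ 𝓝 q := by
  have h1 : ∀ᶠ r : (ℝ × E3) × (ℝ × E3) in 𝓝 q, r.1.2 ∈ e.target :=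
    (continuous_fst.snd).continuousAt.eventually (e.open_target.mem_nhds hq.1)
  have h2 : ∀ᶠ r : (ℝ × E3) × (ℝ × E3) in 𝓝 q, r.2.2 ∈ e.target :=
    (continuous_snd.snd).continuousAt.eventually (e.open_target.mem_nhds hq.2.1)
  have h3 : ContinuousAt (fun r : (ℝ × E3) × (ℝ × E3) => (ptSymm e r.1, ptSymm e r.2)) q :=
    ((continuousAt_ptSymm hq.1).comp continuousAt_fst).prodMk
      ((continuousAt_ptSymm hq.2.1).comp continuousAt_snd)
  exact h1.and (h2.and (h3.eventually (N.isOpen_dom.mem_nhds hq.2.2)))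

lemma diag_mem_domLoc {p : ℝ × E3} (hp : p.2 ∈ e.target) : (p, p) ∈ domLoc N e :=
  ⟨hp, hp, N.diag_mem _⟩

lemma contDiffAt_logLoc (he : e ∈ atlas E3 S) {q : (ℝ × E3) × (ℝ × E3)}
    (hq : q ∈ domLoc N e) : ContDiffAt ℝ ∞ (logLoc N e) q :=
  (N.log_smooth e he e he).contDiffAt (domLoc_mem_nhds N hq)

lemma logLoc_self (p : ℝ × E3) : logLoc N e (p, p) = 0 := by
  rw [logLoc, N.log_self, map_zero]

variable [IsManifold 𝓘(ℝ, E3) ∞ S]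

lemma worldOf_logLoc (he : e ∈ atlas E3 S) {q : (ℝ × E3) × (ℝ × E3)} (hq : q.1.2 ∈ e.target) :
    worldOf (g.metricLoc e) (logLoc N e) q = N.worldFunction (ptSymm e q.2) (ptSymm e q.1) := by
  have h := metricLoc_vecLoc g he (X := ptSymm e q.1) (e.map_target hq)
    (N.log (ptSymm e q.1) (ptSymm e q.2)) (N.log (ptSymm e q.1) (ptSymm e q.2))
  rw [ptLoc_ptSymm hq] at h
  rw [worldOf, SpacetimeMetric.NormalNeighbourhoods.worldFunction, ← h]
  rfl

variable [T2Space S]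

omit [T2Space S] in
-- The logarithm of the radial geodesic is `r • log q`; differentiating at `r = 0`, where the
-- geodesic has velocity `log q`, shows that the derivative at the centre fixes the values of the
-- logarithm.
lemma fderiv_logLoc_right (he : e ∈ atlas E3 S) {p q : ℝ × E3} (hq : (p, q) ∈ domLoc N e) :
    fderiv ℝ (fun q => logLoc N e (p, q)) p (logLoc N e (p, q)) = logLoc N e (p, q) := by
  have hp := hq.1
  obtain ⟨J, γ, hJ, hJc, hIJ, hγ, h0, h1, hv, hr⟩ := N.exists_geodesic hq.2.2
  have m0 : (0 : ℝ) ∈ J := hIJ ⟨le_rfl, zero_le_one⟩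
  have hs : (γ 0).2 ∈ e.source := by rw [h0]; exact e.map_target hp
  have hp0 : curveLoc e γ 0 = p := by
    have : curveLoc e γ 0 = ptLoc e (γ 0) := rfl
    rw [this, h0, ptLoc_ptSymm hp]
  have hd : HasDerivAt (curveLoc e γ) (logLoc N e (p, q)) 0 := by
    have h2 := ((contDiffAt_curveLoc hγ.smooth hJ he m0 hs).differentiableAt
      (by simp)).hasDerivAt
    rw [← vecLoc_velocity hγ.smooth hJ he m0 hs] at h2
    have h3 : vecLoc e (γ 0) (velocity γ 0) = logLoc N e (p, q) :=
      congrArg (fun w : Σ Y : ℝ × S, TM Y => vecLoc e w.1 w.2) hv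
    rwa [h3] at h2
  have hL : HasFDerivAt (fun q => logLoc N e (p, q))
      (fderiv ℝ (fun q => logLoc N e (p, q)) p) (curveLoc e γ 0) := by
    rw [hp0]
    exact (((contDiffAt_logLoc N he (diag_mem_domLoc N hp)).comp p
      (contDiffAt_const.prodMk contDiffAt_id)).differentiableAt (by simp)).hasFDerivAt
  have h4 := (hL.comp_hasDerivAt 0 hd).hasDerivWithinAt (s := Icc 0 1)
  -- The radial identity holds only for `r` in `[0, 1]`, so one-sided derivatives are compared.
  have h5 : HasDerivWithinAt (fun r : ℝ => r • logLoc N e (p, q)) (logLoc N e (p, q))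
      (Icc 0 1) 0 := by
    simpa using ((hasDerivAt_id (0 : ℝ)).smul_const (logLoc N e (p, q))).hasDerivWithinAt
  have h6 : ∀ᶠ r in 𝓝[Icc 0 1] (0 : ℝ),
      ((fun q => logLoc N e (p, q)) ∘ curveLoc e γ) r = r • logLoc N e (p, q) := by
    filter_upwards [self_mem_nhdsWithin, (eventually_mem_source hγ.smooth hJ m0 hs).filter_mono
      nhdsWithin_le_nhds] with r hrI hrs
    have h7 : ptSymm e (curveLoc e γ r) = γ r := ptSymm_ptLoc (e := e) hrs.2
    change vecLoc e (ptSymm e p) (N.log (ptSymm e p) (ptSymm e (curveLoc e γ r))) = _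
    rw [h7, (hr r hrI).2, map_smul]
    rfl
  have h8 := h5.congr_of_eventuallyEq h6 (h6.self_of_nhdsWithin ⟨le_rfl, zero_le_one⟩)
  exact (uniqueDiffOn_Icc zero_lt_one 0 ⟨le_rfl, zero_le_one⟩).eq_deriv _ h4 h8

/-- The derivative in the second point is the identity by `fderiv_eq_id_of_fixes`. Since the
logarithm vanishes identically on the diagonal, the derivative in the first point is minus the
identity. -/
lemma hasFDerivAt_logLoc (he : e ∈ atlas E3 S) {p : ℝ × E3} (hp : p.2 ∈ e.target) :
    HasFDerivAt (logLoc N e) (ContinuousLinearMap.snd ℝ (ℝ × E3) (ℝ × E3) -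
      ContinuousLinearMap.fst ℝ (ℝ × E3) (ℝ × E3)) (p, p) := by
  have hL := contDiffAt_logLoc N he (diag_mem_domLoc N hp)
  have hr : ContDiffAt ℝ ∞ (fun q => logLoc N e (p, q)) p :=
    hL.comp p (contDiffAt_const.prodMk contDiffAt_id)
  have hev : ∀ᶠ q in 𝓝 p, (p, q) ∈ domLoc N e :=
    (Continuous.prodMk_right p).continuousAt.eventually (domLoc_mem_nhds N (diag_mem_domLoc N hp))
  have hid := fderiv_eq_id_of_fixes (f := fun q => logLoc N e (p, q)) (p := p)
    (hr.hasStrictFDerivAt (by simp)) (logLoc_self N p) (by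
      filter_upwards [hev] with q hq h0
      have h1 : N.log (ptSymm e p) (ptSymm e q) = 0 :=
        (vecLoc_bijective he (X := ptSymm e p) (e.map_target hq.1)).1
          (h0.trans (map_zero _).symm)
      have h2 := N.eq_of_log_eq_zero hq.2.2 h1
      exact (ptLoc_ptSymm hq.2.1).symm.trans ((congrArg (ptLoc e) h2).trans (ptLoc_ptSymm hq.1)))
    (hev.mono fun q hq => fderiv_logLoc_right N he hq)
  have hD := (hL.differentiableAt (by simp)).hasFDerivAt
  have h1 : HasFDerivAt (fun q => logLoc N e (p, q)) _ p :=
    HasFDerivAt.comp (g := logLoc N e) p hD (hasFDerivAt_prodMk_right p p)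
  have h2 : HasFDerivAt (fun q => logLoc N e (q, q)) _ p :=
    HasFDerivAt.comp (g := logLoc N e) p hD ((hasFDerivAt_id p).prodMk (hasFDerivAt_id p))
  have h3 : HasFDerivAt (fun q => logLoc N e (q, q)) (0 : (ℝ × E3) →L[ℝ] (ℝ × E3)) p := by
    simp_rw [logLoc_self]
    exact hasFDerivAt_const _ _
  have h4 := h1.fderiv.symm.trans hid
  have h5 := h2.unique h3
  have h4' : ∀ u, fderiv ℝ (logLoc N e) (p, p) (0, u) = u := fun u => DFunLike.congr_fun h4 u
  have h5' : ∀ u, fderiv ℝ (logLoc N e) (p, p) (u, u) = 0 := fun u => DFunLike.congr_fun h5 u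
  refine hD.congr_fderiv (ContinuousLinearMap.ext fun w => ?_)
  have h6 : w = (w.1, w.1) + (0, w.2 - w.1) := by simp
  conv_lhs => rw [h6, map_add, h4', h5', zero_add]
  rfl

omit [T2Space S] in
/-- The gradient of the world function in coordinates. -/
lemma covector_gradWorldFunction (he : e ∈ atlas E3 S) {X Z : ℝ × S} (hX : X.2 ∈ e.source)
    (hZ : Z.2 ∈ e.source) (hd : (Z, X) ∈ N.dom) (k : CoTM Z) :
    k (N.gradWorldFunction X Z) = covecLoc e ⟨Z, k⟩ ((g.metricLoc e (ptLoc e Z)).inverse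
      (fderiv ℝ (fun p => worldOf (g.metricLoc e) (logLoc N e) (p, ptLoc e X)) (ptLoc e Z))) := by
  have hp : (ptLoc e Z).2 ∈ e.target := e.map_source hZ
  have hq : (ptLoc e X).2 ∈ e.target := e.map_source hX
  have hmem : (ptLoc e Z, ptLoc e X) ∈ domLoc N e := by
    refine ⟨hp, hq, ?_⟩
    rw [ptSymm_ptLoc hZ, ptSymm_ptLoc hX]; exact hd
  have hsm : ContDiffAt ℝ ∞ (fun p => worldOf (g.metricLoc e) (logLoc N e) (p, ptLoc e X))
      (ptLoc e Z) :=
    ContDiffAt.comp (g := worldOf (g.metricLoc e) (logLoc N e)) (ptLoc e Z)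
      (contDiffAt_worldOf (contDiffAt_metricLoc g he hp) (contDiffAt_logLoc N he hmem))
      (contDiffAt_id.prodMk contDiffAt_const)
  have hchart : HasMFDerivAt (𝓘(ℝ, ℝ).prod 𝓘(ℝ, E3)) 𝓘(ℝ, ℝ × E3) (ptLoc e) Z (vecLoc e Z) := by
    have h1 : HasMFDerivAt 𝓘(ℝ, E3) 𝓘(ℝ, E3) e Z.2 (dChart e Z.2) :=
      ((chart_mdiff he).mdifferentiableAt hZ).hasMFDerivAt
    have h2 : HasMFDerivAt (𝓘(ℝ, ℝ).prod 𝓘(ℝ, E3)) 𝓘(ℝ, ℝ) Prod.fst Z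
      (ContinuousLinearMap.fst ℝ ℝ (TS Z.2)) := hasMFDerivAt_fst Z
    have h3 : HasMFDerivAt (𝓘(ℝ, ℝ).prod 𝓘(ℝ, E3)) 𝓘(ℝ, E3) (fun X : ℝ × S => e X.2) Z
      ((dChart e Z.2).comp (ContinuousLinearMap.snd ℝ ℝ (TS Z.2))) :=
      h1.comp Z (hasMFDerivAt_snd Z)
    exact ⟨h2.1.prodMk h3.1, h2.2.prodMk h3.2⟩
  have h1 := (hsm.differentiableAt (by simp)).hasFDerivAt.hasMFDerivAt.comp Z hchart
  have hev : (fun Z' => N.worldFunction X Z') =ᶠ[𝓝 Z]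
      (fun p => worldOf (g.metricLoc e) (logLoc N e) (p, ptLoc e X)) ∘ ptLoc e := by
    filter_upwards [continuousAt_snd.eventually (e.open_source.mem_nhds hZ)] with Z' hZ'
    have := worldOf_logLoc N he (q := (ptLoc e Z', ptLoc e X)) (e.map_source hZ')
    rw [ptSymm_ptLoc hZ', ptSymm_ptLoc hX] at this
    exact this.symm
  have h2 := (h1.congr_of_eventuallyEq hev).mfderiv
  let D : CoTM Z := (fderiv ℝ (fun p => worldOf (g.metricLoc e) (logLoc N e) (p, ptLoc e X))
    (ptLoc e Z)).comp (vecLoc e Z)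
  have h3 : N.gradWorldFunction X Z = g.sharp Z D := congrArg (g.sharp Z) h2
  rw [h3, ← covecLoc_vecLoc he hZ k, vecLoc_sharp g he hZ]
  congr 2
  refine ContinuousLinearMap.ext fun u => ?_
  obtain ⟨w, rfl⟩ := (vecLoc_bijective he hZ).2 u
  rw [covecLoc_vecLoc he hZ]
  rfl

end Coordinates

/-- Curves of isolated zeros of a continuous function that depend continuously on the parameter at
one time do so at all times. -/
lemma continuousAt_zero_curve {S Θ : Type*} [MetricSpace S] [CompactSpace S] [TopologicalSpace Θ]
    {x : ℝ → Θ → S} {s : Θ → ℝ} {φ : ℝ → S → Θ → ℂ} {θ₀ : Θ} {V : Set ((ℝ × S) × (ℝ × S))}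
    (hV : IsOpen V) (hdiag : ∀ Z, (Z, Z) ∈ V)
    (hx : ∀ᶠ θ in 𝓝 θ₀, Continuous fun t => x t θ) (hs : ContinuousAt s θ₀)
    (hinit : ContinuousAt (fun θ => x (s θ) θ) θ₀)
    (hφ : ∀ t x', ContinuousAt (fun q : (ℝ × S) × Θ => φ q.1.1 q.1.2 q.2) ((t, x'), θ₀))
    (h0 : ∀ᶠ θ in 𝓝 θ₀, ∀ t, φ t (x t θ) θ = 0)
    (hiso : ∀ t x', ((t, x t θ₀), (t, x')) ∈ V → φ t x' θ₀ = 0 → x' = x t θ₀) (t₀ : ℝ) :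
    ContinuousAt (fun q : ℝ × Θ => x q.1 q.2) (t₀, θ₀) := by
  have hx0 : Continuous fun t => x t θ₀ := hx.self_of_nhds
  -- A compact time interval with both the initial time and the target time in its interior.
  let a := min (s θ₀) t₀ - 1
  let b := max (s θ₀) t₀ + 1
  have hsI : s θ₀ ∈ Ioo a b :=
    ⟨by have := min_le_left (s θ₀) t₀; simp only [a]; linarith,
      by have := le_max_left (s θ₀) t₀; simp only [b]; linarith⟩
  have htI : t₀ ∈ Ioo a b :=
    ⟨by have := min_le_right (s θ₀) t₀; simp only [a]; linarith,
      by have := le_max_right (s θ₀) t₀; simp only [b]; linarith⟩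
  obtain ⟨δ, hδ, hδV⟩ : ∃ δ > 0, ∀ t ∈ Icc a b, ∀ x', dist x' (x t θ₀) ≤ δ →
      ((t, x t θ₀), (t, x')) ∈ V := by
    have hK : IsCompact ((fun t => (((t, x t θ₀), (t, x t θ₀)) : (ℝ × S) × (ℝ × S))) ''
        Icc a b) :=
      isCompact_Icc.image ((continuous_id.prodMk hx0).prodMk (continuous_id.prodMk hx0))
    obtain ⟨δ, hδ, hsub⟩ := hK.exists_cthickening_subset_open hV (by
      rintro _ ⟨t, -, rfl⟩; exact hdiag _)
    refine ⟨δ, hδ, fun t ht x' hd => hsub ?_⟩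
    refine Metric.mem_cthickening_of_dist_le _ _ δ _ (mem_image_of_mem _ ht) ?_
    simpa [Prod.dist_eq, hδ.le] using hd
  refine Metric.continuousAt_iff'.2 fun ε hε => ?_
  -- Radius of a tube about the reference curve: inside the isolating neighbourhoods, and small
  -- enough to leave `ε / 2` for the motion of the reference curve itself.
  let ρ := min (ε / 2) δ
  have hρ : 0 < ρ := lt_min (by linarith) hδ
  have hC : IsCompact {c : ℝ × S | c.1 ∈ Icc a b ∧ dist c.2 (x c.1 θ₀) = ρ} := by
    refine (isCompact_Icc.prod isCompact_univ :
      IsCompact (Icc a b ×ˢ (univ : Set S))).of_isClosed_subset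
      ?_ fun c hc => ⟨hc.1, mem_univ _⟩
    exact (isClosed_Icc.preimage continuous_fst).inter
      (isClosed_eq (continuous_snd.dist (hx0.comp continuous_fst)) continuous_const)
  -- On the wall of the tube `φ` is nonzero at `θ₀`, and by compactness also for all nearby
  -- parameters.
  have hne : ∀ᶠ θ in 𝓝 θ₀, ∀ c ∈ {c : ℝ × S | c.1 ∈ Icc a b ∧ dist c.2 (x c.1 θ₀) = ρ},
      φ c.1 c.2 θ ≠ 0 := by
    refine hC.eventually_forall_of_forall_eventually fun c hc => ?_
    refine (ContinuousAt.comp (f := Prod.swap) (x := (θ₀, c)) (hφ c.1 c.2)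
      continuous_swap.continuousAt).eventually (isOpen_ne.mem_nhds fun hz => ?_)
    have h1 := hiso c.1 c.2 (hδV c.1 hc.1 c.2 (hc.2.le.trans (min_le_right _ _))) hz
    have h2 := hc.2
    rw [h1, dist_self] at h2
    exact hρ.ne h2
  have hstart : ∀ᶠ θ in 𝓝 θ₀, s θ ∈ Icc a b ∧ dist (x (s θ) θ) (x (s θ) θ₀) < ρ := by
    have h1 : ContinuousAt (fun θ => dist (x (s θ) θ) (x (s θ) θ₀)) θ₀ :=
      hinit.dist (ContinuousAt.comp (g := fun t => x t θ₀) hx0.continuousAt hs)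
    exact (hs.eventually (Icc_mem_nhds hsI.1 hsI.2)).and
      (h1.eventually (gt_mem_nhds (by simpa using hρ)))
  -- A nearby curve starts inside the tube and would have to meet the wall in order to leave, which
  -- is impossible for a curve of zeros.
  have hall : ∀ᶠ θ in 𝓝 θ₀, ∀ t ∈ Icc a b, dist (x t θ) (x t θ₀) < ρ := by
    filter_upwards [hne, hstart, hx, h0] with θ h1 h2 h3 h4 t ht
    by_contra hge
    obtain ⟨r, hr, hrρ⟩ := isPreconnected_Icc.intermediate_value h2.1 ht
      (h3.dist hx0).continuousOn ⟨h2.2.le, not_lt.1 hge⟩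
    exact h1 (r, x r θ) ⟨hr, hrρ⟩ (h4 r)
  have hclose : ∀ᶠ t in 𝓝 t₀, dist (x t θ₀) (x t₀ θ₀) < ε / 2 :=
    Metric.continuousAt_iff'.1 hx0.continuousAt _ (by linarith)
  have hI : ∀ᶠ t in 𝓝 t₀, t ∈ Icc a b := Icc_mem_nhds htI.1 htI.2
  rw [nhds_prod_eq]
  filter_upwards [(hI.and hclose).prod_mk hall] with q hq
  have h1 := hq.2 q.1 hq.1.1
  have h2 : ρ ≤ ε / 2 := min_le_left _ _
  calc dist (x q.1 q.2) (x t₀ θ₀) ≤ dist (x q.1 q.2) (x q.1 θ₀) + dist (x q.1 θ₀) (x t₀ θ₀) :=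
        dist_triangle _ _ _
    _ < ε := by linarith [hq.1.2]

/-! ### The phase function as a function of coordinates. -/

section PhaseCoordinates

variable {S : Type*} [TopologicalSpace S] [ChartedSpace E3 S]
  {g : SpacetimeMetric S} {N : g.NormalNeighbourhoods} {e f : OpenPartialHomeomorph S E3}
  {ε : ℤˣ} {Φ : ℝ → ∀ y : S, CoTS y → ℝ → CotangentM S} {φ : PhaseFunction S}

/-- The coordinates `(t, s, w, p)` of a time `t` and of initial data `(s, y, η)` of the flow. -/
abbrev Param : Type := ℝ × ℝ × E3 × (E3 →L[ℝ] ℝ)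

/-- The covector with coordinates `p` at the point with coordinates `w`. -/
def etaLoc (f : OpenPartialHomeomorph S E3) (w : E3) (p : E3 →L[ℝ] ℝ) : CoTS (f.symm w) :=
  p.comp (dChart f (f.symm w))

/-- The coordinates of nonzero covectors. -/
def paramDom (f : OpenPartialHomeomorph S E3) : Set Param :=
  {θ | θ.2.2.1 ∈ f.target ∧ θ.2.2.2 ≠ 0}

/-- The flow as a function of coordinates of the initial data. -/
def flowAt (Φ : ℝ → ∀ y : S, CoTS y → ℝ → CotangentM S) (f : OpenPartialHomeomorph S E3)
    (θ : Param) : CotangentM S :=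
  Φ θ.2.1 (f.symm θ.2.2.1) (etaLoc f θ.2.2.1 θ.2.2.2) θ.1

/-- A phase function in coordinates. -/
def phaseLoc (φ : PhaseFunction S) (e f : OpenPartialHomeomorph S E3) (q : Param × E3) : ℂ :=
  φ q.1.1 (e.symm q.2) q.1.2.1 (f.symm q.1.2.2.1) (etaLoc f q.1.2.2.1 q.1.2.2.2)

/-- The norm of the initial covector in coordinates. -/
def conormLoc (g : SpacetimeMetric S) (f : OpenPartialHomeomorph S E3) (θ : Param) : ℝ :=
  g.conorm θ.2.1 (f.symm θ.2.2.1) (etaLoc f θ.2.2.1 θ.2.2.2)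

omit [ChartedSpace E3 S] in
lemma isOpen_paramDom : IsOpen (paramDom f) :=
  (f.open_target.preimage continuous_snd.snd.fst).inter
    (isOpen_ne.preimage continuous_snd.snd.snd)

lemma contDiffAt_phaseLoc (hφ : φ.IsSmooth) (he : e ∈ atlas E3 S) (hf : f ∈ atlas E3 S)
    {q : Param × E3} (hq : q.1 ∈ paramDom f) (hz : q.2 ∈ e.target) :
    ContDiffAt ℝ ∞ (phaseLoc φ e f) q := by
  have hopen : IsOpen {q : ℝ × E3 × ℝ × E3 × (E3 →L[ℝ] ℝ) |
      q.2.1 ∈ e.target ∧ q.2.2.2.1 ∈ f.target ∧ q.2.2.2.2 ≠ 0} :=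
    (e.open_target.preimage continuous_snd.fst).inter
      ((f.open_target.preimage continuous_snd.snd.snd.fst).inter
        (isOpen_ne.preimage continuous_snd.snd.snd.snd))
  have h1 := (hφ e he f hf).contDiffAt (x := (q.1.1, q.2, q.1.2)) (hopen.mem_nhds ⟨hz, hq⟩)
  exact h1.comp q (contDiffAt_fst.fst.prodMk (contDiffAt_snd.prodMk contDiffAt_fst.snd))

variable [IsManifold 𝓘(ℝ, E3) ∞ S]

lemma etaLoc_ne_zero (hf : f ∈ atlas E3 S) {w : E3} (hw : w ∈ f.target) {p : E3 →L[ℝ] ℝ}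
    (hp : p ≠ 0) : etaLoc f w p ≠ 0 := by
  intro h
  refine hp (ContinuousLinearMap.ext fun u => ?_)
  have h1 := DFunLike.congr_fun h (dSymm f w u)
  change p (dChart f (f.symm w) (dSymm f w u)) = 0 at h1
  rwa [dChart_dSymm hf hw] at h1

lemma etaLoc_param_ne_zero (hf : f ∈ atlas E3 S) {θ : Param} (hθ : θ ∈ paramDom f) :
    etaLoc f θ.2.2.1 θ.2.2.2 ≠ 0 := etaLoc_ne_zero hf hθ.1 hθ.2

lemma flowAt_time (hΦ : g.IsLeviCivitaFlow ε Φ) (hf : f ∈ atlas E3 S) {θ : Param}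
    (hθ : θ ∈ paramDom f) : (flowAt Φ f θ).1.1 = θ.1 :=
  hΦ.time _ _ (etaLoc_param_ne_zero hf hθ) _

/-- The defining formula of a phase function in coordinates. -/
lemma eventually_phaseLoc_eq (hφ : IsLeviCivitaPhase N Φ φ)
    (hΦ : g.IsLeviCivitaFlow ε Φ) (he : e ∈ atlas E3 S) (hf : f ∈ atlas E3 S) {θ : Param}
    (hθ : θ ∈ paramDom f) (hs : (flowAt Φ f θ).1.2 ∈ e.source) :
    ∀ᶠ z in 𝓝 (e (flowAt Φ f θ).1.2), phaseLoc φ e f (θ, z) =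
      ((-(covecLoc e (flowAt Φ f θ) ((g.metricLoc e (ptLoc e (flowAt Φ f θ).1)).inverse
        (fderiv ℝ (fun p => worldOf (g.metricLoc e) (logLoc N e) (p, (θ.1, z)))
          (ptLoc e (flowAt Φ f θ).1)))) : ℝ) : ℂ) +
      Complex.I * ((conormLoc g f θ * worldOf (g.metricLoc e) (logLoc N e)
        (ptLoc e (flowAt Φ f θ).1, (θ.1, z)) : ℝ) : ℂ) := by
  have ht := flowAt_time hΦ hf hθ
  set k := flowAt Φ f θ with hk
  have hz0 : e k.1.2 ∈ e.target := e.map_source hs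
  have hpt : ptLoc e k.1 = (θ.1, e k.1.2) := Prod.ext ht rfl
  have hc : ContinuousAt (fun z : E3 => (ptLoc e k.1, (θ.1, z))) (e k.1.2) :=
    (continuous_const.prodMk (continuous_const.prodMk continuous_id)).continuousAt
  have hmem : (ptLoc e k.1, (θ.1, e k.1.2)) ∈ domLoc N e := by
    rw [← hpt]; exact diag_mem_domLoc N hz0
  filter_upwards [hc.eventually (domLoc_mem_nhds N hmem)] with z hz
  have hX : ptSymm e (ptLoc e k.1) = k.1 := ptSymm_ptLoc hs
  have hdom : (k.1, (θ.1, e.symm z)) ∈ N.dom := by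
    have := hz.2.2
    rwa [hX] at this
  have hzs : (θ.1, e.symm z).2 ∈ e.source := e.map_target hz.2.1
  have hform := hφ.formula θ.1 (e.symm z) θ.2.1 (f.symm θ.2.2.1) (etaLoc f θ.2.2.1 θ.2.2.2)
    (etaLoc_param_ne_zero hf hθ) hdom
  have hpz : ptLoc e (θ.1, e.symm z) = (θ.1, z) := Prod.ext rfl (e.right_inv hz.2.1)
  have hgrad := covector_gradWorldFunction N he (X := (θ.1, e.symm z)) (Z := k.1) hzs hs hdom k.2
  have hw := worldOf_logLoc N he (q := (ptLoc e k.1, (θ.1, z))) hz0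
  rw [hpz] at hgrad
  rw [hX] at hw
  refine hform.trans ?_
  change -((k.2 (N.gradWorldFunction (θ.1, e.symm z) k.1) : ℝ) : ℂ) + Complex.I *
    (conormLoc g f θ : ℂ) * (N.worldFunction (θ.1, e.symm z) k.1 : ℂ) = _
  rw [hgrad, hw]
  push_cast
  rw [mul_assoc]
  rfl

end PhaseCoordinates

/-! ### Jets of the phase function and continuity of the flow. -/

section PhaseJets

variable {S : Type*} [TopologicalSpace S] [ChartedSpace E3 S] [IsManifold 𝓘(ℝ, E3) ∞ S]
  [T2Space S]
  {g : SpacetimeMetric S} {N : g.NormalNeighbourhoods} {e f : OpenPartialHomeomorph S E3}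
  {ε : ℤˣ} {Φ : ℝ → ∀ y : S, CoTS y → ℝ → CotangentM S} {φ : PhaseFunction S} {θ : Param}

/-- The spatial part of a covector of spacetime in coordinates. -/
def xiLoc (e : OpenPartialHomeomorph S E3) (k : CotangentM S) : E3 →L[ℝ] ℝ :=
  (covecLoc e k).comp (ContinuousLinearMap.inr ℝ ℝ E3)

omit [T2Space S] in
lemma contDiffAt_worldOf_right (he : e ∈ atlas E3 S) {P : ℝ × E3} (hP : P.2 ∈ e.target) :
    ContDiffAt ℝ ∞ (fun q => worldOf (g.metricLoc e) (logLoc N e) (P, q)) P :=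
  ContDiffAt.comp (g := worldOf (g.metricLoc e) (logLoc N e)) P
    (contDiffAt_worldOf (contDiffAt_metricLoc g he hP)
      (contDiffAt_logLoc N he (diag_mem_domLoc N hP)))
    (contDiffAt_const.prodMk contDiffAt_id)

/-- The phase function vanishes along the flow, where its differential is the covector of the
flow. -/
lemma phaseLoc_jet (hφ : IsLeviCivitaPhase N Φ φ)
    (hΦ : g.IsLeviCivitaFlow ε Φ) (he : e ∈ atlas E3 S) (hf : f ∈ atlas E3 S)
    (hθ : θ ∈ paramDom f) (hs : (flowAt Φ f θ).1.2 ∈ e.source) :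
    phaseLoc φ e f (θ, e (flowAt Φ f θ).1.2) = 0 ∧
    HasFDerivAt (fun z => phaseLoc φ e f (θ, z))
      (Complex.ofRealCLM.comp (xiLoc e (flowAt Φ f θ))) (e (flowAt Φ f θ).1.2) := by
  have hev := eventually_phaseLoc_eq hφ hΦ he hf hθ hs
  have ht := flowAt_time hΦ hf hθ
  set k := flowAt Φ f θ
  have hP : (ptLoc e k.1).2 ∈ e.target := e.map_source hs
  have hpt : ptLoc e k.1 = (θ.1, e k.1.2) := Prod.ext ht rfl
  have hG := contDiffAt_metricLoc g he hP
  have hL := contDiffAt_logLoc N he (diag_mem_domLoc N hP)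
  have hL0 := logLoc_self N (e := e) (ptLoc e k.1)
  have hL' := hasFDerivAt_logLoc N he hP
  have hleft := hasFDerivAt_fderiv_left_worldOf (hG.differentiableAt (by simp))
    (metricLoc_symm g) hL hL0 hL'
  have hleft0 := fderiv_left_worldOf_self (hG.differentiableAt (by simp)) hL hL0
  have hright0 := (hasFDerivAt_fderiv_right_worldOf (metricLoc_symm g (e := e)) hL hL0 hL').2
  have hW := ((contDiffAt_worldOf_right (N := N) he hP).differentiableAt (by simp)).hasFDerivAt
  rw [hright0] at hW
  have hinv := metricLoc_isInvertible g he hP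
  generalize ptLoc e k.1 = P at *
  subst hpt
  constructor
  · rw [hev.self_of_nhds, hleft0, map_zero, map_zero]
    have : worldOf (g.metricLoc e) (logLoc N e) ((θ.1, e k.1.2), (θ.1, e k.1.2)) = 0 := by
      rw [worldOf, hL0, map_zero, mul_zero]
    rw [this]
    simp
  · refine HasFDerivAt.congr_of_eventuallyEq ?_ hev
    have hinr : HasFDerivAt (fun z : E3 => (θ.1, z)) (ContinuousLinearMap.inr ℝ ℝ E3) (e k.1.2) :=
      hasFDerivAt_prodMk_right _ _
    have h1 := HasFDerivAt.comp (e k.1.2) hleft hinr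
    have h2 := ((((covecLoc e k).comp ((g.metricLoc e (θ.1, e k.1.2)).inverse)).hasFDerivAt.comp
      (e k.1.2) h1).neg)
    have h3 := (Complex.ofRealCLM.hasFDerivAt).comp (e k.1.2) h2
    have h4 := (HasFDerivAt.comp (e k.1.2) hW hinr).const_mul (conormLoc g f θ)
    have h5 := ((Complex.ofRealCLM.hasFDerivAt).comp (e k.1.2) h4).const_mul Complex.I
    refine (h3.add h5).congr_fderiv (ContinuousLinearMap.ext fun u => ?_)
    -- The mixed derivative `-G` of the world function cancels the inverse metric, so the real part
    -- contributes `ξ`; the imaginary part contributes nothing because `∂_X σ = 0`.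
    have h6 : (g.metricLoc e (θ.1, e k.1.2)).inverse ((g.metricLoc e (θ.1, e k.1.2)) (0, u)) =
        (0, u) := hinv.inverse_apply_self _
    simp [xiLoc, h6]

/-- The Hessian of the imaginary part of the phase function along the flow. -/
lemma phaseLoc_im_jet (hφ : IsLeviCivitaPhase N Φ φ)
    (hΦ : g.IsLeviCivitaFlow ε Φ) (he : e ∈ atlas E3 S) (hf : f ∈ atlas E3 S)
    (hθ : θ ∈ paramDom f) (hs : (flowAt Φ f θ).1.2 ∈ e.source) :
    HasFDerivAt (fun z => fderiv ℝ (fun z => (phaseLoc φ e f (θ, z)).im) z)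
      (conormLoc g f θ • hLoc g e (ptLoc e (flowAt Φ f θ).1)) (e (flowAt Φ f θ).1.2) := by
  have hev := eventually_phaseLoc_eq hφ hΦ he hf hθ hs
  have ht := flowAt_time hΦ hf hθ
  set k := flowAt Φ f θ
  have hP : (ptLoc e k.1).2 ∈ e.target := e.map_source hs
  have hpt : ptLoc e k.1 = (θ.1, e k.1.2) := Prod.ext ht rfl
  have hL := contDiffAt_logLoc N he (diag_mem_domLoc N hP)
  have hright := (hasFDerivAt_fderiv_right_worldOf (metricLoc_symm g (e := e)) hL
    (logLoc_self N (e := e) (ptLoc e k.1)) (hasFDerivAt_logLoc N he hP)).1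
  have hW := ((contDiffAt_worldOf_right (N := N) he hP).of_le
    (show (1 : WithTop ℕ∞) ≤ ∞ by norm_cast)).eventually (by simp)
  generalize ptLoc e k.1 = P at *
  subst hpt
  have hc : ContinuousAt (fun z : E3 => (θ.1, z)) (e k.1.2) :=
    (Continuous.prodMk_right θ.1).continuousAt
  have hfd : ∀ᶠ z in 𝓝 (e k.1.2), fderiv ℝ (fun z => (phaseLoc φ e f (θ, z)).im) z =
      conormLoc g f θ • (ContinuousLinearMap.compL ℝ E3 (ℝ × E3) ℝ).flip
        (ContinuousLinearMap.inr ℝ ℝ E3) (fderiv ℝ (fun q => worldOf (g.metricLoc e)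
          (logLoc N e) ((θ.1, e k.1.2), q)) (θ.1, z)) := by
    filter_upwards [hev.eventually_nhds, hc.eventually hW] with z h1 h2
    have h3 : (fun z => (phaseLoc φ e f (θ, z)).im) =ᶠ[𝓝 z] fun z => conormLoc g f θ *
        worldOf (g.metricLoc e) (logLoc N e) ((θ.1, e k.1.2), (θ.1, z)) := by
      filter_upwards [h1] with z' hz'
      rw [hz', Complex.add_im, Complex.ofReal_im, Complex.I_mul_im, Complex.ofReal_re, zero_add]
    rw [h3.fderiv_eq]
    have h4 := (HasFDerivAt.comp z (h2.differentiableAt (by simp)).hasFDerivAt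
      (hasFDerivAt_prodMk_right θ.1 z)).const_mul (conormLoc g f θ)
    exact h4.fderiv
  refine HasFDerivAt.congr_of_eventuallyEq ?_ hfd
  have h5 := (((ContinuousLinearMap.compL ℝ E3 (ℝ × E3) ℝ).flip
    (ContinuousLinearMap.inr ℝ ℝ E3)).hasFDerivAt.comp (e k.1.2)
    (HasFDerivAt.comp (e k.1.2) hright (hasFDerivAt_prodMk_right θ.1 (e k.1.2)))).const_smul
    (conormLoc g f θ)
  refine h5.congr_fderiv ?_
  refine ContinuousLinearMap.ext fun u => ContinuousLinearMap.ext fun v => ?_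
  change conormLoc g f θ * g.metricLoc e (θ.1, e k.1.2) (0, u) (0, v) =
    conormLoc g f θ * hLoc g e (θ.1, e k.1.2) u v
  rw [metricLoc_apply]
  simp

omit [T2Space S] in
lemma conormLoc_pos (hf : f ∈ atlas E3 S) (hθ : θ ∈ paramDom f) : 0 < conormLoc g f θ :=
  conorm_pos (etaLoc_param_ne_zero hf hθ)

/-- The only zero of the phase function in the normal neighbourhood is the point of the flow. -/
lemma eq_of_phase_eq_zero (hφ : IsLeviCivitaPhase N Φ φ) (hΦ : g.IsLeviCivitaFlow ε Φ)
    {t s : ℝ} {x y : S} {η : CoTS y} (hη : η ≠ 0) (hd : ((Φ s y η t).1, (t, x)) ∈ N.dom)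
    (h0 : (φ t x s y η).im ≤ 0) : (t, x) = (Φ s y η t).1 := by
  by_contra hne
  rw [hφ.formula t x s y η hη hd, mul_assoc] at h0
  have h1 := mul_pos (conorm_pos (g := g) (s := s) hη)
    (N.worldFunction_pos hd (hΦ.time s y hη t) hne)
  simp only [Complex.add_im, Complex.neg_im, Complex.ofReal_im, neg_zero, zero_add,
    Complex.I_mul_im, ← Complex.ofReal_mul, Complex.ofReal_re] at h0
  linarith

variable [CompactSpace S]

/-- The position at each time is an isolated zero of the jointly continuous `φ`, and at the initial
time it is `y`; so `continuousAt_zero_curve` applies, with no appeal to dependence of ODE solutions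
on their data. -/
lemma continuousAt_flowAt (hφ : IsLeviCivitaPhase N Φ φ) (hΦ : g.IsLeviCivitaFlow ε Φ)
    (hf : f ∈ atlas E3 S) (hθ : θ ∈ paramDom f) :
    ContinuousAt (fun θ => (flowAt Φ f θ).1.2) θ := by
  have : SecondCountableTopology S := ChartedSpace.secondCountable_of_sigmaCompact E3 S
  let _ : MetricSpace S := TopologicalSpace.metrizableSpaceMetric S
  obtain ⟨t₀, s₀, w₀, p₀⟩ := θ
  have hdom : ∀ᶠ θ : ℝ × E3 × (E3 →L[ℝ] ℝ) in 𝓝 (s₀, w₀, p₀), (t₀, θ) ∈ paramDom f :=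
    (Continuous.prodMk_right t₀).continuousAt.eventually (isOpen_paramDom.mem_nhds hθ)
  have hdom' : ∀ {θ : ℝ × E3 × (E3 →L[ℝ] ℝ)}, (t₀, θ) ∈ paramDom f → ∀ t, (t, θ) ∈ paramDom f :=
    fun h t => h
  have hinit : ∀ θ : ℝ × E3 × (E3 →L[ℝ] ℝ), (t₀, θ) ∈ paramDom f →
      (flowAt Φ f (θ.1, θ)).1.2 = f.symm θ.2.1 := by
    intro θ h
    obtain ⟨-, k, -, hk⟩ := hΦ.isTimeFlow θ.1 (f.symm θ.2.1) (etaLoc_param_ne_zero hf h)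
    change (Φ θ.1 (f.symm θ.2.1) (etaLoc f θ.2.1 θ.2.2) θ.1).1.2 = _
    rw [hk]
  refine continuousAt_zero_curve (Θ := ℝ × E3 × (E3 →L[ℝ] ℝ))
    (x := fun t θ => (flowAt Φ f (t, θ)).1.2) (s := fun θ => θ.1)
    (φ := fun t x θ => φ t x θ.1 (f.symm θ.2.1) (etaLoc f θ.2.1 θ.2.2)) (V := N.dom)
    N.isOpen_dom N.diag_mem ?_ continuousAt_fst ?_ ?_ ?_ ?_ t₀
  · filter_upwards [hdom] with θ h
    exact ((hΦ.isTimeFlow θ.1 (f.symm θ.2.1) (etaLoc_param_ne_zero hf h)).1.cont).snd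
  · have h1 : ContinuousAt (fun θ : ℝ × E3 × (E3 →L[ℝ] ℝ) => f.symm θ.2.1) (s₀, w₀, p₀) :=
      ContinuousAt.comp (f := fun θ : ℝ × E3 × (E3 →L[ℝ] ℝ) => θ.2.1) (f.continuousAt_symm hθ.1)
        continuous_snd.fst.continuousAt
    exact h1.congr (hdom.mono fun θ h => (hinit θ h).symm)
  · intro t x
    have hx : x ∈ (chartAt E3 x).source := mem_chart_source _ _
    set e := chartAt E3 x
    have he : e ∈ atlas E3 S := chart_mem_atlas _ _
    have h1 : ContinuousAt (phaseLoc φ e f) ((t, s₀, w₀, p₀), e x) :=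
      (contDiffAt_phaseLoc hφ.smooth he hf (hdom' hθ t) (e.map_source hx)).continuousAt
    have h2 : ContinuousAt (fun q : (ℝ × S) × (ℝ × E3 × (E3 →L[ℝ] ℝ)) =>
        (((q.1.1, q.2) : Param), e q.1.2)) ((t, x), (s₀, w₀, p₀)) :=
      (continuous_fst.fst.prodMk continuous_snd).continuousAt.prodMk
        (ContinuousAt.comp (f := fun q : (ℝ × S) × (ℝ × E3 × (E3 →L[ℝ] ℝ)) => q.1.2)
          (e.continuousAt hx) continuous_fst.snd.continuousAt)
    refine (ContinuousAt.comp (f := fun q : (ℝ × S) × (ℝ × E3 × (E3 →L[ℝ] ℝ)) =>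
        (((q.1.1, q.2) : Param), e q.1.2)) (x := ((t, x), (s₀, w₀, p₀))) h1 h2).congr ?_
    have h3 : ∀ᶠ q : (ℝ × S) × (ℝ × E3 × (E3 →L[ℝ] ℝ)) in 𝓝 ((t, x), (s₀, w₀, p₀)),
        q.1.2 ∈ e.source :=
      continuous_fst.snd.continuousAt.eventually (e.open_source.mem_nhds hx)
    filter_upwards [h3] with q hq
    simp [phaseLoc, e.left_inv hq]
  · filter_upwards [hdom] with θ h t
    have hx : (flowAt Φ f (t, θ)).1.2 ∈ (chartAt E3 (flowAt Φ f (t, θ)).1.2).source :=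
      mem_chart_source _ _
    set e := chartAt E3 (flowAt Φ f (t, θ)).1.2
    have he : e ∈ atlas E3 S := chart_mem_atlas _ _
    have h1 := (phaseLoc_jet hφ hΦ he hf (hdom' h t) hx).1
    simpa [phaseLoc, e.left_inv hx] using h1
  · intro t x hd h0
    have hne := etaLoc_param_ne_zero hf (hdom' hθ t)
    have ht := hΦ.time s₀ (f.symm w₀) hne t
    have hd' : ((Φ s₀ (f.symm w₀) (etaLoc f w₀ p₀) t).1, (t, x)) ∈ N.dom := by
      have : (Φ s₀ (f.symm w₀) (etaLoc f w₀ p₀) t).1 =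
        (t, (flowAt Φ f (t, s₀, w₀, p₀)).1.2) := Prod.ext ht rfl
      rw [this]; exact hd
    have := eq_of_phase_eq_zero hφ hΦ hne hd' (by
      change φ t x s₀ (f.symm w₀) (etaLoc f w₀ p₀) = 0 at h0
      rw [h0]; simp)
    exact congrArg Prod.snd this

end PhaseJets

/-- Continuous solutions of a nondegenerate implicit equation are smooth. -/
lemma contDiffAt_of_implicit {E₁ E₂ F : Type*} [NormedAddCommGroup E₁] [NormedSpace ℝ E₁]
    [CompleteSpace E₁] [NormedAddCommGroup E₂] [NormedSpace ℝ E₂] [CompleteSpace E₂]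
    [NormedAddCommGroup F] [NormedSpace ℝ F] [CompleteSpace F] {H : E₁ × E₂ → F} {ζ : E₁ → E₂}
    {θ : E₁} (hH : ContDiffAt ℝ ∞ H (θ, ζ θ)) (hζ : ContinuousAt ζ θ)
    (h0 : ∀ᶠ θ' in 𝓝 θ, H (θ', ζ θ') = H (θ, ζ θ))
    (hinv : ((fderiv ℝ H (θ, ζ θ)).comp (ContinuousLinearMap.inr ℝ E₁ E₂)).IsInvertible) :
    ContDiffAt ℝ ∞ ζ θ := by
  have h1 := hH.eventually_apply_eq_iff_implicitFunction (by simp) hinv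
  refine (hH.contDiffAt_implicitFunction (by simp) hinv).congr_of_eventuallyEq ?_
  filter_upwards [(continuousAt_id.prodMk hζ).eventually h1, h0] with θ' h2 h3
  exact (h2.1 h3).symm

/-! ### Smooth dependence of the flow on its initial data. -/

section FlowSmooth

variable {S : Type*} [TopologicalSpace S] [ChartedSpace E3 S]
  {g : SpacetimeMetric S} {N : g.NormalNeighbourhoods} {e f : OpenPartialHomeomorph S E3}
  {ε : ℤˣ} {Φ : ℝ → ∀ y : S, CoTS y → ℝ → CotangentM S} {φ : PhaseFunction S} {θ : Param}

/-- The spatial differential of a phase function in coordinates. -/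
def dPhaseLoc (φ : PhaseFunction S) (e f : OpenPartialHomeomorph S E3) (q : Param × E3) :
    E3 →L[ℝ] ℂ :=
  (fderiv ℝ (phaseLoc φ e f) q).comp (ContinuousLinearMap.inr ℝ Param E3)

/-- The coordinates of the position of the flow. -/
def zetaLoc (Φ : ℝ → ∀ y : S, CoTS y → ℝ → CotangentM S) (e f : OpenPartialHomeomorph S E3)
    (θ : Param) : E3 :=
  e (flowAt Φ f θ).1.2

lemma contDiffAt_dPhaseLoc (hφ : φ.IsSmooth) (he : e ∈ atlas E3 S) (hf : f ∈ atlas E3 S)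
    {q : Param × E3} (hq : q.1 ∈ paramDom f) (hz : q.2 ∈ e.target) :
    ContDiffAt ℝ ∞ (dPhaseLoc φ e f) q :=
  ((contDiffAt_phaseLoc hφ he hf hq hz).fderiv_right (m := ∞) (by simp)).clm_comp contDiffAt_const

lemma hasFDerivAt_phaseLoc_right (hφ : φ.IsSmooth) (he : e ∈ atlas E3 S) (hf : f ∈ atlas E3 S)
    {z : E3} (hq : θ ∈ paramDom f) (hz : z ∈ e.target) :
    HasFDerivAt (fun z => phaseLoc φ e f (θ, z)) (dPhaseLoc φ e f (θ, z)) z :=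
  HasFDerivAt.comp (g := phaseLoc φ e f) z
    ((contDiffAt_phaseLoc hφ he hf (q := (θ, z)) hq hz).differentiableAt (by simp)).hasFDerivAt
    (hasFDerivAt_prodMk_right θ z)

variable [IsManifold 𝓘(ℝ, E3) ∞ S] [T2Space S]

lemma dPhaseLoc_zetaLoc (hφ : IsLeviCivitaPhase N Φ φ) (hΦ : g.IsLeviCivitaFlow ε Φ)
    (he : e ∈ atlas E3 S) (hf : f ∈ atlas E3 S) (hθ : θ ∈ paramDom f)
    (hs : (flowAt Φ f θ).1.2 ∈ e.source) :
    dPhaseLoc φ e f (θ, zetaLoc Φ e f θ) = Complex.ofRealCLM.comp (xiLoc e (flowAt Φ f θ)) :=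
  (hasFDerivAt_phaseLoc_right hφ.smooth he hf hθ (e.map_source hs)).unique
    (phaseLoc_jet hφ hΦ he hf hθ hs).2

/-- The imaginary part of the spatial Hessian of the phase function along the flow. -/
lemma im_fderiv_dPhaseLoc (hφ : IsLeviCivitaPhase N Φ φ) (hΦ : g.IsLeviCivitaFlow ε Φ)
    (he : e ∈ atlas E3 S) (hf : f ∈ atlas E3 S) (hθ : θ ∈ paramDom f)
    (hs : (flowAt Φ f θ).1.2 ∈ e.source) (u v : E3) :
    (fderiv ℝ (dPhaseLoc φ e f) (θ, zetaLoc Φ e f θ) (0, u) v).im =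
      conormLoc g f θ * hLoc g e (ptLoc e (flowAt Φ f θ).1) u v := by
  have hz : zetaLoc Φ e f θ ∈ e.target := e.map_source hs
  have h1 := phaseLoc_im_jet hφ hΦ he hf hθ hs
  have h2 : HasFDerivAt (fun z => dPhaseLoc φ e f (θ, z)) _ (zetaLoc Φ e f θ) :=
    HasFDerivAt.comp (g := dPhaseLoc φ e f) _
    ((contDiffAt_dPhaseLoc hφ.smooth he hf (q := (θ, zetaLoc Φ e f θ)) hθ hz).differentiableAt
      (by simp)).hasFDerivAt (hasFDerivAt_prodMk_right θ _)
  have h3 : HasFDerivAt (fun z => fderiv ℝ (fun z => (phaseLoc φ e f (θ, z)).im) z) _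
      (zetaLoc Φ e f θ) :=
    ((ContinuousLinearMap.compL ℝ E3 ℂ ℝ Complex.imCLM).hasFDerivAt.comp _
      h2).congr_of_eventuallyEq (by
      filter_upwards [e.open_target.mem_nhds hz] with z hz'
      exact (Complex.imCLM.hasFDerivAt.comp z
        (hasFDerivAt_phaseLoc_right hφ.smooth he hf hθ hz')).fderiv)
  have h4 := DFunLike.congr_fun (DFunLike.congr_fun (h3.unique h1) u) v
  exact h4

variable [CompactSpace S]

lemma eventually_flowAt_mem (hφ : IsLeviCivitaPhase N Φ φ) (hΦ : g.IsLeviCivitaFlow ε Φ)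
    (hf : f ∈ atlas E3 S) (hθ : θ ∈ paramDom f)
    (hs : (flowAt Φ f θ).1.2 ∈ e.source) :
    ∀ᶠ θ' in 𝓝 θ, θ' ∈ paramDom f ∧ (flowAt Φ f θ').1.2 ∈ e.source :=
  (isOpen_paramDom.eventually_mem hθ).and
    ((continuousAt_flowAt hφ hΦ hf hθ).eventually (e.open_source.eventually_mem hs))

/-- The position of the flow depends smoothly on time and initial data. -/
lemma contDiffAt_zetaLoc (hφ : IsLeviCivitaPhase N Φ φ) (hΦ : g.IsLeviCivitaFlow ε Φ)
    (he : e ∈ atlas E3 S) (hf : f ∈ atlas E3 S) (hθ : θ ∈ paramDom f)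
    (hs : (flowAt Φ f θ).1.2 ∈ e.source) : ContDiffAt ℝ ∞ (zetaLoc Φ e f) θ := by
  have hz : zetaLoc Φ e f θ ∈ e.target := e.map_source hs
  have hD := contDiffAt_dPhaseLoc hφ.smooth he hf (q := (θ, zetaLoc Φ e f θ)) hθ hz
  -- Along the flow `∂_x φ` equals the real covector `ξ`, so the position solves `Im ∂_x φ = 0`. The
  -- derivative of this equation in the position is `‖η‖ h`, which is invertible.
  refine contDiffAt_of_implicit (H := fun q => Complex.imCLM.comp (dPhaseLoc φ e f q))
    (contDiffAt_const.clm_comp hD)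
    (ContinuousAt.comp (f := fun θ => (flowAt Φ f θ).1.2) (e.continuousAt hs)
      (continuousAt_flowAt hφ hΦ hf hθ)) ?_ ?_
  · filter_upwards [eventually_flowAt_mem hφ hΦ hf hθ hs] with θ' h'
    rw [dPhaseLoc_zetaLoc hφ hΦ he hf h'.1 h'.2, dPhaseLoc_zetaLoc hφ hΦ he hf hθ hs]
    ext v
    simp
  · have h1 : HasFDerivAt (fun q => Complex.imCLM.comp (dPhaseLoc φ e f q)) _
        (θ, zetaLoc Φ e f θ) :=
      (ContinuousLinearMap.compL ℝ E3 ℂ ℝ Complex.imCLM).hasFDerivAt.comp _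
        (hD.differentiableAt (by simp)).hasFDerivAt
    rw [h1.fderiv]
    refine isInvertible_of_pos_diag fun u hu => by_contra fun hu' =>
      ne_of_gt ?_ (DFunLike.congr_fun hu u)
    change 0 < (fderiv ℝ (dPhaseLoc φ e f) (θ, zetaLoc Φ e f θ) (0, u) u).im
    rw [im_fderiv_dPhaseLoc hφ hΦ he hf hθ hs]
    exact mul_pos (conormLoc_pos hf hθ) (hLoc_pos g he (e.map_source hs) hu')

/-- The covector of the flow depends smoothly on time and initial data. -/
lemma contDiffAt_xiLoc (hφ : IsLeviCivitaPhase N Φ φ) (hΦ : g.IsLeviCivitaFlow ε Φ)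
    (he : e ∈ atlas E3 S) (hf : f ∈ atlas E3 S) (hθ : θ ∈ paramDom f)
    (hs : (flowAt Φ f θ).1.2 ∈ e.source) :
    ContDiffAt ℝ ∞ (fun θ => xiLoc e (flowAt Φ f θ)) θ := by
  have hz : zetaLoc Φ e f θ ∈ e.target := e.map_source hs
  have h1 : ContDiffAt ℝ ∞ (fun θ => dPhaseLoc φ e f (θ, zetaLoc Φ e f θ)) θ :=
    ContDiffAt.comp (g := dPhaseLoc φ e f) θ
      (contDiffAt_dPhaseLoc hφ.smooth he hf (q := (θ, zetaLoc Φ e f θ)) hθ hz)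
      (contDiffAt_id.prodMk (contDiffAt_zetaLoc hφ hΦ he hf hθ hs))
  -- The covector is read off as the real part of `∂_x φ` at the smoothly varying position.
  have h2 : ContDiffAt ℝ ∞
      (fun θ => Complex.reCLM.comp (dPhaseLoc φ e f (θ, zetaLoc Φ e f θ))) θ :=
    contDiffAt_const.clm_comp h1
  refine h2.congr_of_eventuallyEq ?_
  filter_upwards [eventually_flowAt_mem hφ hΦ hf hθ hs] with θ' h'
  rw [dPhaseLoc_zetaLoc hφ hΦ he hf h'.1 h'.2]
  ext v
  simp

end FlowSmooth

/-! ### Variations of the flow and the canonical one-form. -/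

section Transport

variable {S : Type*} [TopologicalSpace S] [ChartedSpace E3 S]
  {g : SpacetimeMetric S} {N : g.NormalNeighbourhoods} {e f : OpenPartialHomeomorph S E3}
  {ε : ℤˣ} {Φ : ℝ → ∀ y : S, CoTS y → ℝ → CotangentM S} {φ : PhaseFunction S} {θ : Param}

/-- The coordinates of the point of spacetime reached by the flow. -/
def posLoc (Φ : ℝ → ∀ y : S, CoTS y → ℝ → CotangentM S) (e f : OpenPartialHomeomorph S E3)
    (θ : Param) : ℝ × E3 :=
  (θ.1, zetaLoc Φ e f θ)

/-- The direction in parameter space given by a variation of the initial covector. -/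
def etaDir (δ : E3 →L[ℝ] ℝ) : Param := (0, 0, 0, δ)

/-- The direction of time in parameter space. -/
def timeDir : Param := (1, 0, 0, 0)

variable [IsManifold 𝓘(ℝ, E3) ∞ S]

lemma ptLoc_flowAt (hΦ : g.IsLeviCivitaFlow ε Φ) (hf : f ∈ atlas E3 S) (hθ : θ ∈ paramDom f) :
    ptLoc e (flowAt Φ f θ).1 = posLoc Φ e f θ :=
  Prod.ext (flowAt_time hΦ hf hθ) rfl

lemma hasDerivAt_cotLoc_flowAt (hΦ : g.IsLeviCivitaFlow ε Φ) (he : e ∈ atlas E3 S)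
    (hf : f ∈ atlas E3 S) (hθ : θ ∈ paramDom f) (hs : (flowAt Φ f θ).1.2 ∈ e.source) :
    HasDerivAt (fun r => cotLoc e (flowAt Φ f (r, θ.2)))
      (flowField (g.metricLoc e) (cotLoc e (flowAt Φ f θ))) θ.1 :=
  (hΦ.isTimeFlow θ.2.1 (f.symm θ.2.2.1) (etaLoc_param_ne_zero hf hθ)).1.ode e he θ.1 hs

omit [IsManifold 𝓘(ℝ, E3) ∞ S] in
lemma dEta_eq_fderiv (hφ : φ.IsSmooth) (he : e ∈ atlas E3 S) (hf : f ∈ atlas E3 S)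
    (hθ : θ ∈ paramDom f) {x : S} (hx : x ∈ e.source) (δ : E3 →L[ℝ] ℝ) :
    φ.dEta θ.1 x θ.2.1 (f.symm θ.2.2.1) (etaLoc f θ.2.2.1 θ.2.2.2) (etaLoc f θ.2.2.1 δ) =
      fderiv ℝ (phaseLoc φ e f) (θ, e x) (etaDir δ, 0) := by
  have h2 : HasDerivAt (fun l : ℝ =>
      (((θ.1, θ.2.1, θ.2.2.1, θ.2.2.2 + l • δ), e x) : Param × E3)) (etaDir δ, 0) 0 := by
    have := ((hasDerivAt_id (0 : ℝ)).smul_const δ).const_add θ.2.2.2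
    simp only [id, one_smul] at this
    exact ((hasDerivAt_const _ _).prodMk ((hasDerivAt_const _ _).prodMk
      ((hasDerivAt_const _ _).prodMk this))).prodMk (hasDerivAt_const _ _)
  have h3 := HasFDerivAt.comp_hasDerivAt_of_eq (l := phaseLoc φ e f) (0 : ℝ)
    ((contDiffAt_phaseLoc hφ he hf (q := (θ, e x)) hθ (e.map_source hx)).differentiableAt
      (by simp)).hasFDerivAt h2 (by simp)
  rw [← h3.deriv, PhaseFunction.dEta]
  congr 1
  funext l
  change _ = φ θ.1 (e.symm (e x)) θ.2.1 (f.symm θ.2.2.1) (etaLoc f θ.2.2.1 (θ.2.2.2 + l • δ))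
  rw [e.left_inv hx]
  rfl

variable [T2Space S] [CompactSpace S]

lemma contDiffAt_posLoc (hφ : IsLeviCivitaPhase N Φ φ) (hΦ : g.IsLeviCivitaFlow ε Φ)
    (he : e ∈ atlas E3 S) (hf : f ∈ atlas E3 S) (hθ : θ ∈ paramDom f)
    (hs : (flowAt Φ f θ).1.2 ∈ e.source) : ContDiffAt ℝ ∞ (posLoc Φ e f) θ :=
  contDiffAt_fst.prodMk (contDiffAt_zetaLoc hφ hΦ he hf hθ hs)

lemma fderiv_posLoc (hφ : IsLeviCivitaPhase N Φ φ) (hΦ : g.IsLeviCivitaFlow ε Φ)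
    (he : e ∈ atlas E3 S) (hf : f ∈ atlas E3 S) (hθ : θ ∈ paramDom f)
    (hs : (flowAt Φ f θ).1.2 ∈ e.source) (v : Param) :
    fderiv ℝ (posLoc Φ e f) θ v = (v.1, fderiv ℝ (zetaLoc Φ e f) θ v) := by
  have h1 : HasFDerivAt (posLoc Φ e f) _ θ := (hasFDerivAt_fst (𝕜 := ℝ)).prodMk
    ((contDiffAt_zetaLoc hφ hΦ he hf hθ hs).differentiableAt (by simp)).hasFDerivAt
  rw [h1.fderiv]
  rfl

/-- The velocity of the flow is null and proportional to its covector. -/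
lemma velocity_flowAt (hφ : IsLeviCivitaPhase N Φ φ) (hΦ : g.IsLeviCivitaFlow ε Φ)
    (he : e ∈ atlas E3 S) (hf : f ∈ atlas E3 S) (hθ : θ ∈ paramDom f)
    (hs : (flowAt Φ f θ).1.2 ∈ e.source) :
    fderiv ℝ (posLoc Φ e f) θ timeDir =
        flowDir (g.metricLoc e) (cotLoc e (flowAt Φ f θ)) ∧
      (∃ c : ℝ, covecLoc e (flowAt Φ f θ) =
        c • g.metricLoc e (posLoc Φ e f θ) (fderiv ℝ (posLoc Φ e f) θ timeDir)) ∧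
      g.metricLoc e (posLoc Φ e f θ) (fderiv ℝ (posLoc Φ e f) θ timeDir)
        (fderiv ℝ (posLoc Φ e f) θ timeDir) = 0 := by
  have hflow := (hΦ.isTimeFlow θ.2.1 (f.symm θ.2.2.1) (etaLoc_param_ne_zero hf hθ)).1
  have h1 : fderiv ℝ (posLoc Φ e f) θ timeDir =
      flowDir (g.metricLoc e) (cotLoc e (flowAt Φ f θ)) := by
    have h2 := hasDerivAt_fun_fst (hasDerivAt_cotLoc_flowAt hΦ he hf hθ hs)
    have h3 : HasDerivAt (fun r : ℝ => ((r, θ.2) : Param)) timeDir θ.1 :=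
      (hasDerivAt_id θ.1).prodMk (hasDerivAt_const θ.1 θ.2)
    have h4 : HasDerivAt (fun r : ℝ => posLoc Φ e f (r, θ.2)) _ θ.1 :=
      HasFDerivAt.comp_hasDerivAt (l := posLoc Φ e f) θ.1
        ((contDiffAt_posLoc hφ hΦ he hf hθ hs).differentiableAt (by simp)).hasFDerivAt h3
    refine h4.unique (h2.congr_of_eventuallyEq (Filter.Eventually.of_forall fun r => ?_))
    exact (ptLoc_flowAt hΦ hf (θ := (r, θ.2)) hθ).symm
  have hP : (ptLoc e (flowAt Φ f θ).1).2 ∈ e.target := e.map_source hs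
  have hinv := metricLoc_isInvertible g he hP
  have hpos : ((g.metricLoc e (cotLoc e (flowAt Φ f θ)).1).inverse
      (cotLoc e (flowAt Φ f θ)).2).1 ≠ 0 := by
    rw [inverse_cotLoc_fst he hs]
    exact hflow.pos θ.1
  have hnull : covecLoc e (flowAt Φ f θ) ((g.metricLoc e (ptLoc e (flowAt Φ f θ).1)).inverse
      (covecLoc e (flowAt Φ f θ))) = 0 := by
    have h2 := hflow.null θ.1
    have h3 := vecLoc_sharp g he hs (flowAt Φ f θ).2
    have h4 := covecLoc_vecLoc he hs (flowAt Φ f θ).2 (g.sharp _ (flowAt Φ f θ).2)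
    rw [h3] at h4
    exact h4.trans h2
  rw [← ptLoc_flowAt hΦ hf hθ, h1]
  refine ⟨rfl, ⟨((g.metricLoc e (cotLoc e (flowAt Φ f θ)).1).inverse
      (cotLoc e (flowAt Φ f θ)).2).1, ?_⟩, ?_⟩
  · change _ = _ • g.metricLoc e (ptLoc e (flowAt Φ f θ).1) (_⁻¹ •
      (g.metricLoc e (ptLoc e (flowAt Φ f θ).1)).inverse (covecLoc e (flowAt Φ f θ)))
    rw [map_smul, smul_smul, mul_inv_cancel₀ hpos, one_smul, hinv.self_apply_inverse]
  · change g.metricLoc e (ptLoc e (flowAt Φ f θ).1) (_⁻¹ •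
      (g.metricLoc e (ptLoc e (flowAt Φ f θ).1)).inverse (covecLoc e (flowAt Φ f θ))) (_⁻¹ •
      (g.metricLoc e (ptLoc e (flowAt Φ f θ).1)).inverse (covecLoc e (flowAt Φ f θ))) = 0
    rw [map_smul, map_smul, smul_apply, hinv.self_apply_inverse, hnull, smul_zero, smul_zero]

/-- The derivative of the phase function in the parameters along the flow. -/
lemma fderiv_phaseLoc_param (hφ : IsLeviCivitaPhase N Φ φ) (hΦ : g.IsLeviCivitaFlow ε Φ)
    (he : e ∈ atlas E3 S) (hf : f ∈ atlas E3 S) (hθ : θ ∈ paramDom f)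
    (hs : (flowAt Φ f θ).1.2 ∈ e.source) (v : Param) :
    fderiv ℝ (phaseLoc φ e f) (θ, zetaLoc Φ e f θ) (v, 0) =
      -((xiLoc e (flowAt Φ f θ) (fderiv ℝ (zetaLoc Φ e f) θ v) : ℝ) : ℂ) := by
  have hz : zetaLoc Φ e f θ ∈ e.target := e.map_source hs
  have h1 : HasFDerivAt (fun θ => phaseLoc φ e f (θ, zetaLoc Φ e f θ)) _ θ :=
    HasFDerivAt.comp (g := phaseLoc φ e f) θ
      ((contDiffAt_phaseLoc hφ.smooth he hf (q := (θ, zetaLoc Φ e f θ)) hθ hz).differentiableAt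
        (by simp)).hasFDerivAt
      ((hasFDerivAt_id θ).prodMk
        ((contDiffAt_zetaLoc hφ hΦ he hf hθ hs).differentiableAt (by simp)).hasFDerivAt)
  have h2 : HasFDerivAt (fun θ => phaseLoc φ e f (θ, zetaLoc Φ e f θ)) (0 : Param →L[ℝ] ℂ) θ :=
    (hasFDerivAt_const (0 : ℂ) θ).congr_of_eventuallyEq (by
      filter_upwards [eventually_flowAt_mem hφ hΦ hf hθ hs] with θ' h'
      exact (phaseLoc_jet hφ hΦ he hf h'.1 h'.2).1)
  -- Chain rule for the identity `φ(θ, x(θ)) = 0`, where `∂_x φ = ξ`.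
  have h3 := DFunLike.congr_fun (h1.unique h2) v
  change fderiv ℝ (phaseLoc φ e f) (θ, zetaLoc Φ e f θ) (v, fderiv ℝ (zetaLoc Φ e f) θ v) = 0 at h3
  have h4 : ((v, fderiv ℝ (zetaLoc Φ e f) θ v) : Param × E3) =
      (v, 0) + (0, fderiv ℝ (zetaLoc Φ e f) θ v) := by simp
  rw [h4, map_add] at h3
  rw [eq_neg_of_add_eq_zero_left h3]
  exact congrArg Neg.neg (DFunLike.congr_fun (dPhaseLoc_zetaLoc hφ hΦ he hf hθ hs)
    (fderiv ℝ (zetaLoc Φ e f) θ v))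

/-- The pairing of the covector of the flow with a variation of its position is constant in
time. -/
lemma hasDerivAt_xiLoc_pairing (hφ : IsLeviCivitaPhase N Φ φ) (hΦ : g.IsLeviCivitaFlow ε Φ)
    (he : e ∈ atlas E3 S) (hf : f ∈ atlas E3 S) (hθ : θ ∈ paramDom f)
    (hs : (flowAt Φ f θ).1.2 ∈ e.source) (δ : E3 →L[ℝ] ℝ) :
    HasDerivAt (fun r => covecLoc e (flowAt Φ f (r, θ.2))
      (fderiv ℝ (posLoc Φ e f) (r, θ.2) (etaDir δ))) 0 θ.1 := by
  let Z := posLoc Φ e f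
  have hZ : ContDiffAt ℝ ∞ Z θ := contDiffAt_posLoc hφ hΦ he hf hθ hs
  have hZ' : HasFDerivAt Z (fderiv ℝ Z θ) θ := (hZ.differentiableAt (by simp)).hasFDerivAt
  have hDZ : HasFDerivAt (fderiv ℝ Z) (fderiv ℝ (fderiv ℝ Z) θ) θ :=
    ((hZ.fderiv_right (m := ∞) (by simp)).differentiableAt (by simp)).hasFDerivAt
  have hsymm : IsSymmSndFDerivAt ℝ Z θ := hZ.isSymmSndFDerivAt (by simp; norm_cast)
  have hP : (Z θ).2 ∈ e.target := e.map_source hs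
  have hG := contDiffAt_metricLoc g he hP
  have hG' := (hG.differentiableAt (by simp)).hasFDerivAt
  obtain ⟨hdir, ⟨c, hc⟩, -⟩ := velocity_flowAt hφ hΦ he hf hθ hs
  have hcov := hasDerivAt_fun_snd (hasDerivAt_cotLoc_flowAt hΦ he hf hθ hs)
  have hline : HasDerivAt (fun r : ℝ => ((r, θ.2) : Param)) timeDir θ.1 :=
    (hasDerivAt_id θ.1).prodMk (hasDerivAt_const θ.1 θ.2)
  have hvar : HasDerivAt (fun r : ℝ => fderiv ℝ Z (r, θ.2) (etaDir δ))
      (fderiv ℝ (fderiv ℝ Z) θ timeDir (etaDir δ)) θ.1 :=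
    (ContinuousLinearMap.apply ℝ (ℝ × E3) (etaDir δ)).hasFDerivAt.comp_hasDerivAt θ.1
      (HasFDerivAt.comp_hasDerivAt (l := fderiv ℝ Z) θ.1 hDZ hline)
  -- The velocity is null for all nearby parameters, so the derivative of its squared length in `η`
  -- vanishes. With `Ξ = c G(X')` and `Ξ` parallel, the time derivative of the pairing is `c / 2`
  -- times that derivative, once the mixed partial derivatives are exchanged.
  have hnull : HasFDerivAt (fun θ' => g.metricLoc e (Z θ') (fderiv ℝ Z θ' timeDir)
      (fderiv ℝ Z θ' timeDir)) (0 : Param →L[ℝ] ℝ) θ :=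
    (hasFDerivAt_const (0 : ℝ) θ).congr_of_eventuallyEq (by
      filter_upwards [eventually_flowAt_mem hφ hΦ hf hθ hs] with θ' h'
      exact (velocity_flowAt hφ hΦ he hf h'.1 h'.2).2.2)
  have hW : HasFDerivAt (fun θ' => fderiv ℝ Z θ' timeDir) _ θ :=
    (ContinuousLinearMap.apply ℝ (ℝ × E3) timeDir).hasFDerivAt.comp θ hDZ
  have hnull' := DFunLike.congr_fun
    (hnull.unique (((HasFDerivAt.comp (g := g.metricLoc e) θ hG' hZ').clm_apply hW).clm_apply hW))
    (etaDir δ)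
  refine (hcov.clm_apply hvar).congr_deriv ?_
  have h1 : (0 : ℝ) = fderiv ℝ (g.metricLoc e) (Z θ) (fderiv ℝ Z θ (etaDir δ))
        (fderiv ℝ Z θ timeDir) (fderiv ℝ Z θ timeDir) +
      2 * g.metricLoc e (Z θ) (fderiv ℝ Z θ timeDir)
        (fderiv ℝ (fderiv ℝ Z) θ (etaDir δ) timeDir) := by
    have h2 : (0 : ℝ) = g.metricLoc e (Z θ) (fderiv ℝ Z θ timeDir)
          (fderiv ℝ (fderiv ℝ Z) θ (etaDir δ) timeDir) +
        (g.metricLoc e (Z θ) (fderiv ℝ (fderiv ℝ Z) θ (etaDir δ) timeDir) (fderiv ℝ Z θ timeDir) +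
          fderiv ℝ (g.metricLoc e) (Z θ) (fderiv ℝ Z θ (etaDir δ))
            (fderiv ℝ Z θ timeDir) (fderiv ℝ Z θ timeDir)) := hnull'
    rw [metricLoc_symm g (e := e) (Z θ) (fderiv ℝ (fderiv ℝ Z) θ (etaDir δ) timeDir)] at h2
    rw [h2]; ring
  change covecLoc e (flowAt Φ f θ) (christoffel (g.metricLoc e) (ptLoc e (flowAt Φ f θ).1)
      (flowDir (g.metricLoc e) (cotLoc e (flowAt Φ f θ))) (fderiv ℝ Z θ (etaDir δ))) +
    covecLoc e (flowAt Φ f θ) (fderiv ℝ (fderiv ℝ Z) θ timeDir (etaDir δ)) = 0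
  rw [← hdir, hc, ptLoc_flowAt hΦ hf hθ, hsymm timeDir (etaDir δ), smul_apply, smul_apply,
    metric_christoffel_self (metricLoc_isInvertible g he hP) (hG.differentiableAt (by simp))
      (metricLoc_symm g), ← smul_add, smul_eq_mul]
  refine mul_eq_zero_of_right c ?_
  change fderiv ℝ (g.metricLoc e) (Z θ) (fderiv ℝ Z θ (etaDir δ))
        (fderiv ℝ Z θ timeDir) (fderiv ℝ Z θ timeDir) / 2 +
      g.metricLoc e (Z θ) (fderiv ℝ Z θ timeDir)
        (fderiv ℝ (fderiv ℝ Z) θ (etaDir δ) timeDir) = 0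
  linarith

/-- The covector of the flow annihilates the variations of its position under variations of the
initial covector. -/
lemma xiLoc_fderiv_zetaLoc (hφ : IsLeviCivitaPhase N Φ φ) (hΦ : g.IsLeviCivitaFlow ε Φ)
    (he : e ∈ atlas E3 S) (hf : f ∈ atlas E3 S) (hθ : θ ∈ paramDom f)
    (hs : (flowAt Φ f θ).1.2 ∈ e.source) (δ : E3 →L[ℝ] ℝ) :
    xiLoc e (flowAt Φ f θ) (fderiv ℝ (zetaLoc Φ e f) θ (etaDir δ)) = 0 := by
  -- Since `∂_η φ = -⟨ξ, x_η⟩` along the flow, this expresses the pairing without a chart around the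
  -- position. It can therefore be followed through all times although the position leaves any given
  -- chart.
  let K : ℝ → ℝ := fun r => -(φ.dEta r (flowAt Φ f (r, θ.2)).1.2 θ.2.1 (f.symm θ.2.2.1)
    (etaLoc f θ.2.2.1 θ.2.2.2) (etaLoc f θ.2.2.1 δ)).re
  have hK : ∀ e' ∈ atlas E3 S, ∀ r, (flowAt Φ f (r, θ.2)).1.2 ∈ e'.source →
      K r = xiLoc e' (flowAt Φ f (r, θ.2)) (fderiv ℝ (zetaLoc Φ e' f) (r, θ.2) (etaDir δ)) := by
    intro e' he' r hr
    simp only [K]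
    rw [dEta_eq_fderiv hφ.smooth he' hf (θ := (r, θ.2)) hθ hr]
    have h1 := fderiv_phaseLoc_param hφ hΦ he' hf (θ := (r, θ.2)) hθ hr (etaDir δ)
    rw [zetaLoc] at h1
    rw [h1]
    simp
  have hK' : ∀ r, HasDerivAt K 0 r := by
    intro r
    have hr : (flowAt Φ f (r, θ.2)).1.2 ∈ (chartAt E3 (flowAt Φ f (r, θ.2)).1.2).source :=
      mem_chart_source _ _
    set e' := chartAt E3 (flowAt Φ f (r, θ.2)).1.2
    have he' : e' ∈ atlas E3 S := chart_mem_atlas _ _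
    refine (hasDerivAt_xiLoc_pairing hφ hΦ he' hf (θ := (r, θ.2)) hθ hr δ).congr_of_eventuallyEq ?_
    have hc : ContinuousAt (fun r' : ℝ => ((r', θ.2) : Param)) r :=
      (Continuous.prodMk_left θ.2).continuousAt
    filter_upwards [hc.eventually (eventually_flowAt_mem hφ hΦ hf (θ := (r, θ.2)) hθ hr)]
      with r' hr'
    rw [hK e' he' r' hr'.2, fderiv_posLoc hφ hΦ he' hf hr'.1 hr'.2]
    rfl
  -- At `t = s` the position is `y` whatever the covector, so `x_η = 0`.
  have hinit : K θ.2.1 = 0 := by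
    have hmem : ∀ p ≠ (0 : E3 →L[ℝ] ℝ), (flowAt Φ f (θ.2.1, θ.2.1, θ.2.2.1, p)).1.2 =
        f.symm θ.2.2.1 := by
      intro p hp
      obtain ⟨-, k, -, hk⟩ := hΦ.isTimeFlow θ.2.1 (f.symm θ.2.2.1) (etaLoc_ne_zero hf hθ.1 hp)
      change (Φ θ.2.1 (f.symm θ.2.2.1) (etaLoc f θ.2.2.1 p) θ.2.1).1.2 = _
      rw [hk]
    have hr : (flowAt Φ f (θ.2.1, θ.2)).1.2 ∈ f.source := by
      rw [hmem _ hθ.2]; exact f.map_target hθ.1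
    have h1 : HasDerivAt (fun l : ℝ => ((θ.2.1, θ.2.1, θ.2.2.1, θ.2.2.2 + l • δ) : Param))
        (etaDir δ) 0 := by
      have := ((hasDerivAt_id (0 : ℝ)).smul_const δ).const_add θ.2.2.2
      simp only [id, one_smul] at this
      exact (hasDerivAt_const _ _).prodMk
        ((hasDerivAt_const _ _).prodMk ((hasDerivAt_const _ _).prodMk this))
    have h2 := HasFDerivAt.comp_hasDerivAt_of_eq (l := zetaLoc Φ f f) (0 : ℝ)
      ((contDiffAt_zetaLoc hφ hΦ hf hf (θ := (θ.2.1, θ.2)) hθ hr).differentiableAt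
        (by simp)).hasFDerivAt h1 (by simp)
    have h3 : ContinuousAt (fun l : ℝ => θ.2.2.2 + l • δ) 0 := by fun_prop
    have h4 : HasDerivAt (zetaLoc Φ f f ∘ fun l : ℝ =>
        ((θ.2.1, θ.2.1, θ.2.2.1, θ.2.2.2 + l • δ) : Param)) 0 0 := by
      refine (hasDerivAt_const (0 : ℝ) (f (f.symm θ.2.2.1))).congr_of_eventuallyEq ?_
      filter_upwards [h3.eventually (isOpen_ne.eventually_mem (by simpa using hθ.2))] with l hl
      change f (flowAt Φ f _).1.2 = _
      rw [hmem _ hl]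
    rw [hK f hf θ.2.1 hr, h2.unique h4, map_zero]
  rw [← hK e he θ.1 hs, ← hinit]
  exact eq_of_hasDerivAt_zero isPreconnected_univ
    (fun r _ => Filter.Eventually.of_forall hK') (mem_univ _) (mem_univ _)

end Transport

/-! ### Nondegeneracy of the mixed second derivative. -/

section Nondegenerate

variable {S : Type*} [TopologicalSpace S] [ChartedSpace E3 S] [IsManifold 𝓘(ℝ, E3) ∞ S]
  [T2Space S]
  {g : SpacetimeMetric S} {N : g.NormalNeighbourhoods} {e f : OpenPartialHomeomorph S E3}
  {ε : ℤˣ} {Φ : ℝ → ∀ y : S, CoTS y → ℝ → CotangentM S} {φ : PhaseFunction S} {θ : Param}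

/-- The parameters of the flow restarted at the point with parameters `θ` and followed back to the
initial time. -/
def returnParam (Φ : ℝ → ∀ y : S, CoTS y → ℝ → CotangentM S) (e f : OpenPartialHomeomorph S E3)
    (θ : Param) : Param :=
  (θ.2.1, θ.1, zetaLoc Φ e f θ, xiLoc e (flowAt Φ f θ))

omit [IsManifold 𝓘(ℝ, E3) ∞ S] [T2Space S] in
-- The base points `e.symm (e x)` and `x` are equal only propositionally, so a function of a point
-- and a covector there has to be transported.
lemma apply_etaLoc_chart {α : Type*} (F : ∀ y : S, CoTS y → α) {x : S} (hx : x ∈ e.source)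
    (q : E3 →L[ℝ] ℝ) : F (e.symm (e x)) (etaLoc e (e x) q) = F x (q.comp (dChart e x)) := by
  have : ∀ x', x' = x → F x' (q.comp (dChart e x')) = F x (q.comp (dChart e x)) := by
    rintro _ rfl; rfl
  exact this _ (e.left_inv hx)

omit [T2Space S] in
lemma xiLoc_comp_dChart (he : e ∈ atlas E3 S) {t : ℝ} {x : S} (hx : x ∈ e.source)
    (k : CoTM (t, x)) : (xiLoc e ⟨(t, x), k⟩).comp (dChart e x) =
      k.comp (ContinuousLinearMap.inr ℝ ℝ (TS x)) := by
  refine ContinuousLinearMap.ext fun u => ?_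
  exact covecLoc_vecLoc he (X := (t, x)) hx k (0, u)

omit [T2Space S] in
lemma eq_of_comp_dChart (he : e ∈ atlas E3 S) {x : S} (hx : x ∈ e.source) {p q : E3 →L[ℝ] ℝ}
    (h : p.comp (dChart e x) = q.comp (dChart e x)) : p = q := by
  refine ContinuousLinearMap.ext fun u => ?_
  obtain ⟨v, rfl⟩ := (dChart_bijective he hx).2 u
  exact DFunLike.congr_fun h v

/-- Restarting at time `t` from `(x, ξ)` gives the same flow line by uniqueness, so going back to
time `s` recovers `y` and `η`. This supplies a left inverse of `η ↦ (x, ξ)`. -/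
lemma flowAt_returnParam (hΦ : g.IsLeviCivitaFlow ε Φ) (he : e ∈ atlas E3 S) (hf : f ∈ atlas E3 S)
    (hθ : θ ∈ paramDom f) (hs : (flowAt Φ f θ).1.2 ∈ e.source) :
    returnParam Φ e f θ ∈ paramDom e ∧
      (flowAt Φ e (returnParam Φ e f θ)).1.2 = f.symm θ.2.2.1 ∧
      xiLoc f (flowAt Φ e (returnParam Φ e f θ)) = θ.2.2.2 := by
  have hne := etaLoc_param_ne_zero hf hθ
  have ht := flowAt_time hΦ hf hθ
  obtain ⟨t, s, w, p⟩ := θ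
  obtain ⟨-, k₀, hk₀, hks⟩ := hΦ.isTimeFlow s (f.symm w) hne
  obtain ⟨⟨⟨t', x⟩, k⟩, hk⟩ : ∃ k, flowAt Φ f (t, s, w, p) = k := ⟨_, rfl⟩
  rw [hk] at hs ht
  obtain rfl : t' = t := ht
  obtain ⟨hlift, hre⟩ := hΦ.restart hne hk
  have hξ : (xiLoc e ⟨(t', x), k⟩).comp (dChart e x) =
      k.comp (ContinuousLinearMap.inr ℝ ℝ (TS x)) := xiLoc_comp_dChart he hs k
  have hret : returnParam Φ e f (t', s, w, p) = (s, t', e x, xiLoc e ⟨(t', x), k⟩) := by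
    simp only [returnParam, zetaLoc, hk]
  have hflow : flowAt Φ e (returnParam Φ e f (t', s, w, p)) = ⟨(s, f.symm w), k₀⟩ := by
    rw [hret]
    refine (apply_etaLoc_chart (fun y η => Φ t' y η s) hs (xiLoc e ⟨(t', x), k⟩)).trans ?_
    simp only
    rw [hξ, hre s, hks]
  refine ⟨?_, ?_, ?_⟩
  · rw [hret]
    refine ⟨e.map_source hs, fun h0 => hlift.ne_zero ?_⟩
    rw [← hξ]
    change xiLoc e ⟨(t', x), k⟩ = 0 at h0
    rw [h0, ContinuousLinearMap.zero_comp]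
  · rw [hflow]
  · rw [hflow]
    refine eq_of_comp_dChart hf (f.map_target hθ.1) ?_
    rw [xiLoc_comp_dChart hf (f.map_target hθ.1), hk₀.restrict]
    rfl

variable [CompactSpace S]

/-- A variation of the initial covector that changes neither the position nor the covector of the
flow vanishes. -/
lemma eq_zero_of_fderiv_flow_eq_zero (hφ : IsLeviCivitaPhase N Φ φ) (hΦ : g.IsLeviCivitaFlow ε Φ)
    (he : e ∈ atlas E3 S) (hf : f ∈ atlas E3 S) (hθ : θ ∈ paramDom f)
    (hs : (flowAt Φ f θ).1.2 ∈ e.source) {δ : E3 →L[ℝ] ℝ}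
    (h1 : fderiv ℝ (zetaLoc Φ e f) θ (etaDir δ) = 0)
    (h2 : fderiv ℝ (fun θ => xiLoc e (flowAt Φ f θ)) θ (etaDir δ) = 0) : δ = 0 := by
  obtain ⟨hb, hy, -⟩ := flowAt_returnParam hΦ he hf hθ hs
  have hret : HasFDerivAt (returnParam Φ e f) _ θ :=
    (hasFDerivAt_snd.fst (𝕜 := ℝ)).prodMk (hasFDerivAt_fst.prodMk
      (((contDiffAt_zetaLoc hφ hΦ he hf hθ hs).differentiableAt (by simp)).hasFDerivAt.prodMk
        ((contDiffAt_xiLoc hφ hΦ he hf hθ hs).differentiableAt (by simp)).hasFDerivAt))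
  have hys : (flowAt Φ e (returnParam Φ e f θ)).1.2 ∈ f.source := by
    rw [hy]; exact f.map_target hθ.1
  have hcomp := HasFDerivAt.comp (g := fun θ => xiLoc f (flowAt Φ e θ)) θ
    ((contDiffAt_xiLoc hφ hΦ hf he hb hys).differentiableAt (by simp)).hasFDerivAt hret
  have hid : HasFDerivAt ((fun θ => xiLoc f (flowAt Φ e θ)) ∘ returnParam Φ e f) _ θ :=
    (hasFDerivAt_snd.snd.snd (𝕜 := ℝ)).congr_of_eventuallyEq (by
      filter_upwards [eventually_flowAt_mem hφ hΦ hf hθ hs] with θ' h'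
      exact (flowAt_returnParam hΦ he hf h'.1 h'.2).2.2)
  -- Differentiating "return after flow is the identity" writes `δ` as a linear image of the
  -- variations of position and covector; the two time entries do not vary.
  have h3 := DFunLike.congr_fun (hid.unique hcomp) (etaDir δ)
  change δ = fderiv ℝ (fun θ => xiLoc f (flowAt Φ e θ)) (returnParam Φ e f θ)
    (0, 0, fderiv ℝ (zetaLoc Φ e f) θ (etaDir δ),
      fderiv ℝ (fun θ => xiLoc e (flowAt Φ f θ)) θ (etaDir δ)) at h3
  rw [h3, h1, h2]
  exact map_zero _

/-- The differential of the flow in the initial covector is isotropic for the canonical symplectic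
form. -/
lemma fderiv_flow_symm (hφ : IsLeviCivitaPhase N Φ φ) (hΦ : g.IsLeviCivitaFlow ε Φ)
    (he : e ∈ atlas E3 S) (hf : f ∈ atlas E3 S) (hθ : θ ∈ paramDom f)
    (hs : (flowAt Φ f θ).1.2 ∈ e.source) (δ δ' : E3 →L[ℝ] ℝ) :
    fderiv ℝ (fun θ => xiLoc e (flowAt Φ f θ)) θ (etaDir δ)
        (fderiv ℝ (zetaLoc Φ e f) θ (etaDir δ')) =
      fderiv ℝ (fun θ => xiLoc e (flowAt Φ f θ)) θ (etaDir δ')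
        (fderiv ℝ (zetaLoc Φ e f) θ (etaDir δ)) := by
  have hζ := contDiffAt_zetaLoc hφ hΦ he hf hθ hs
  have hξ := ((contDiffAt_xiLoc hφ hΦ he hf hθ hs).differentiableAt (by simp)).hasFDerivAt
  have hD : HasFDerivAt (fderiv ℝ (zetaLoc Φ e f)) _ θ :=
    ((hζ.fderiv_right (m := ∞) (by simp)).differentiableAt (by simp)).hasFDerivAt
  have hsymm : IsSymmSndFDerivAt ℝ (zetaLoc Φ e f) θ :=
    hζ.isSymmSndFDerivAt (by simp; norm_cast)
  -- Differentiating `⟨ξ, x_η b⟩ = 0` in direction `a` leaves minus `ξ` paired with a second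
  -- derivative of the position, which is symmetric in `a` and `b`.
  have key : ∀ a b : E3 →L[ℝ] ℝ, fderiv ℝ (fun θ => xiLoc e (flowAt Φ f θ)) θ (etaDir a)
        (fderiv ℝ (zetaLoc Φ e f) θ (etaDir b)) =
      -xiLoc e (flowAt Φ f θ) (fderiv ℝ (fderiv ℝ (zetaLoc Φ e f)) θ (etaDir a) (etaDir b)) := by
    intro a b
    have h1 : HasFDerivAt (fun θ => fderiv ℝ (zetaLoc Φ e f) θ (etaDir b)) _ θ :=
      (ContinuousLinearMap.apply ℝ E3 (etaDir b)).hasFDerivAt.comp θ hD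
    have h2 : HasFDerivAt (fun θ => xiLoc e (flowAt Φ f θ)
        (fderiv ℝ (zetaLoc Φ e f) θ (etaDir b))) (0 : Param →L[ℝ] ℝ) θ :=
      (hasFDerivAt_const (0 : ℝ) θ).congr_of_eventuallyEq (by
        filter_upwards [eventually_flowAt_mem hφ hΦ hf hθ hs] with θ' h'
        exact xiLoc_fderiv_zetaLoc hφ hΦ he hf h'.1 h'.2 b)
    have h3 := DFunLike.congr_fun (h2.unique (hξ.clm_apply h1)) (etaDir a)
    change 0 = xiLoc e (flowAt Φ f θ)
        (fderiv ℝ (fderiv ℝ (zetaLoc Φ e f)) θ (etaDir a) (etaDir b)) +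
      fderiv ℝ (fun θ => xiLoc e (flowAt Φ f θ)) θ (etaDir a)
        (fderiv ℝ (zetaLoc Φ e f) θ (etaDir b)) at h3
    linarith
  rw [key, key, hsymm]

/-- The mixed second derivative of the phase function along the flow. -/
lemma mixed_fderiv_phaseLoc (hφ : IsLeviCivitaPhase N Φ φ) (hΦ : g.IsLeviCivitaFlow ε Φ)
    (he : e ∈ atlas E3 S) (hf : f ∈ atlas E3 S) (hθ : θ ∈ paramDom f)
    (hs : (flowAt Φ f θ).1.2 ∈ e.source) (δ : E3 →L[ℝ] ℝ) (u : E3) :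
    fderiv ℝ (fderiv ℝ (phaseLoc φ e f)) (θ, zetaLoc Φ e f θ) (0, u) (etaDir δ, 0) =
      ((fderiv ℝ (fun θ => xiLoc e (flowAt Φ f θ)) θ (etaDir δ) u : ℝ) : ℂ) -
        fderiv ℝ (dPhaseLoc φ e f) (θ, zetaLoc Φ e f θ)
          (0, fderiv ℝ (zetaLoc Φ e f) θ (etaDir δ)) u := by
  have hz : zetaLoc Φ e f θ ∈ e.target := e.map_source hs
  have hp := contDiffAt_phaseLoc hφ.smooth he hf (q := (θ, zetaLoc Φ e f θ)) hθ hz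
  have hsymm : IsSymmSndFDerivAt ℝ (phaseLoc φ e f) (θ, zetaLoc Φ e f θ) :=
    hp.isSymmSndFDerivAt (by simp; norm_cast)
  have hD : HasFDerivAt (dPhaseLoc φ e f) _ (θ, zetaLoc Φ e f θ) :=
    ((contDiffAt_dPhaseLoc hφ.smooth he hf (q := (θ, zetaLoc Φ e f θ)) hθ hz).differentiableAt
      (by simp)).hasFDerivAt
  have h1 : ∀ v : Param × E3, fderiv ℝ (dPhaseLoc φ e f) (θ, zetaLoc Φ e f θ) v u =
      fderiv ℝ (fderiv ℝ (phaseLoc φ e f)) (θ, zetaLoc Φ e f θ) v (0, u) := by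
    intro v
    have h2 : HasFDerivAt (dPhaseLoc φ e f) _ (θ, zetaLoc Φ e f θ) :=
      ((ContinuousLinearMap.compL ℝ E3 (Param × E3) ℂ).flip
        (ContinuousLinearMap.inr ℝ Param E3)).hasFDerivAt.comp _
        ((hp.fderiv_right (m := ∞) (by simp)).differentiableAt (by simp)).hasFDerivAt
    rw [h2.fderiv]
    rfl
  have h3 : HasFDerivAt (fun θ => dPhaseLoc φ e f (θ, zetaLoc Φ e f θ)) _ θ :=
    HasFDerivAt.comp (g := dPhaseLoc φ e f) θ hD ((hasFDerivAt_id θ).prodMk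
      ((contDiffAt_zetaLoc hφ hΦ he hf hθ hs).differentiableAt (by simp)).hasFDerivAt)
  have h4 : HasFDerivAt (fun θ => dPhaseLoc φ e f (θ, zetaLoc Φ e f θ)) _ θ :=
    ((ContinuousLinearMap.compL ℝ E3 ℝ ℂ Complex.ofRealCLM).hasFDerivAt.comp θ
      ((contDiffAt_xiLoc hφ hΦ he hf hθ hs).differentiableAt (by simp)).hasFDerivAt
      ).congr_of_eventuallyEq (by
        filter_upwards [eventually_flowAt_mem hφ hΦ hf hθ hs] with θ' h'
        exact dPhaseLoc_zetaLoc hφ hΦ he hf h'.1 h'.2)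
  -- The two sides are the derivatives in `η` of the identity `∂_x φ(θ, x(θ)) = ξ(θ)`.
  have h5 := DFunLike.congr_fun (DFunLike.congr_fun (h3.unique h4) (etaDir δ)) u
  change fderiv ℝ (dPhaseLoc φ e f) (θ, zetaLoc Φ e f θ)
      (etaDir δ, fderiv ℝ (zetaLoc Φ e f) θ (etaDir δ)) u =
    ((fderiv ℝ (fun θ => xiLoc e (flowAt Φ f θ)) θ (etaDir δ) u : ℝ) : ℂ) at h5
  have h6 : ((etaDir δ, fderiv ℝ (zetaLoc Φ e f) θ (etaDir δ)) : Param × E3) =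
      (etaDir δ, 0) + (0, fderiv ℝ (zetaLoc Φ e f) θ (etaDir δ)) := by simp
  rw [h6, map_add, add_apply] at h5
  rw [← h5, add_sub_cancel_right, h1, hsymm]

omit [IsManifold 𝓘(ℝ, E3) ∞ S] [T2Space S] [CompactSpace S] in
/-- The spatial Hessian of a phase function is symmetric. -/
lemma fderiv_dPhaseLoc_symm (hφ : φ.IsSmooth) (he : e ∈ atlas E3 S) (hf : f ∈ atlas E3 S)
    {q : Param × E3} (hq : q.1 ∈ paramDom f) (hz : q.2 ∈ e.target) (u v : E3) :
    fderiv ℝ (dPhaseLoc φ e f) q (0, u) v = fderiv ℝ (dPhaseLoc φ e f) q (0, v) u := by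
  have hp := contDiffAt_phaseLoc hφ he hf hq hz
  have h2 : HasFDerivAt (dPhaseLoc φ e f) _ q :=
    ((ContinuousLinearMap.compL ℝ E3 (Param × E3) ℂ).flip
      (ContinuousLinearMap.inr ℝ Param E3)).hasFDerivAt.comp _
      ((hp.fderiv_right (m := ∞) (by simp)).differentiableAt (by simp)).hasFDerivAt
  have hsymm : IsSymmSndFDerivAt ℝ (phaseLoc φ e f) q :=
    hp.isSymmSndFDerivAt (by simp; norm_cast)
  rw [h2.fderiv]
  exact hsymm (0, u) (0, v)

/-- Nondegeneracy of the mixed second derivative of the phase function along the flow. -/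
lemma eq_zero_of_mixed_fderiv_eq_zero (hφ : IsLeviCivitaPhase N Φ φ)
    (hΦ : g.IsLeviCivitaFlow ε Φ) (he : e ∈ atlas E3 S) (hf : f ∈ atlas E3 S)
    (hθ : θ ∈ paramDom f) (hs : (flowAt Φ f θ).1.2 ∈ e.source) {δ δ' : E3 →L[ℝ] ℝ}
    (h : ∀ u : E3, fderiv ℝ (fderiv ℝ (phaseLoc φ e f)) (θ, zetaLoc Φ e f θ) (0, u)
        (etaDir δ, 0) +
      Complex.I * fderiv ℝ (fderiv ℝ (phaseLoc φ e f)) (θ, zetaLoc Φ e f θ) (0, u)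
        (etaDir δ', 0) = 0) : δ = 0 ∧ δ' = 0 := by
  have hz : zetaLoc Φ e f θ ∈ e.target := e.map_source hs
  let Q : E3 → E3 → ℂ := fun u v => fderiv ℝ (dPhaseLoc φ e f) (θ, zetaLoc Φ e f θ) (0, u) v
  let ζ' : (E3 →L[ℝ] ℝ) → E3 := fun δ => fderiv ℝ (zetaLoc Φ e f) θ (etaDir δ)
  let ξ' : (E3 →L[ℝ] ℝ) → E3 →L[ℝ] ℝ :=
    fun δ => fderiv ℝ (fun θ => xiLoc e (flowAt Φ f θ)) θ (etaDir δ)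
  have hQ : ∀ u v, Q u v = Q v u := fderiv_dPhaseLoc_symm hφ.smooth he hf hθ hz
  have hQim : ∀ u v, (Q u v).im = conormLoc g f θ * hLoc g e (ptLoc e (flowAt Φ f θ).1) u v :=
    im_fderiv_dPhaseLoc hφ hΦ he hf hθ hs
  have hQnn : ∀ u, 0 ≤ (Q u u).im ∧ ((Q u u).im = 0 → u = 0) := by
    intro u
    by_cases hu : u = 0
    · subst hu
      rw [hQim]; simp
    · have := mul_pos (conormLoc_pos (g := g) hf hθ)
        (hLoc_pos g he (p := ptLoc e (flowAt Φ f θ).1) hz hu)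
      rw [hQim]
      exact ⟨this.le, fun h0 => absurd h0 this.ne'⟩
  have hm : ∀ δ u, fderiv ℝ (fderiv ℝ (phaseLoc φ e f)) (θ, zetaLoc Φ e f θ) (0, u)
      (etaDir δ, 0) = (ξ' δ u : ℂ) - Q (ζ' δ) u := mixed_fderiv_phaseLoc hφ hΦ he hf hθ hs
  have hre : ∀ u, ξ' δ u - (Q (ζ' δ) u).re + (Q (ζ' δ') u).im = 0 := by
    intro u
    have := congrArg Complex.re (h u)
    rw [hm, hm] at this
    simpa using this
  have him : ∀ u, -(Q (ζ' δ) u).im + (ξ' δ' u - (Q (ζ' δ') u).re) = 0 := by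
    intro u
    have := congrArg Complex.im (h u)
    rw [hm, hm] at this
    simpa using this
  have hsym : ξ' δ (ζ' δ') = ξ' δ' (ζ' δ) := fderiv_flow_symm hφ hΦ he hf hθ hs δ δ'
  -- Testing the real part on `x_η δ'` and the imaginary part on `x_η δ` and subtracting cancels the
  -- `ξ_η` terms by `hsym` and the real Hessian terms by symmetry. A sum of two nonnegative numbers
  -- remains, and it is zero.
  have h1 := hre (ζ' δ')
  have h2 := him (ζ' δ)
  rw [hQ (ζ' δ') (ζ' δ)] at h2
  have ha := hQnn (ζ' δ)
  have hb := hQnn (ζ' δ')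
  have ha0 : ζ' δ = 0 := ha.2 (by linarith [ha.1, hb.1])
  have hb0 : ζ' δ' = 0 := hb.2 (by linarith [ha.1, hb.1])
  have hQ0 : ∀ u, Q 0 u = 0 := fun u =>
    DFunLike.congr_fun (map_zero (fderiv ℝ (dPhaseLoc φ e f) (θ, zetaLoc Φ e f θ))) u
  refine ⟨eq_zero_of_fderiv_flow_eq_zero hφ hΦ he hf hθ hs ha0 ?_,
    eq_zero_of_fderiv_flow_eq_zero hφ hΦ he hf hθ hs hb0 ?_⟩
  · refine ContinuousLinearMap.ext fun u => ?_
    have := hre u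
    rw [ha0, hb0, hQ0] at this
    simpa using this
  · refine ContinuousLinearMap.ext fun u => ?_
    have := him u
    rw [ha0, hb0, hQ0] at this
    simpa using this

end Nondegenerate

/-! ### From coordinates back to the manifold. -/

section AlongFlow

variable {S : Type*} [TopologicalSpace S] [ChartedSpace E3 S] [IsManifold 𝓘(ℝ, E3) ∞ S]
  {g : SpacetimeMetric S} {N : g.NormalNeighbourhoods} {e f : OpenPartialHomeomorph S E3}
  {ε : ℤˣ} {Φ : ℝ → ∀ y : S, CoTS y → ℝ → CotangentM S} {φ : PhaseFunction S} {θ : Param}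

/-- Every covector has coordinates. -/
lemma exists_etaLoc_eq (hf : f ∈ atlas E3 S) {w : E3} (hw : w ∈ f.target) (η : CoTS (f.symm w)) :
    ∃ p, etaLoc f w p = η := by
  refine ⟨η.comp (dSymm f w), ContinuousLinearMap.ext fun u => ?_⟩
  exact congrArg η (dSymm_dChart hf hw u)

/-- Replacing `y` by `f.symm w` before coordinates are introduced lets statements about covectors at
`y` be proved for `etaLoc f w p` without transport between fibres. -/
lemma exists_param_eq (P : ∀ y : S, CoTS y → Prop)
    (h : ∀ f ∈ atlas E3 S, ∀ w ∈ f.target, ∀ p ≠ 0, P (f.symm w) (etaLoc f w p)) (y : S)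
    (η : CoTS y) (hη : η ≠ 0) : P y η := by
  have hy : y ∈ (chartAt E3 y).source := mem_chart_source _ _
  have hf : chartAt E3 y ∈ atlas E3 S := chart_mem_atlas _ _
  generalize chartAt E3 y = f at hy hf
  obtain ⟨w, hw, rfl⟩ : ∃ w ∈ f.target, f.symm w = y := ⟨f y, f.map_source hy, f.left_inv hy⟩
  obtain ⟨p, rfl⟩ := exists_etaLoc_eq hf hw η
  refine h f hf w hw p ?_
  rintro rfl
  exact hη (ContinuousLinearMap.zero_comp _)

/-- Derivatives of functions given in a chart. -/
lemma mfderiv_eq_comp_dChart (he : e ∈ atlas E3 S) {x : S} (hx : x ∈ e.source) {F : S → ℂ}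
    {F₀ : E3 → ℂ} {F' : E3 →L[ℝ] ℂ} (hF : ∀ᶠ x' in 𝓝 x, F x' = F₀ (e x'))
    (hF' : HasFDerivAt F₀ F' (e x)) (u : TS x) :
    (mfderiv 𝓘(ℝ, E3) 𝓘(ℝ, ℂ) F x : TS x →L[ℝ] ℂ) u = F' (dChart e x u) := by
  have h1 : HasMFDerivAt 𝓘(ℝ, E3) 𝓘(ℝ, E3) e x (dChart e x) :=
    ((chart_mdiff he).mdifferentiableAt hx).hasMFDerivAt
  have h2 : HasMFDerivAt 𝓘(ℝ, E3) 𝓘(ℝ, ℂ) (F₀ ∘ e) x (F'.comp (dChart e x)) :=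
    HasMFDerivAt.comp x (hF'.hasMFDerivAt) h1
  have h3 := (h2.congr_of_eventuallyEq hF).mfderiv
  exact DFunLike.congr_fun h3 u

variable [T2Space S]

/-- The value and the differential of the phase function along the flow. -/
lemma IsLeviCivitaPhase.jet (hφ : IsLeviCivitaPhase N Φ φ) (hΦ : g.IsLeviCivitaFlow ε Φ)
    (t s : ℝ) (y : S) (η : CoTS y) (hη : η ≠ 0) :
    φ t (Φ s y η t).1.2 s y η = 0 ∧
      ∀ u : TS (Φ s y η t).1.2,
        φ.dX t (Φ s y η t).1.2 s y η u = (((Φ s y η t).2 (0, u) : ℝ) : ℂ) := by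
  refine exists_param_eq (P := fun y η => φ t (Φ s y η t).1.2 s y η = 0 ∧
      ∀ u : TS (Φ s y η t).1.2,
        φ.dX t (Φ s y η t).1.2 s y η u = (((Φ s y η t).2 (0, u) : ℝ) : ℂ)) ?_ y η hη
  intro f hf w hw p hp
  have hθ : ((t, s, w, p) : Param) ∈ paramDom f := ⟨hw, hp⟩
  change φ t (flowAt Φ f (t, s, w, p)).1.2 s (f.symm w) (etaLoc f w p) = 0 ∧
    ∀ u : TS (flowAt Φ f (t, s, w, p)).1.2,
      φ.dX t (flowAt Φ f (t, s, w, p)).1.2 s (f.symm w) (etaLoc f w p) u =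
        (((flowAt Φ f (t, s, w, p)).2 (0, u) : ℝ) : ℂ)
  have hx := mem_chart_source E3 (flowAt Φ f (t, s, w, p)).1.2
  have he := chart_mem_atlas E3 (flowAt Φ f (t, s, w, p)).1.2
  generalize chartAt E3 (flowAt Φ f (t, s, w, p)).1.2 = e at hx he
  have hj := phaseLoc_jet hφ hΦ he hf hθ hx
  constructor
  · have h1 := hj.1
    change φ t (e.symm (e (flowAt Φ f (t, s, w, p)).1.2)) s (f.symm w) (etaLoc f w p) = 0 at h1
    rwa [e.left_inv hx] at h1
  · intro u
    refine (mfderiv_eq_comp_dChart he hx ?_ hj.2 u).trans ?_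
    · filter_upwards [e.open_source.mem_nhds hx] with x' hx'
      change _ = φ t (e.symm (e x')) s (f.symm w) (etaLoc f w p)
      rw [e.left_inv hx']
    · exact congrArg Complex.ofReal
        (covecLoc_vecLoc he hx (flowAt Φ f (t, s, w, p)).2 (0, u))

variable [CompactSpace S]

/-- Nondegeneracy of the phase function along the flow. -/
lemma IsLeviCivitaPhase.det_mixedHessian_ne_zero (hφ : IsLeviCivitaPhase N Φ φ)
    (hΦ : g.IsLeviCivitaFlow ε Φ) (t s : ℝ) (y : S) (η : CoTS y) (hη : η ≠ 0)
    (b : Module.Basis (Fin 3) ℝ (TS (Φ s y η t).1.2)) (c : Module.Basis (Fin 3) ℝ (CoTS y)) :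
    (φ.mixedHessian t (Φ s y η t).1.2 s y η b c).det ≠ 0 := by
  revert b c
  refine exists_param_eq (P := fun y η => ∀ (b : Module.Basis (Fin 3) ℝ (TS (Φ s y η t).1.2))
    (c : Module.Basis (Fin 3) ℝ (CoTS y)),
    (φ.mixedHessian t (Φ s y η t).1.2 s y η b c).det ≠ 0) ?_ y η hη
  intro f hf w hw p hp
  have hθ : ((t, s, w, p) : Param) ∈ paramDom f := ⟨hw, hp⟩
  change ∀ (b : Module.Basis (Fin 3) ℝ (TS (flowAt Φ f (t, s, w, p)).1.2))
    (c : Module.Basis (Fin 3) ℝ (CoTS (f.symm w))), (φ.mixedHessian t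
      (flowAt Φ f (t, s, w, p)).1.2 s (f.symm w) (etaLoc f w p) b c).det ≠ 0
  intro b c hdet
  have hx := mem_chart_source E3 (flowAt Φ f (t, s, w, p)).1.2
  have he := chart_mem_atlas E3 (flowAt Φ f (t, s, w, p)).1.2
  generalize chartAt E3 (flowAt Φ f (t, s, w, p)).1.2 = e at hx he
  choose δ hδ using fun β => exists_etaLoc_eq hf hw (c β)
  have hz : zetaLoc Φ e f (t, s, w, p) ∈ e.target := e.map_source hx
  let M : E3 → (E3 →L[ℝ] ℝ) → ℂ := fun u δ =>
    fderiv ℝ (fderiv ℝ (phaseLoc φ e f)) ((t, s, w, p), zetaLoc Φ e f (t, s, w, p)) (0, u)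
      (etaDir δ, 0)
  have hM : ∀ α β, φ.mixedHessian t (flowAt Φ f (t, s, w, p)).1.2 s (f.symm w) (etaLoc f w p) b c
      α β = M (dChart e _ (b α)) (δ β) := by
    intro α β
    have h1 : HasFDerivAt (fun z => fderiv ℝ (phaseLoc φ e f) ((t, s, w, p), z) (etaDir (δ β), 0))
        _ (zetaLoc Φ e f (t, s, w, p)) :=
      (ContinuousLinearMap.apply ℝ ℂ ((etaDir (δ β), 0) : Param × E3)).hasFDerivAt.comp _
        (HasFDerivAt.comp (g := fderiv ℝ (phaseLoc φ e f)) _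
          (((contDiffAt_phaseLoc hφ.smooth he hf
            (q := ((t, s, w, p), zetaLoc Φ e f (t, s, w, p))) hθ hz).fderiv_right (m := ∞)
            (by simp)).differentiableAt (by simp)).hasFDerivAt
          (hasFDerivAt_prodMk_right (t, s, w, p) _))
    refine (mfderiv_eq_comp_dChart he hx ?_ h1 (b α)).trans rfl
    filter_upwards [e.open_source.mem_nhds hx] with x' hx'
    rw [← hδ β]
    exact dEta_eq_fderiv hφ.smooth he hf (θ := (t, s, w, p)) hθ hx' (δ β)
  obtain ⟨v, hv, hMv⟩ := Matrix.exists_mulVec_eq_zero_iff.2 hdet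
  let D : (Fin 3 → ℝ) → E3 →L[ℝ] ℝ := fun r => ∑ β, r β • δ β
  have hD : ∀ r, D r = 0 → r = 0 := by
    intro r hr
    have h1 : ∑ β, r β • c β = 0 := by
      simp only [← hδ]
      have : ∑ β, r β • etaLoc f w (δ β) = etaLoc f w (D r) := by
        refine ContinuousLinearMap.ext fun u => ?_
        simp [etaLoc, D]
      rw [this, hr]
      exact ContinuousLinearMap.zero_comp _
    funext β
    exact Fintype.linearIndependent_iff.1 c.linearIndependent r h1 β
  have hMD : ∀ (r : Fin 3 → ℝ) (u : E3), M u (D r) = ∑ β, (r β : ℂ) * M u (δ β) := by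
    intro r u
    have h1 : ((etaDir (D r), 0) : Param × E3) = ∑ β, r β • ((etaDir (δ β), 0) : Param × E3) := by
      simp [D, etaDir, Fin.sum_univ_three]
    simp only [M]
    rw [h1, map_sum]
    refine Finset.sum_congr rfl fun β _ => ?_
    rw [map_smul, Complex.real_smul]
  -- A complex kernel vector of the matrix splits into real covectors `δ, δ'` such that the mixed
  -- derivative kills `δ + i δ'`. The relation holds on the basis `b` and extends to all directions
  -- by linearity.
  have key : ∀ u, M u (D fun β => (v β).re) + Complex.I * M u (D fun β => (v β).im) = 0 := by
    have h1 : ∀ α, M (dChart e _ (b α)) (D fun β => (v β).re) +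
        Complex.I * M (dChart e _ (b α)) (D fun β => (v β).im) = 0 := by
      intro α
      have h2 := congrFun hMv α
      simp only [Matrix.mulVec, dotProduct, hM, Pi.zero_apply] at h2
      rw [hMD, hMD, Finset.mul_sum, ← Finset.sum_add_distrib, ← h2]
      refine Finset.sum_congr rfl fun β _ => ?_
      conv_rhs => rw [← Complex.re_add_im (v β)]
      ring
    intro u
    obtain ⟨u', rfl⟩ := (dChart_bijective he hx).2 u
    let A : E3 →L[ℝ] ℂ :=
      ((fderiv ℝ (fderiv ℝ (phaseLoc φ e f))
        ((t, s, w, p), zetaLoc Φ e f (t, s, w, p))).flip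
        (etaDir (D fun β => (v β).re), 0)).comp (ContinuousLinearMap.inr ℝ Param E3)
    let B : E3 →L[ℝ] ℂ :=
      ((fderiv ℝ (fderiv ℝ (phaseLoc φ e f))
        ((t, s, w, p), zetaLoc Φ e f (t, s, w, p))).flip
        (etaDir (D fun β => (v β).im), 0)).comp (ContinuousLinearMap.inr ℝ Param E3)
    let C : TS (flowAt Φ f (t, s, w, p)).1.2 →L[ℝ] ℂ := (A + Complex.I • B).comp (dChart e _)
    have hlin : (C : TS (flowAt Φ f (t, s, w, p)).1.2 →ₗ[ℝ] ℂ) = 0 :=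
      b.ext fun α => (h1 α : C (b α) = 0)
    exact DFunLike.congr_fun hlin u'
  obtain ⟨h1, h2⟩ := eq_zero_of_mixed_fderiv_eq_zero hφ hΦ he hf hθ hx key
  refine hv (funext fun β => Complex.ext ?_ ?_)
  · exact congrFun (hD _ h1) β
  · exact congrFun (hD _ h2) β

end AlongFlow

/-! ### Smaller star-shaped normal neighbourhoods. -/

section Shrinking

variable {S : Type*} [TopologicalSpace S] [ChartedSpace E3 S]
  {g : SpacetimeMetric S} (N : g.NormalNeighbourhoods)

/-- The squared Riemannian length of the logarithm, for the metric `β² dt² + h_t`. -/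
def logNormSq (Z X : ℝ × S) : ℝ :=
  (g.lapse Z * (N.log Z X).1) ^ 2 + g.h Z.1 Z.2 (N.log Z X).2 (N.log Z X).2

lemma logNormSq_of_log_eq_smul {Z X X' : ℝ × S} {r : ℝ} (h : N.log Z X' = r • N.log Z X) :
    logNormSq N Z X' = r ^ 2 * logNormSq N Z X := by
  simp only [logNormSq, h, Prod.smul_fst, Prod.smul_snd, map_smul, smul_apply, smul_eq_mul]
  ring

lemma logNormSq_self (Z : ℝ × S) : logNormSq N Z Z = 0 := by
  simp [logNormSq, N.log_self]

lemma logNormSq_nonneg (Z X : ℝ × S) : 0 ≤ logNormSq N Z X := by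
  refine add_nonneg (sq_nonneg _) ?_
  by_cases h : (N.log Z X).2 = 0
  · rw [h]; simp
  · exact (g.h_pos _ _ _ h).le

variable [IsManifold 𝓘(ℝ, E3) ∞ S]

lemma logNormSq_pos [T2Space S] {Z X : ℝ × S} (hd : (Z, X) ∈ N.dom) (hne : X ≠ Z) :
    0 < logNormSq N Z X := by
  by_cases h : (N.log Z X).2 = 0
  · have h1 : (N.log Z X).1 ≠ 0 := fun h1 => hne (N.eq_of_log_eq_zero hd (Prod.ext h1 h))
    have h2 := g.lapse_pos Z
    rw [logNormSq, h]
    simp only [map_zero, add_zero]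
    positivity
  · exact add_pos_of_nonneg_of_pos (sq_nonneg _) (g.h_pos _ _ _ h)

lemma hLoc_dChart {e : OpenPartialHomeomorph S E3} (he : e ∈ atlas E3 S) {X : ℝ × S}
    (hX : X.2 ∈ e.source) (u v : TS X.2) :
    hLoc g e (ptLoc e X) (dChart e X.2 u) (dChart e X.2 v) = g.h X.1 X.2 u v := by
  obtain ⟨t, x⟩ := X
  obtain ⟨z, hz, rfl⟩ : ∃ z ∈ e.target, e.symm z = x :=
    ⟨e x, e.map_source hX, e.left_inv hX⟩
  have hp : ptLoc e (t, e.symm z) = (t, z) := Prod.ext rfl (e.right_inv hz)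
  have hd : ∀ v : TS (e.symm z), dSymm e z (dChart e (e.symm z) v) = v := dSymm_dChart he hz
  rw [hp, hLoc_apply]
  simp only [hd]

/-- The two points need separate charts, since the end point may be far from the chart of the
centre. -/
lemma continuousAt_logNormSq {Z X : ℝ × S} (hd : (Z, X) ∈ N.dom) :
    ContinuousAt (fun q : (ℝ × S) × (ℝ × S) => logNormSq N q.1 q.2) (Z, X) := by
  have hZ := mem_chart_source E3 Z.2
  have he := chart_mem_atlas E3 Z.2
  have hX := mem_chart_source E3 X.2
  have hf := chart_mem_atlas E3 X.2
  generalize chartAt E3 Z.2 = e at hZ he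
  generalize chartAt E3 X.2 = f at hX hf
  let L : (ℝ × E3) × (ℝ × E3) → ℝ × E3 := fun q =>
    vecLoc e (ptSymm e q.1) (N.log (ptSymm e q.1) (ptSymm f q.2))
  let U : Set ((ℝ × E3) × (ℝ × E3)) := {q | q.1.2 ∈ e.target ∧ q.2.2 ∈ f.target ∧
    (ptSymm e q.1, ptSymm f q.2) ∈ N.dom}
  let c : (ℝ × S) × (ℝ × S) → (ℝ × E3) × (ℝ × E3) := fun q => (ptLoc e q.1, ptLoc f q.2)
  have hcU : c (Z, X) ∈ U := by
    refine ⟨e.map_source hZ, f.map_source hX, ?_⟩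
    change (ptSymm e (ptLoc e Z), ptSymm f (ptLoc f X)) ∈ N.dom
    rwa [ptSymm_ptLoc hZ, ptSymm_ptLoc hX]
  have hU : U ∈ 𝓝 (c (Z, X)) := by
    have h1 : ∀ᶠ r : (ℝ × E3) × (ℝ × E3) in 𝓝 (c (Z, X)), r.1.2 ∈ e.target :=
      (continuous_fst.snd).continuousAt.eventually (e.open_target.mem_nhds hcU.1)
    have h2 : ∀ᶠ r : (ℝ × E3) × (ℝ × E3) in 𝓝 (c (Z, X)), r.2.2 ∈ f.target :=
      (continuous_snd.snd).continuousAt.eventually (f.open_target.mem_nhds hcU.2.1)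
    have h3 : ContinuousAt (fun r : (ℝ × E3) × (ℝ × E3) => (ptSymm e r.1, ptSymm f r.2))
        (c (Z, X)) :=
      (ContinuousAt.comp (g := ptSymm e) (continuousAt_ptSymm hcU.1) continuousAt_fst).prodMk
        (ContinuousAt.comp (g := ptSymm f) (continuousAt_ptSymm hcU.2.1) continuousAt_snd)
    have h4 := h3.eventually (N.isOpen_dom.mem_nhds hcU.2.2)
    filter_upwards [h1, h2, h4] with r h1 h2 h4 using ⟨h1, h2, h4⟩
  have hL : ContinuousAt L (c (Z, X)) :=
    ((N.log_smooth e he f hf).contDiffAt hU).continuousAt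
  have hptc : ∀ {e : OpenPartialHomeomorph S E3} {Y : ℝ × S}, Y.2 ∈ e.source →
      ContinuousAt (ptLoc e) Y := fun {e Y} hY =>
    continuousAt_fst.prodMk (ContinuousAt.comp (g := e) (e.continuousAt hY) continuousAt_snd)
  have hc : ContinuousAt c (Z, X) :=
    (ContinuousAt.comp (g := ptLoc e) (hptc hZ) continuousAt_fst).prodMk
      (ContinuousAt.comp (g := ptLoc f) (hptc hX) continuousAt_snd)
  have hLc : ContinuousAt (fun q => L (c q)) (Z, X) :=
    ContinuousAt.comp (g := L) (f := c) hL hc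
  have hh : ContinuousAt (fun q : (ℝ × S) × (ℝ × S) => hLoc g e (ptLoc e q.1)) (Z, X) := by
    have h1 : ContDiffAt ℝ ∞ (hLoc g e) (ptLoc e Z) := (contDiffOn_hLoc g he).contDiffAt
      ((isOpen_univ.prod e.open_target).mem_nhds ⟨mem_univ _, e.map_source hZ⟩)
    exact ContinuousAt.comp (g := hLoc g e) h1.continuousAt
      (ContinuousAt.comp (g := ptLoc e) (hptc hZ) continuousAt_fst)
  have hF : ContinuousAt (fun q : (ℝ × S) × (ℝ × S) => (g.lapse q.1 * (L (c q)).1) ^ 2 +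
      hLoc g e (ptLoc e q.1) (L (c q)).2 (L (c q)).2) (Z, X) :=
    (((g.lapse_smooth.continuous.continuousAt.comp continuousAt_fst).mul hLc.fst).pow 2).add
      ((hh.clm_apply hLc.snd).clm_apply hLc.snd)
  refine hF.congr ?_
  have h1 : ∀ᶠ q : (ℝ × S) × (ℝ × S) in 𝓝 (Z, X), q.1.2 ∈ e.source :=
    (continuous_fst.snd).continuousAt.eventually (e.open_source.mem_nhds hZ)
  have h2 : ∀ᶠ q : (ℝ × S) × (ℝ × S) in 𝓝 (Z, X), q.2.2 ∈ f.source :=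
    (continuous_snd.snd).continuousAt.eventually (f.open_source.mem_nhds hX)
  filter_upwards [h1, h2] with q hq1 hq2
  have h3 : L (c q) = vecLoc e q.1 (N.log q.1 q.2) := by
    simp only [L, c]
    rw [ptSymm_ptLoc hq1, ptSymm_ptLoc hq2]
  rw [h3, vecLoc_fst, vecLoc_snd, logNormSq]
  congr 1
  exact hLoc_dChart he hq1 _ _

/-- The part of a normal neighbourhood in which the logarithm is shorter than at all points with
`κ = 1 / 2`. -/
def shrunkDom (κ : (ℝ × S) × (ℝ × S) → ℝ) : Set ((ℝ × S) × (ℝ × S)) :=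
  {q | q ∈ N.dom ∧ ∀ X, κ (q.1, X) = 1 / 2 → logNormSq N q.1 q.2 < logNormSq N q.1 X}

/-- A cut-off function on pairs of points that vanishes on the diagonal and equals one outside the
normal neighbourhoods. -/
structure IsCutoff (κ : (ℝ × S) × (ℝ × S) → ℝ) : Prop where
  continuous : Continuous κ
  diag : ∀ Z, κ (Z, Z) = 0
  one : ∀ Z X, (Z, X) ∉ N.dom ∨ 1 ≤ |X.1 - Z.1| → κ (Z, X) = 1

variable {N} {κ : (ℝ × S) × (ℝ × S) → ℝ}

omit [IsManifold 𝓘(ℝ, E3) ∞ S] in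
lemma IsCutoff.mem_dom (hκ : IsCutoff N κ) {Z X : ℝ × S} (h : κ (Z, X) ≠ 1) :
    (Z, X) ∈ N.dom ∧ |X.1 - Z.1| < 1 := by
  by_contra hn
  exact h (hκ.one Z X (by
    by_cases hd : (Z, X) ∈ N.dom
    · exact Or.inr (not_lt.1 fun hl => hn ⟨hd, hl⟩)
    · exact Or.inl hd))

omit [IsManifold 𝓘(ℝ, E3) ∞ S] in
-- Otherwise `κ`, which is `0` at the centre, would equal `1/2` somewhere on the radial geodesic to
-- `X`; but points on it have logarithms no longer than that of `X`, against the definition of the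
-- shrunk domain.
lemma IsCutoff.lt_half (hκ : IsCutoff N κ) {Z X : ℝ × S} (h : (Z, X) ∈ shrunkDom N κ) :
    κ (Z, X) < 1 / 2 := by
  by_contra hge
  obtain ⟨J, γ, -, hIJ, hγ, h0, h1, -, hr⟩ := N.geodesic Z X h.1
  have hcont : ContinuousOn (fun r => κ (Z, γ r)) (Icc 0 1) :=
    hκ.continuous.comp_continuousOn
      (continuousOn_const.prodMk (hγ.smooth.continuousOn.mono hIJ))
  obtain ⟨r, hrI, hrκ⟩ := intermediate_value_Icc zero_le_one hcont
    (show (1 / 2 : ℝ) ∈ Icc _ _ by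
      simp only [h0, h1, hκ.diag]
      exact ⟨by norm_num, not_lt.1 hge⟩)
  have h2 := h.2 (γ r) hrκ
  rw [logNormSq_of_log_eq_smul N (hr r hrI).2] at h2
  have h3 := logNormSq_nonneg N Z X
  have h4 : r ^ 2 ≤ 1 := pow_le_one₀ hrI.1 hrI.2
  nlinarith

variable [T2Space S] [CompactSpace S]

omit [T2Space S] in
-- The condition quantifies over all `X'`, but `κ = 1/2` keeps `X'` within unit time of the centre,
-- so a compact slab suffices. At each `X'` of the slab either `κ ≠ 1/2` persists nearby, or the
-- strict inequality does, by continuity.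
lemma IsCutoff.isOpen_shrunkDom (hκ : IsCutoff N κ) : IsOpen (shrunkDom N κ) := by
  refine isOpen_iff_eventually.2 ?_
  rintro ⟨Z, X⟩ ⟨hd, hlt⟩
  have hK : IsCompact (Icc (Z.1 - 2) (Z.1 + 2) ×ˢ (univ : Set S)) :=
    isCompact_Icc.prod isCompact_univ
  have h1 : ∀ᶠ q in 𝓝 (Z, X), ∀ X' ∈ Icc (Z.1 - 2) (Z.1 + 2) ×ˢ (univ : Set S),
      κ (q.1, X') = 1 / 2 → logNormSq N q.1 q.2 < logNormSq N q.1 X' := by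
    refine hK.eventually_forall_of_forall_eventually fun X' _ => ?_
    have hc : Continuous fun r : ((ℝ × S) × (ℝ × S)) × (ℝ × S) => (r.1.1, r.2) :=
      continuous_fst.fst.prodMk continuous_snd
    by_cases hX' : κ (Z, X') = 1 / 2
    · have hd' : (Z, X') ∈ N.dom := (hκ.mem_dom (by rw [hX']; norm_num)).1
      have h2 : ContinuousAt (fun r : ((ℝ × S) × (ℝ × S)) × (ℝ × S) =>
          logNormSq N r.1.1 r.2) ((Z, X), X') :=
        ContinuousAt.comp (g := fun q : (ℝ × S) × (ℝ × S) => logNormSq N q.1 q.2)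
          (f := fun r : ((ℝ × S) × (ℝ × S)) × (ℝ × S) => (r.1.1, r.2)) (x := ((Z, X), X'))
          (continuousAt_logNormSq N hd') hc.continuousAt
      have h3 : ContinuousAt (fun r : ((ℝ × S) × (ℝ × S)) × (ℝ × S) =>
          logNormSq N r.1.1 r.1.2) ((Z, X), X') :=
        ContinuousAt.comp (g := fun q : (ℝ × S) × (ℝ × S) => logNormSq N q.1 q.2)
          (f := fun r : ((ℝ × S) × (ℝ × S)) × (ℝ × S) => r.1) (x := ((Z, X), X'))
          (continuousAt_logNormSq N hd) continuousAt_fst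
      exact (h3.eventually_lt h2 (hlt X' hX')).mono fun r hr _ => hr
    · have h2 : ContinuousAt (fun r : ((ℝ × S) × (ℝ × S)) × (ℝ × S) => κ (r.1.1, r.2))
          ((Z, X), X') := (hκ.continuous.comp hc).continuousAt
      exact (h2.eventually_ne hX').mono fun r hr h => absurd h hr
  have h2 : ∀ᶠ q : (ℝ × S) × (ℝ × S) in 𝓝 (Z, X), q.1.1 ∈ Ioo (Z.1 - 1) (Z.1 + 1) :=
    (continuous_fst.fst).continuousAt.eventually (Ioo_mem_nhds (by simp) (by simp))
  filter_upwards [h1, h2, N.isOpen_dom.mem_nhds hd] with q h1 h2 h3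
  refine ⟨h3, fun X' hX' => h1 X' ⟨?_, mem_univ _⟩ hX'⟩
  have h4 := abs_lt.1 (hκ.mem_dom (Z := q.1) (X := X') (by rw [hX']; norm_num)).2
  exact ⟨by linarith [h2.1, h4.1], by linarith [h2.2, h4.2]⟩

/-- Normal neighbourhoods shrunk along a cut-off function. -/
def IsCutoff.shrink (hκ : IsCutoff N κ) : g.NormalNeighbourhoods where
  dom := shrunkDom N κ
  isOpen_dom := hκ.isOpen_shrunkDom
  diag_mem Z := by
    -- The centre has logarithm zero, while a point with `κ = 1/2` lies in the original
    -- neighbourhood and differs from the centre, where `κ = 0`.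
    refine ⟨N.diag_mem Z, fun X hX => ?_⟩
    rw [logNormSq_self]
    refine logNormSq_pos N (hκ.mem_dom (by rw [hX]; norm_num)).1 ?_
    rintro rfl
    rw [hκ.diag] at hX
    norm_num at hX
  log := N.log
  geodesic Z X h := by
    obtain ⟨J, γ, hJ, hIJ, hγ, h0, h1, hv, hr⟩ := N.geodesic Z X h.1
    refine ⟨J, γ, hJ, hIJ, hγ, h0, h1, hv, fun r hrI => ⟨⟨(hr r hrI).1, fun X' hX' => ?_⟩,
      (hr r hrI).2⟩⟩
    -- Star-shapedness survives because moving inward along the radial geodesic multiplies the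
    -- squared length by `r ^ 2 ≤ 1`.
    refine lt_of_le_of_lt ?_ (h.2 X' hX')
    change logNormSq N Z (γ r) ≤ logNormSq N Z X
    rw [logNormSq_of_log_eq_smul N (hr r hrI).2]
    exact mul_le_of_le_one_left (logNormSq_nonneg N Z X) (pow_le_one₀ hrI.1 hrI.2)
  log_smooth e he f hf := (N.log_smooth e he f hf).mono fun _ hq => ⟨hq.1, hq.2.1, hq.2.2.1⟩

variable (N) in
lemma exists_isCutoff : ∃ κ : (ℝ × S) × (ℝ × S) → ℝ, IsCutoff N κ ∧
    ContMDiff ((𝓘(ℝ, ℝ).prod 𝓘(ℝ, E3)).prod (𝓘(ℝ, ℝ).prod 𝓘(ℝ, E3))) 𝓘(ℝ, ℝ) ∞ κ := by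
  -- Besides leaving the normal neighbourhood, a time difference of at least one also forces `κ =
  -- 1`; this replaces the missing compactness of the time axis.
  have hV : IsOpen {q : (ℝ × S) × (ℝ × S) | q ∈ N.dom ∧ |q.2.1 - q.1.1| < 1} :=
    N.isOpen_dom.inter (isOpen_lt (continuous_snd.fst.sub continuous_fst.fst).abs continuous_const)
  obtain ⟨κ, h0, h1, -⟩ := exists_contMDiffMap_zero_one_of_isClosed (n := (⊤ : ℕ∞))
    ((𝓘(ℝ, ℝ).prod 𝓘(ℝ, E3)).prod (𝓘(ℝ, ℝ).prod 𝓘(ℝ, E3)))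
    (isClosed_diagonal (X := ℝ × S)) hV.isClosed_compl (by
      refine disjoint_compl_right_iff_subset.2 ?_
      rintro ⟨Z, X⟩ hq
      obtain rfl : Z = X := hq
      exact ⟨N.diag_mem Z, by simp⟩)
  refine ⟨κ, ⟨κ.contMDiff.continuous, fun Z => h0 (mem_diagonal Z), fun Z X h => h1 ?_⟩,
    κ.contMDiff⟩
  rintro ⟨h2, h3⟩
  rcases h with h | h
  · exact h h2
  · exact absurd h3 (not_lt.2 h)

end Shrinking

/-! ### Homogeneous continuation and the opposite phase function. -/

section Continuation

variable {S : Type*} [TopologicalSpace S] [ChartedSpace E3 S]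
  {g : SpacetimeMetric S} {N : g.NormalNeighbourhoods} {e f : OpenPartialHomeomorph S E3}
  {ε : ℤˣ} {Φ Φ' : ℝ → ∀ y : S, CoTS y → ℝ → CotangentM S} {φ : PhaseFunction S} {θ : Param}
  {κ : (ℝ × S) × (ℝ × S) → ℝ}

/-- The phase function `-conj φ(-η)` of the opposite flow. -/
def PhaseFunction.opposite (φ : PhaseFunction S) : PhaseFunction S :=
  fun t x s y η => -(starRingEnd ℂ) (φ t x s y (-η))

lemma PhaseFunction.dEta_opposite (φ : PhaseFunction S) (t : ℝ) (x : S) (s : ℝ) (y : S)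
    (η ζ : CoTS y) : φ.opposite.dEta t x s y η (-ζ) =
      -(starRingEnd ℂ) (φ.dEta t x s y (-η) ζ) := by
  have h1 : (fun r : ℝ => φ.opposite t x s y (η + r • -ζ)) =
      fun r : ℝ => -star (φ t x s y (-η + r • ζ)) := by
    funext r
    simp only [PhaseFunction.opposite, smul_neg, neg_add, neg_neg]
    rfl
  rw [PhaseFunction.dEta, h1, deriv.fun_neg, deriv.star]
  rfl

lemma PhaseFunction.opposite_smul {t s : ℝ} {x y : S} {η : CoTS y} {l : ℝ}
    (h : φ t x s y (l • -η) = (l : ℂ) * φ t x s y (-η)) :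
    φ.opposite t x s y (l • η) = (l : ℂ) * φ.opposite t x s y η := by
  simp only [PhaseFunction.opposite]
  rw [← smul_neg, h, map_mul, Complex.conj_ofReal, mul_neg]

lemma PhaseFunction.IsSmooth.opposite (hφ : φ.IsSmooth) : φ.opposite.IsSmooth := by
  intro e he f hf
  have h1 : ContDiff ℝ ∞ fun q : ℝ × E3 × ℝ × E3 × (E3 →L[ℝ] ℝ) =>
      ((q.1, q.2.1, q.2.2.1, q.2.2.2.1, -q.2.2.2.2) : ℝ × E3 × ℝ × E3 × (E3 →L[ℝ] ℝ)) := by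
    fun_prop
  have h2 := (hφ e he f hf).comp h1.contDiffOn
    (s := {q | q.2.1 ∈ e.target ∧ q.2.2.2.1 ∈ f.target ∧ q.2.2.2.2 ≠ 0})
    (fun q hq => ⟨hq.1, hq.2.1, neg_ne_zero.2 hq.2.2⟩)
  exact ((Complex.conjCLE.contDiff.comp_contDiffOn h2).neg)

variable [IsManifold 𝓘(ℝ, E3) ∞ S] [T2Space S]

/-- Reversal of the flow turns `η ↦ -conj φ(-η)` into a solution of (1) for the opposite flow, and
the map preserves imaginary parts, so the conditions off the neighbourhoods carry over. -/
lemma IsLeviCivitaPhase.opposite (hφ : IsLeviCivitaPhase N Φ φ) (hΦ : g.IsLeviCivitaFlow ε Φ)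
    (hΦ' : g.IsLeviCivitaFlow (-ε) Φ') : IsLeviCivitaPhase N Φ' φ.opposite := by
  have hneg : ∀ s y (η : CoTS y), η ≠ 0 → ∀ t,
      Φ s y (-η) t = ⟨(Φ' s y η t).1, -(Φ' s y η t).2⟩ := fun s y η hη t =>
    hΦ'.neg (ε := -ε) (by rwa [neg_neg]) hη t
  refine ⟨hφ.smooth.opposite, ?_, ?_, ?_⟩
  · intro t x s y η hη hd
    have h1 := hneg s y η hη t
    have h2 := hφ.formula t x s y (-η) (neg_ne_zero.2 hη) (by rw [h1]; exact hd)
    have h3 : g.conorm s y (-η) = g.conorm s y η := by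
      rw [← neg_one_smul ℝ η, conorm_smul]; simp
    rw [PhaseFunction.opposite, h2, h1, h3]
    simp [add_comm]
  · intro t x s y η hη hd
    have h1 := hφ.im_nonneg t x s y (-η) (neg_ne_zero.2 hη) (by rw [hneg s y η hη t]; exact hd)
    simpa [PhaseFunction.opposite] using h1
  · intro t x s y η hη hd
    obtain ⟨ζ, hζ⟩ := hφ.dEta_ne_zero t x s y (-η) (neg_ne_zero.2 hη)
      (by rw [hneg s y η hη t]; exact hd)
    refine ⟨-ζ, ?_⟩
    rw [PhaseFunction.dEta_opposite]
    simpa using hζ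

/-- The homogeneous continuation of a phase function. -/
def PhaseFunction.homogeneous (φ : PhaseFunction S) (g : SpacetimeMetric S)
    (Φ : ℝ → ∀ y : S, CoTS y → ℝ → CotangentM S) (κ : (ℝ × S) × (ℝ × S) → ℝ) :
    PhaseFunction S := fun t x s y η =>
  (g.conorm s y η : ℂ) * (φ t x s y ((g.conorm s y η)⁻¹ • η) +
    Complex.I * (expNegInvGlue (κ ((Φ s y η t).1, (t, x)) - 1 / 2) : ℝ))

lemma homogeneous_smul (hΦ : g.IsLeviCivitaFlow ε Φ) {t s : ℝ} {x y : S} {η : CoTS y}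
    (hη : η ≠ 0) {l : ℝ} (hl : 0 < l) :
    φ.homogeneous g Φ κ t x s y (l • η) = (l : ℂ) * φ.homogeneous g Φ κ t x s y η := by
  have h1 : (l * g.conorm s y η)⁻¹ • l • η = (g.conorm s y η)⁻¹ • η := by
    rw [smul_smul, mul_inv, mul_right_comm, inv_mul_cancel₀ hl.ne', one_mul]
  simp only [PhaseFunction.homogeneous]
  rw [hΦ.smul hη hl, conorm_smul, abs_of_pos hl, h1]
  push_cast
  ring

omit [IsManifold 𝓘(ℝ, E3) ∞ S] [T2Space S] in
/-- A nonzero value of a homogeneous function is a nonzero radial derivative. -/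
lemma dEta_self_of_homogeneous {t s : ℝ} {x y : S} {η : CoTS y}
    (h : ∀ l : ℝ, 0 < l → φ t x s y (l • η) = (l : ℂ) * φ t x s y η) :
    φ.dEta t x s y η η = φ t x s y η := by
  have h1 : HasDerivAt (fun r : ℝ => ((1 + r : ℝ) : ℂ) * φ t x s y η) (φ t x s y η) 0 := by
    have := (((hasDerivAt_id (0 : ℝ)).const_add 1).ofReal_comp).mul_const (φ t x s y η)
    simpa using this
  refine (h1.congr_of_eventuallyEq ?_).deriv
  filter_upwards [lt_mem_nhds (show (-1 : ℝ) < 0 by norm_num)] with r hr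
  rw [← h (1 + r) (by linarith), add_smul, one_smul]

omit [T2Space S] in
-- The norm is the square root of a smooth function that is positive for nonzero covectors.
lemma contDiffAt_conormLoc (hf : f ∈ atlas E3 S) (hθ : θ ∈ paramDom f) :
    ContDiffAt ℝ ∞ (conormLoc g f) θ := by
  have hh : ∀ θ ∈ paramDom f, (hLoc g f (θ.2.1, θ.2.2.1)).IsInvertible := by
    intro θ hθ
    refine isInvertible_of_pos_diag fun u hu => by_contra fun hu' => ?_
    have := hLoc_pos g hf (p := (θ.2.1, θ.2.2.1)) hθ.1 hu'
    rw [hu] at this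
    exact lt_irrefl _ this
  have heq : ∀ θ ∈ paramDom f, conormLoc g f θ =
      √(θ.2.2.2 ((hLoc g f (θ.2.1, θ.2.2.1)).inverse θ.2.2.2)) := by
    intro θ hθ
    set v := (hLoc g f (θ.2.1, θ.2.2.1)).inverse θ.2.2.2 with hv
    have h1 : hLoc g f (θ.2.1, θ.2.2.1) v = θ.2.2.2 := (hh θ hθ).self_apply_inverse _
    have h2 : g.h θ.2.1 (f.symm θ.2.2.1) (dSymm f θ.2.2.1 v) = etaLoc f θ.2.2.1 θ.2.2.2 := by
      refine ContinuousLinearMap.ext fun u => ?_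
      obtain ⟨u, rfl⟩ := (dSymm_bijective hf hθ.1).2 u
      change hLoc g f (θ.2.1, θ.2.2.1) v u = θ.2.2.2 (dChart f _ (dSymm f θ.2.2.1 u))
      rw [h1, dChart_dSymm hf hθ.1]
    rw [conormLoc, SpacetimeMetric.conorm, ← h2, (h_isInvertible g _ _).inverse_apply_self, h2]
    change √(θ.2.2.2 (dChart f _ (dSymm f θ.2.2.1 v))) = _
    rw [dChart_dSymm hf hθ.1]
  have hev : conormLoc g f =ᶠ[𝓝 θ]
      fun θ => √(θ.2.2.2 ((hLoc g f (θ.2.1, θ.2.2.1)).inverse θ.2.2.2)) := by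
    filter_upwards [isOpen_paramDom.mem_nhds hθ] with θ' h' using heq θ' h'
  have h1 : ContDiffAt ℝ ∞ (hLoc g f) (θ.2.1, θ.2.2.1) := (contDiffOn_hLoc g hf).contDiffAt
    ((isOpen_univ.prod f.open_target).mem_nhds ⟨mem_univ _, hθ.1⟩)
  have h2 : ContDiffAt ℝ ∞ (fun θ : Param => (hLoc g f (θ.2.1, θ.2.2.1)).inverse) θ :=
    ContDiffAt.comp (g := ContinuousLinearMap.inverse) θ (hh θ hθ).contDiffAt_map_inverse
      (ContDiffAt.comp (g := hLoc g f) θ h1 (contDiffAt_snd.fst.prodMk contDiffAt_snd.snd.fst))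
  have h3 : ContDiffAt ℝ ∞ (fun θ : Param => θ.2.2.2) θ := contDiffAt_snd.snd.snd
  refine ContDiffAt.congr_of_eventuallyEq ?_ hev
  refine (h3.clm_apply (h2.clm_apply h3)).sqrt fun h0 => ?_
  have h4 := conormLoc_pos (g := g) hf hθ
  rw [heq θ hθ, h0, Real.sqrt_zero] at h4
  exact lt_irrefl _ h4

variable [CompactSpace S]

/-- The cut-off is evaluated at the moving flow point, so this relies on the smooth dependence of
the position on time and initial data. -/
lemma homogeneous_isSmooth (hφ : IsLeviCivitaPhase N Φ φ) (hΦ : g.IsLeviCivitaFlow ε Φ)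
    (hκ : ContMDiff ((𝓘(ℝ, ℝ).prod 𝓘(ℝ, E3)).prod (𝓘(ℝ, ℝ).prod 𝓘(ℝ, E3))) 𝓘(ℝ, ℝ) ∞ κ) :
    (φ.homogeneous g Φ κ).IsSmooth := by
  intro e he f hf
  rintro ⟨t, z, s, w, p⟩ ⟨hz, hw, hp⟩
  refine ContDiffAt.contDiffWithinAt ?_
  have hθ : ((t, s, w, p) : Param) ∈ paramDom f := ⟨hw, hp⟩
  let a : ℝ × E3 × ℝ × E3 × (E3 →L[ℝ] ℝ) → Param := fun q => (q.1, q.2.2)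
  have ha : ContDiff ℝ ∞ a := by fun_prop
  have hc : ContDiffAt ℝ ∞ (fun q => conormLoc g f (a q)) (t, z, s, w, p) :=
    ContDiffAt.comp (g := conormLoc g f) (f := a) _ (contDiffAt_conormLoc hf hθ) ha.contDiffAt
  have hc0 : 0 < conormLoc g f (t, s, w, p) := conormLoc_pos hf hθ
  have h1 : ContDiffAt ℝ ∞ (fun q : ℝ × E3 × ℝ × E3 × (E3 →L[ℝ] ℝ) =>
      phaseLoc φ e f ((q.1, q.2.2.1, q.2.2.2.1, (conormLoc g f (a q))⁻¹ • q.2.2.2.2), q.2.1))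
      (t, z, s, w, p) := by
    refine ContDiffAt.comp (g := phaseLoc φ e f) (t, z, s, w, p)
      (f := fun q : ℝ × E3 × ℝ × E3 × (E3 →L[ℝ] ℝ) =>
        (((q.1, q.2.2.1, q.2.2.2.1, (conormLoc g f (a q))⁻¹ • q.2.2.2.2), q.2.1) : Param × E3))
      (contDiffAt_phaseLoc hφ.smooth he hf
        ⟨hw, smul_ne_zero (inv_ne_zero hc0.ne') hp⟩ hz) ?_
    have hs := contDiffAt_fun_smul (hc.inv hc0.ne')
      (contDiffAt_snd.snd.snd.snd : ContDiffAt ℝ ∞ (fun q : ℝ × E3 × ℝ × E3 × (E3 →L[ℝ] ℝ) =>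
        q.2.2.2.2) (t, z, s, w, p))
    exact (contDiffAt_fst.prodMk (contDiffAt_snd.snd.fst.prodMk
      (contDiffAt_snd.snd.snd.fst.prodMk hs))).prodMk contDiffAt_snd.fst
  have h2 : ContDiffAt ℝ ∞ (fun q : ℝ × E3 × ℝ × E3 × (E3 →L[ℝ] ℝ) =>
      κ ((flowAt Φ f (a q)).1, (q.1, e.symm q.2.1))) (t, z, s, w, p) := by
    have hx := mem_chart_source E3 (flowAt Φ f (t, s, w, p)).1.2
    have he₀ := chart_mem_atlas E3 (flowAt Φ f (t, s, w, p)).1.2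
    generalize chartAt E3 (flowAt Φ f (t, s, w, p)).1.2 = e₀ at hx he₀
    have h3 : ContDiffAt ℝ ∞ (fun q => posLoc Φ e₀ f (a q)) (t, z, s, w, p) :=
      ContDiffAt.comp (g := posLoc Φ e₀ f) (f := a) _ (contDiffAt_posLoc hφ hΦ he₀ hf hθ hx)
        ha.contDiffAt
    have h4 := ContMDiffAt.comp (t, z, s, w, p) (contMDiffAt_symm_prod he₀
      (p := posLoc Φ e₀ f (a (t, z, s, w, p))) (e₀.map_source hx)) h3.contMDiffAt
    have h5 : ContDiffAt ℝ ∞ (fun q : ℝ × E3 × ℝ × E3 × (E3 →L[ℝ] ℝ) => (q.1, q.2.1))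
      (t, z, s, w, p) := contDiffAt_fst.prodMk contDiffAt_snd.fst
    have h6 := ContMDiffAt.comp (t, z, s, w, p) (contMDiffAt_symm_prod he
      (p := (t, z)) hz) h5.contMDiffAt
    have h7 := contMDiffAt_iff_contDiffAt.1
      (ContMDiffAt.comp (t, z, s, w, p) hκ.contMDiffAt (h4.prodMk h6))
    refine h7.congr_of_eventuallyEq ?_
    filter_upwards [ha.continuous.continuousAt.eventually
      (eventually_flowAt_mem hφ hΦ hf (θ := a (t, z, s, w, p)) hθ hx)] with q hq
    change κ ((flowAt Φ f (a q)).1, (q.1, e.symm q.2.1)) =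
      κ (ptSymm e₀ (posLoc Φ e₀ f (a q)), (q.1, e.symm q.2.1))
    rw [← ptLoc_flowAt hΦ hf hq.1, ptSymm_ptLoc hq.2]
  have h3 := (expNegInvGlue.contDiff (n := (⊤ : ℕ∞))).contDiffAt.comp (t, z, s, w, p)
    (h2.sub (contDiffAt_const (c := (1 / 2 : ℝ))))
  have h4 := Complex.ofRealCLM.contDiff.contDiffAt.comp (t, z, s, w, p) h3
  have h5 := Complex.ofRealCLM.contDiff.contDiffAt.comp (t, z, s, w, p) hc
  exact h5.mul (h1.add (contDiffAt_const.mul h4))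

/-- The homogeneous continuation is a phase function with respect to smaller normal
neighbourhoods. -/
lemma homogeneous_isLeviCivitaPhase (hφ : IsLeviCivitaPhase N Φ φ) (hΦ : g.IsLeviCivitaFlow ε Φ)
    (hκ : IsCutoff N κ)
    (hκ' : ContMDiff ((𝓘(ℝ, ℝ).prod 𝓘(ℝ, E3)).prod (𝓘(ℝ, ℝ).prod 𝓘(ℝ, E3))) 𝓘(ℝ, ℝ) ∞ κ) :
    IsLeviCivitaPhase hκ.shrink Φ (φ.homogeneous g Φ κ) := by
  have hscale : ∀ t x s y (η : CoTS y), η ≠ 0 → ((Φ s y η t).1, (t, x)) ∈ N.dom →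
      (g.conorm s y η : ℂ) * φ t x s y ((g.conorm s y η)⁻¹ • η) = φ t x s y η := by
    intro t x s y η hη hd
    have hc := conorm_pos (g := g) (s := s) hη
    rw [hφ.smul hΦ hη hd (inv_pos.2 hc), ← mul_assoc, ← Complex.ofReal_mul,
      mul_inv_cancel₀ hc.ne', Complex.ofReal_one, one_mul]
  -- Between the shrunk and the original neighbourhood `Im φ = ‖η‖ σ` is already positive. Outside
  -- the original one `Im φ ≥ 0` and `κ = 1`, so the added term is strictly positive.
  have him : ∀ t x s y (η : CoTS y), η ≠ 0 → ((Φ s y η t).1, (t, x)) ∉ hκ.shrink.dom →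
      0 < (φ.homogeneous g Φ κ t x s y η).im := by
    intro t x s y η hη hd
    have hc := conorm_pos (g := g) (s := s) hη
    have hne : (g.conorm s y η)⁻¹ • η ≠ 0 := smul_ne_zero (inv_ne_zero hc.ne') hη
    have hΦc : (Φ s y ((g.conorm s y η)⁻¹ • η) t).1 = (Φ s y η t).1 := by
      rw [hΦ.smul hη (inv_pos.2 hc)]
    have hsum : (φ.homogeneous g Φ κ t x s y η).im =
        ((g.conorm s y η : ℂ) * φ t x s y ((g.conorm s y η)⁻¹ • η)).im +
          g.conorm s y η * expNegInvGlue (κ ((Φ s y η t).1, (t, x)) - 1 / 2) := by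
      simp [PhaseFunction.homogeneous, mul_add]
    rw [hsum]
    by_cases hN : ((Φ s y η t).1, (t, x)) ∈ N.dom
    · refine add_pos_of_pos_of_nonneg ?_ (mul_nonneg hc.le (expNegInvGlue.nonneg _))
      rw [hscale t x s y η hη hN]
      by_contra hle
      have h1 := eq_of_phase_eq_zero hφ hΦ hη hN (not_lt.1 hle)
      rw [← h1] at hd
      exact hd (hκ.shrink.diag_mem _)
    · have h1 := hφ.im_nonneg t x s y _ hne (by rw [hΦc]; exact hN)
      rw [hκ.one _ _ (Or.inl hN), Complex.im_ofReal_mul]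
      exact add_pos_of_nonneg_of_pos (mul_nonneg hc.le h1)
        (mul_pos hc (expNegInvGlue.pos_of_pos (by norm_num)))
  refine ⟨homogeneous_isSmooth hφ hΦ hκ', ?_, fun t x s y η hη hd => (him t x s y η hη hd).le, ?_⟩
  · intro t x s y η hη hd
    have h1 := hκ.lt_half hd
    have h2 : expNegInvGlue (κ ((Φ s y η t).1, (t, x)) - 1 / 2) = 0 :=
      expNegInvGlue.zero_of_nonpos (by linarith)
    rw [PhaseFunction.homogeneous, h2, Complex.ofReal_zero, mul_zero, add_zero,
      hscale t x s y η hη hd.1]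
    exact hφ.formula t x s y η hη hd.1
  · intro t x s y η hη hd
    -- By Euler's relation the radial derivative equals the value, which has positive imaginary
    -- part.
    refine ⟨η, ?_⟩
    rw [dEta_self_of_homogeneous fun l hl => homogeneous_smul hΦ hη hl]
    intro h0
    have := him t x s y η hη hd
    rw [h0] at this
    exact lt_irrefl _ this

end Continuation

end LeviCivitaPhase

end

theorem lemma3p11 {S : Type*} [TopologicalSpace S] [ChartedSpace LeviCivitaPhase.E3 S]
    [IsManifold 𝓘(ℝ, LeviCivitaPhase.E3) ∞ S] [T2Space S] [CompactSpace S]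
    (g : LeviCivitaPhase.SpacetimeMetric S) (N : g.NormalNeighbourhoods)
    (Φ : ℤˣ → ℝ → ∀ y : S, LeviCivitaPhase.CoTS y → ℝ → LeviCivitaPhase.CotangentM S)
    (hΦ : ∀ ε, g.IsLeviCivitaFlow ε (Φ ε))
    (φ : ℤˣ → LeviCivitaPhase.PhaseFunction S)
    (hφ : ∀ ε, LeviCivitaPhase.IsLeviCivitaPhase N (Φ ε) (φ ε)) :
    -- (a) homogeneity, wherever the phase functions are given by their defining formula
    (∀ (ε : ℤˣ) (t : ℝ) (x : S) (s : ℝ) (y : S) (η : LeviCivitaPhase.CoTS y), η ≠ 0 →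
      ((Φ ε s y η t).1, (t, x)) ∈ N.dom →
      ∀ l : ℝ, 0 < l → φ ε t x s y (l • η) = (l : ℂ) * φ ε t x s y η) ∧
    -- (b) symmetry, likewise
    (∀ (t : ℝ) (x : S) (s : ℝ) (y : S) (η : LeviCivitaPhase.CoTS y), η ≠ 0 →
      ((Φ 1 s y η t).1, (t, x)) ∈ N.dom →
      φ 1 t x s y η = -(starRingEnd ℂ) (φ (-1) t x s y (-η))) ∧
    -- the continuations can be chosen so that (a) and (b) hold everywhere
    (∃ (N' : g.NormalNeighbourhoods) (ψ : ℤˣ → LeviCivitaPhase.PhaseFunction S),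
      N'.dom ⊆ N.dom ∧ (∀ Z X, (Z, X) ∈ N'.dom → N'.log Z X = N.log Z X) ∧
      (∀ ε, LeviCivitaPhase.IsLeviCivitaPhase N' (Φ ε) (ψ ε)) ∧
      (∀ (ε : ℤˣ) (t : ℝ) (x : S) (s : ℝ) (y : S) (η : LeviCivitaPhase.CoTS y), η ≠ 0 →
        ∀ l : ℝ, 0 < l → ψ ε t x s y (l • η) = (l : ℂ) * ψ ε t x s y η) ∧
      (∀ (t : ℝ) (x : S) (s : ℝ) (y : S) (η : LeviCivitaPhase.CoTS y), η ≠ 0 →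
        ψ 1 t x s y η = -(starRingEnd ℂ) (ψ (-1) t x s y (-η)))) ∧
    -- (c) behaviour along the flow
    (∀ (ε : ℤˣ) (t s : ℝ) (y : S) (η : LeviCivitaPhase.CoTS y), η ≠ 0 →
      φ ε t (Φ ε s y η t).1.2 s y η = 0 ∧
      (∀ u : LeviCivitaPhase.TS (Φ ε s y η t).1.2,
        (φ ε).dX t (Φ ε s y η t).1.2 s y η u = (((Φ ε s y η t).2 (0, u) : ℝ) : ℂ)) ∧
      ∀ (b : Module.Basis (Fin 3) ℝ (LeviCivitaPhase.TS (Φ ε s y η t).1.2))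
        (c : Module.Basis (Fin 3) ℝ (LeviCivitaPhase.CoTS y)),
        ((φ ε).mixedHessian t (Φ ε s y η t).1.2 s y η b c).det ≠ 0) := by
  refine ⟨fun ε t x s y η hη hd l hl => (hφ ε).smul (hΦ ε) hη hd hl,
    fun t x s y η hη hd => (hφ 1).neg (hΦ 1) (hΦ (-1)) (hφ (-1)) hη hd, ?_,
    fun ε t s y η hη => ⟨((hφ ε).jet (hΦ ε) t s y η hη).1, ((hφ ε).jet (hΦ ε) t s y η hη).2,
      (hφ ε).det_mixedHessian_ne_zero (hΦ ε) t s y η hη⟩⟩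
  obtain ⟨κ, hκ, hκ'⟩ := LeviCivitaPhase.exists_isCutoff N
  have hψ := LeviCivitaPhase.homogeneous_isLeviCivitaPhase (hφ 1) (hΦ 1) hκ hκ'
  let ψ₁ := (φ 1).homogeneous g (Φ 1) κ
  have hne : (-1 : ℤˣ) ≠ 1 := by decide
  -- Only the positive phase function is continued; the negative one is its opposite, so the
  -- symmetry (b) holds by definition.
  let ψ : ℤˣ → LeviCivitaPhase.PhaseFunction S := fun ε => if ε = 1 then ψ₁ else ψ₁.opposite
  have hpos : ψ 1 = ψ₁ := if_pos rfl
  have hneg : ψ (-1) = ψ₁.opposite := if_neg hne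
  refine ⟨hκ.shrink, ψ, fun _ h => h.1,
    fun _ _ _ => rfl, fun ε => ?_, fun ε t x s y η hη l hl => ?_, fun t x s y η _ => ?_⟩
  · rcases Int.units_eq_one_or ε with rfl | rfl
    · rw [hpos]
      exact hψ
    · rw [hneg]
      exact hψ.opposite (hΦ 1) (hΦ (-1))
  · rcases Int.units_eq_one_or ε with rfl | rfl
    · rw [hpos]
      exact LeviCivitaPhase.homogeneous_smul (hΦ 1) hη hl
    · rw [hneg]
      exact LeviCivitaPhase.PhaseFunction.opposite_smul
        (LeviCivitaPhase.homogeneous_smul (hΦ 1) (neg_ne_zero.2 hη) hl)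
  · rw [hpos, hneg]
    simp [LeviCivitaPhase.PhaseFunction.opposite]
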